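/- Let $M$ and $N$ be oriented Riemannian manifolds with their volume measures (more generally, arbitrary $\sigma$-finite measure spaces), and let $X=M\times N$ carry the product measure. Let $H$, $K$, $L$ be (possibly unbounded) self-adjoint operators on $L^2(M)$, $L^2(N)$, $L^2(X)$ respectively, such that $L$ is the sum of $H$ and $K$ in the following sense: for all $f$ in some subset of $D(H)$ and all $g$ in some subset of $D(K)$, these subsets being dense in the domains for the graph norms, the function $f(x)g(y)$ belongs to $D(L)$ and $L(f(x)g(y))=(Hf)(x)\,g(y)+f(x)\,(Kg)(y)$. Let $e^{itH}$, $e^{itK}$, $e^{itL}$ be the strongly continuous unitary groups with generators $iH$, $iK$, $iL$. Let $I\subseteq\mathbb R$ be a finite or infinite interval with $0\in\overline I$, let $a,b\ge 0$ be real, and assume that there is a constant $C_0$ such that for all $t\in I$, $t\ne0$, $$\|e^{itH}\phi\|_{L^\infty(M)}\le C_0|t|^{-a}\|\phi\|_{L^1(M)}\quad(\phi\in L^1\cap L^2(M)),\qquad \|e^{itK}\psi\|_{L^\infty(N)}\le C_0|t|^{-b}\|\psi\|_{L^1(N)}\quad(\psi\in L^1\cap L^2(N)).$$ Put $\sigma=a+b$.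 A couple $(p,q)$ is called admissible if $\frac1p+\frac{\sigma}{q}=\frac{\sigma}{2}$ and either $\sigma>1$, $2\le p\le\infty$, $2\le q\le\frac{2\sigma}{\sigma-1}$, or $0<\sigma\le1$, $\frac2\sigma<p\le\infty$, $2\le q<\infty$ (so for $\sigma>1$ the endpoint $\left(2,\frac{2\sigma}{\sigma-1}\right)$ is included). Write $q'$ for the dual exponent of $q$ and $$\|F\|_{L^p_IL^q}=\Bigl(\int_I\Bigl(\int_X|F(t,x,y)|^q\,dV\Bigr)^{p/q}dt\Bigr)^{1/p},$$ with the usual modification for $p=\infty$. Then: 1. for every admissible couple $(p,q)$ there is a constant $C$ such that $\|e^{itL}f\|_{L^p_IL^q}\le C\|f\|_{L^2(X)}$ for all $f\in L^2(X)$; 2. for all admissible couples $(p,q)$ and $(\tilde p,\tilde q)$ there is a constant $C$ such that for all $F\in L^{\tilde p'}_IL^{\tilde q'}$ the integral $\int_0^te^{i(t-s)L}F(s)\,ds$ exists for every $t\in I$ as a weak integral in $L^2(X)$ (that is, tested against every $g\in L^2(X)$, with $e^{i(t-s)L}$ moved to $g$ as its adjoint), and $$\Bigl\|\int_0^te^{i(t-s)L}F(s)\,ds\Bigr\|_{L^p_IL^q}\le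 C\,\|F\|_{L^{\tilde p'}_IL^{\tilde q'}}.$$ -/

import Mathlib

open MeasureTheory
open scoped ENNReal NNReal ComplexConjugate

noncomputable section

/-- `U` is the Schrödinger flow `t ↦ e^{itA}` of the (unbounded) operator `A`: the strongly
continuous one-parameter unitary group whose infinitesimal generator is exactly `iA`, that is,
`f ∈ D(A)` and `A f = g` if and only if `t ↦ U t f` is differentiable at `0` with
derivative `i g`. For self-adjoint `A` there is exactly one such `U`. -/
structure IsSchrodingerFlow {E : Type*} [NormedAddCommGroup E] [InnerProductSpace ℂ E]
    [CompleteSpace E] (A : E →ₗ.[ℂ] E) (U : ℝ → E →L[ℂ] E) : Prop where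
  unitary : ∀ t, U t ∈ unitary (E →L[ℂ] E)
  zero : U 0 = 1
  add : ∀ s t, U (s + t) = U s * U t
  continuous : ∀ f, Continuous fun t => U t f
  generator : ∀ f g : E, (f, g) ∈ A.graph ↔ HasDerivAt (fun t => U t f) (Complex.I • g) 0

/-- `D` is a dense subset of the domain of `A`, for the graph norm. -/
def IsDenseInDomain {E : Type*} [NormedAddCommGroup E] [InnerProductSpace ℂ E]
    (A : E →ₗ.[ℂ] E) (D : Set A.domain) : Prop :=
  ∀ f : A.domain, ((f : E), A f) ∈ closure ((fun u : A.domain => ((u : E), A u)) '' D)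

/-- The operator `L` on `L²(M × N)` is the sum of `H` on `L²(M)` and `K` on `L²(N)`: for `f` in
a dense subset of `D(H)` and `g` in a dense subset of `D(K)`, the function `f(x) g(y)` is in
`D(L)` and `L (f(x) g(y)) = (H f)(x) g(y) + f(x) (K g)(y)`. -/
def IsSumOperator {M N : Type*} [MeasurableSpace M] [MeasurableSpace N]
    {μ : Measure M} {ν : Measure N}
    (H : Lp ℂ 2 μ →ₗ.[ℂ] Lp ℂ 2 μ) (K : Lp ℂ 2 ν →ₗ.[ℂ] Lp ℂ 2 ν)
    (L : Lp ℂ 2 (μ.prod ν) →ₗ.[ℂ] Lp ℂ 2 (μ.prod ν)) : Prop :=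
  ∃ (DH : Set H.domain) (DK : Set K.domain),
    IsDenseInDomain H DH ∧ IsDenseInDomain K DK ∧
    ∀ f ∈ DH, ∀ g ∈ DK, ∃ w : L.domain,
      ((w : Lp ℂ 2 (μ.prod ν)) =ᵐ[μ.prod ν]
        fun z => (f : Lp ℂ 2 μ) z.1 * (g : Lp ℂ 2 ν) z.2) ∧
      (L w =ᵐ[μ.prod ν]
        fun z => H f z.1 * (g : Lp ℂ 2 ν) z.2 + (f : Lp ℂ 2 μ) z.1 * K g z.2)

/-- The dispersive estimate `‖U(t) φ‖_{L^r} ≤ C |t|^{-a} ‖φ‖_{L^r'}` for `0 ≠ t ∈ I` and all `φ`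
in `L² ∩ L^r'`, with `C` independent of `t` and `φ`. -/
def DispersiveEstimate {X : Type*} [MeasurableSpace X] {μ : Measure X}
    (U : ℝ → Lp ℂ 2 μ →L[ℂ] Lp ℂ 2 μ) (I : Set ℝ) (a : ℝ) (r r' : ℝ≥0∞) : Prop :=
  ∃ C : ℝ≥0, ∀ t ∈ I, t ≠ 0 → ∀ φ : Lp ℂ 2 μ, MemLp φ r' μ →
    eLpNorm (U t φ) r μ ≤ C * ENNReal.ofReal (|t| ^ (-a)) * eLpNorm φ r' μ

/-- The couple `(p, q)` is admissible with respect to the index `σ`. -/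
def IsAdmissible (σ : ℝ) (p q : ℝ≥0∞) : Prop :=
  p⁻¹.toReal + σ * q⁻¹.toReal = σ / 2 ∧
    ((1 < σ ∧ 2 ≤ p ∧ 2 ≤ q ∧ q ≤ ENNReal.ofReal (2 * σ / (σ - 1))) ∨
      (0 < σ ∧ σ ≤ 1 ∧ ENNReal.ofReal (2 / σ) < p ∧ 2 ≤ q ∧ q < ∞))

/-- The norm of `L^p_I L^q`: the `L^p` norm over `t ∈ I` of the `L^q(X)` norm of `F(t)`. -/
def mixedNorm {X : Type*} [MeasurableSpace X] (μ : Measure X) (I : Set ℝ) (p q : ℝ≥0∞)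
    (F : ℝ → X → ℂ) : ℝ≥0∞ :=
  eLpNorm (fun t => eLpNorm (F t) q μ) p (volume.restrict I)

/-- `v = ∫₀ᵗ U(t - s) F(s) ds`, as a weak integral in `L²(X)`: for every `g ∈ L²(X)`,
`⟨g, v⟩ = ∫₀ᵗ ⟨U(t - s)* g, F(s)⟩ ds`, all integrals being absolutely convergent; here
`U(t - s)* = U(s - t)` because `U` is a unitary group, and `⟨h, k⟩` is the integral of
`conj h * k` over `X`. This makes sense for `F(s)` which need not belong to `L²(X)`; it
determines `v`, and it is the Bochner integral when `s ↦ F(s)` is integrable in `L²(X)`. -/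
def IsDuhamelIntegral {X : Type*} [MeasurableSpace X] {μ : Measure X}
    (U : ℝ → Lp ℂ 2 μ →L[ℂ] Lp ℂ 2 μ) (F : ℝ → X → ℂ) (t : ℝ) (v : Lp ℂ 2 μ) : Prop :=
  ∀ g : Lp ℂ 2 μ,
    (∀ᵐ s ∂(volume.restrict (Set.uIoc 0 t)),
      Integrable (fun z => conj (U (s - t) g z) * F s z) μ) ∧
    IntervalIntegrable (fun s => ∫ z, conj (U (s - t) g z) * F s z ∂μ) volume 0 t ∧
    inner ℂ g v = ∫ s in (0 : ℝ)..t, ∫ z, conj (U (s - t) g z) * F s z ∂μ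

end

/-!
The flow of `L` is the tensor product of the flows of `H` and `K` (`IsSchrodingerFlow.apply_tensor`):
as `L` is closed, the identity defining the sum extends to all `f ∈ D(H)` and `g ∈ D(K)`
(`IsSumOperator.tensor_mem_graph`), so that the tensor product of two orbits solves the equation
`y' = i L y`, whose solutions are unique. The adjoint of a tensor product of operators is tested against
indicator functions of rectangles, and a function is bounded as soon as its averages over rectangles
are; hence dispersive estimates multiply (`enorm_inner_le_of_apply_tensor`), and the flow of `L`
satisfies one with rate `|t| ^ (-(a + b))`. From there on the product structure plays no role, and the
proof is the abstract theory of Strichartz estimates with `σ = a + b`.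

The theory is formulated for families `V t` of contractions from `L²(X)` to a Hilbert space, for which
`⟨V s φ, V t ψ⟩` satisfies a dispersive estimate for `s` and `t` in a set `J` of times
(`IsDispersive`). For a flow one takes `V t = U (-t)`, with adjoint `U t`. As `0` is in the closure of
the interval `I`, differences of positive times of `I` are in `I` up to sign, and so are differences
of negative times; the two cases are treated separately. All estimates are proved for bounded functions
on sets of finite measure (`IsTest`) and then extended by duality and density.

The dual estimate `‖∫ V t (F t) dt‖ ≤ C ‖F‖` in `L^p' L^q'` is conservation of energy for `p = ∞`. For
`2 < p < ∞` one expands the square of the left side. The dispersive and the energy bound are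
interpolated by splitting functions along their dyadic levels (`IsTest.exists_atoms`,
`IsDispersive.exists_enorm_inner_push_le_rpow`), and the time integral is the Hardy–Littlewood–Sobolev
inequality (`exists_lintegral_lintegral_abs_rpow_le`), proved by the same kind of splitting. At the
endpoint `p = 2` the argument is that of Keel and Tao
(`IsDispersive.exists_enorm_pairing_lt_le_two`): the pairs of times at distance about `2 ^ j` are treated
separately, and for atoms on sets of measures about `2 ^ k` and `2 ^ l` there is a bound which decays
exponentially away from `k = l = j σ`, so that the sum over all `j`, `k`, `l` converges. It uses the
dispersive bound or an estimate in time windows of length `2 ^ j`; the latter only needs the local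
integrability of `|τ| ^ (-1/2)`, in place of the estimates with neighbouring exponents.

The homogeneous estimate is the dual one (`IsDispersive.mixedNorm_adjoint_le`). With Hölder's inequality
and the Riesz representation theorem it also provides the weak integrals of `V s (F s)`
(`exists_weak_integral`). For the inhomogeneous estimate one needs the bilinear form
`∫∫ ⟨V s (F s), V t (G t)⟩ ds dt` over the pairs with `s < t`. If both couples are endpoints this is the
bilinear form treated by the argument of Keel and Tao; otherwise the restriction `s < t` is
removed by the Christ–Kiselev lemma (`IsDispersive.exists_enorm_pairing_lt_le`), proved by successive
bisection of the time axis. Duality (`mixedNorm_le_of_forall_test`) and approximation of `F` by test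
functions then give the estimate for the Duhamel integral (`IsDispersive.exists_inhomogeneous`).
-/

open Filter Topology

/-! ### Geometric sums and Schur's test -/

/-- A two-sided geometric series centred at an arbitrary real `x` is bounded independently of `x`. -/
theorem exists_tsum_two_rpow_le {δ : ℝ} (hδ : 0 < δ) :
    ∃ C : ℝ≥0∞, C ≠ ∞ ∧ ∀ x : ℝ, ∑' m : ℤ, (2 : ℝ≥0∞) ^ (-δ * |(m : ℝ) - x|) ≤ C := by
  set r : ℝ := (2 : ℝ) ^ (-δ) with hr
  have hr0 : 0 < r := by positivity
  have hr1 : r < 1 := Real.rpow_lt_one_of_one_lt_of_neg (by norm_num) (by linarith)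
  have hsum : Summable fun m : ℤ => (2 : ℝ) ^ (-δ * |(m : ℝ)|) := by
    have key : Summable fun n : ℕ => (2 : ℝ) ^ (-δ * |((n : ℤ) : ℝ)|) := by
      refine (summable_geometric_of_lt_one hr0.le hr1).congr fun n => ?_
      rw [hr, ← Real.rpow_natCast, ← Real.rpow_mul (by norm_num)]
      simp
    refine Summable.of_nat_of_neg key ?_
    refine key.congr fun n => ?_
    simp
  refine ⟨(2 : ℝ≥0∞) ^ δ * ∑' m : ℤ, ENNReal.ofReal ((2 : ℝ) ^ (-δ * |(m : ℝ)|)), ?_, fun x => ?_⟩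
  · exact ENNReal.mul_ne_top (by simp [ENNReal.rpow_eq_top_iff]) hsum.tsum_ofReal_ne_top
  · rw [← ENNReal.tsum_mul_left, ← (Equiv.addRight ⌊x⌋).tsum_eq]
    refine ENNReal.tsum_le_tsum fun m => ?_
    have h2 : ENNReal.ofReal ((2 : ℝ) ^ (-δ * |(m : ℝ)|)) = (2 : ℝ≥0∞) ^ (-δ * |(m : ℝ)|) := by
      rw [← ENNReal.ofReal_rpow_of_pos (by norm_num)]; simp
    rw [h2, ← ENNReal.rpow_add _ _ (by norm_num) (by norm_num)]
    refine ENNReal.rpow_le_rpow_of_exponent_le (by norm_num) ?_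
    have h3 : |(m : ℝ)| ≤ |((m + ⌊x⌋ : ℤ) : ℝ) - x| + 1 := by
      have h4 : |Int.fract x| ≤ 1 := by
        rw [abs_of_nonneg (Int.fract_nonneg x)]; exact (Int.fract_lt_one x).le
      have : (m : ℝ) = (((m + ⌊x⌋ : ℤ) : ℝ) - x) + Int.fract x := by
        push_cast; rw [Int.fract]; ring
      calc |(m : ℝ)| = |(((m + ⌊x⌋ : ℤ) : ℝ) - x) + Int.fract x| := by rw [← this]
        _ ≤ _ := (abs_add_le _ _).trans (by linarith)
    simp only [Equiv.coe_addRight]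
    nlinarith

/-- Schur's test for a nonnegative kernel with bounded row and column integrals. -/
theorem lintegral_lintegral_schur {S T : Type*} [MeasurableSpace S] [MeasurableSpace T]
    {m : Measure S} {n : Measure T} [SFinite m] [SFinite n] {w : S → T → ℝ≥0∞}
    {c : S → ℝ≥0∞} {d : T → ℝ≥0∞}
    (hw : Measurable (Function.uncurry w)) (hc : Measurable c) (hd : Measurable d)
    {C₁ C₂ : ℝ≥0∞} (h₁ : ∀ s, ∫⁻ t, w s t ∂n ≤ C₁) (h₂ : ∀ t, ∫⁻ s, w s t ∂m ≤ C₂) :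
    ∫⁻ s, ∫⁻ t, w s t * (c s * d t) ∂n ∂m ≤
      (C₁ * ∫⁻ s, c s ^ 2 ∂m) ^ (1 / 2 : ℝ) * (C₂ * ∫⁻ t, d t ^ 2 ∂n) ^ (1 / 2 : ℝ) := by
  have hw' : Measurable fun z : S × T => w z.1 z.2 := hw
  have hm1 : Measurable fun z : S × T => w z.1 z.2 ^ (1 / 2 : ℝ) * c z.1 := by fun_prop
  have hm2 : Measurable fun z : S × T => w z.1 z.2 ^ (1 / 2 : ℝ) * d z.2 := by fun_prop
  have hsq : ∀ a b : ℝ≥0∞, (a ^ (1 / 2 : ℝ) * b) ^ (2 : ℝ) = a * b ^ 2 := fun a b => by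
    rw [ENNReal.mul_rpow_of_nonneg _ _ (by norm_num), ← ENNReal.rpow_mul]; norm_num
  have hsq' : ∀ a : ℝ≥0∞, a ^ (1 / 2 : ℝ) * a ^ (1 / 2 : ℝ) = a := fun a => by
    rw [← ENNReal.rpow_add_of_nonneg _ _ (by norm_num) (by norm_num)]; norm_num
  have key := ENNReal.lintegral_mul_le_Lp_mul_Lq (m.prod n) Real.HolderConjugate.two_two
    hm1.aemeasurable hm2.aemeasurable
  have e0 : ∫⁻ z, ((fun z : S × T => w z.1 z.2 ^ (1 / 2 : ℝ) * c z.1) *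
      fun z : S × T => w z.1 z.2 ^ (1 / 2 : ℝ) * d z.2) z ∂m.prod n =
      ∫⁻ s, ∫⁻ t, w s t * (c s * d t) ∂n ∂m := by
    rw [lintegral_prod _ (hm1.mul hm2).aemeasurable]
    refine lintegral_congr fun s => lintegral_congr fun t => ?_
    simp only [Pi.mul_apply]
    rw [mul_mul_mul_comm, hsq']
  have e1 : ∫⁻ z : S × T, (w z.1 z.2 ^ (1 / 2 : ℝ) * c z.1) ^ (2 : ℝ) ∂m.prod n
      ≤ C₁ * ∫⁻ s, c s ^ 2 ∂m := by
    simp only [hsq]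
    rw [lintegral_prod _ (by fun_prop), ← lintegral_const_mul _ (by fun_prop)]
    refine lintegral_mono fun s => ?_
    simp only
    rw [lintegral_mul_const _ (by fun_prop)]
    gcongr
    exact h₁ s
  have e2 : ∫⁻ z : S × T, (w z.1 z.2 ^ (1 / 2 : ℝ) * d z.2) ^ (2 : ℝ) ∂m.prod n
      ≤ C₂ * ∫⁻ t, d t ^ 2 ∂n := by
    simp only [hsq]
    rw [lintegral_prod_symm _ (by fun_prop), ← lintegral_const_mul _ (by fun_prop)]
    refine lintegral_mono fun t => ?_
    simp only
    rw [lintegral_mul_const _ (by fun_prop)]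
    gcongr
    exact h₂ t
  rw [e0] at key
  exact key.trans (by gcongr)

theorem tsum_tsum_schur {w : ℤ → ℤ → ℝ≥0∞} {c d : ℤ → ℝ≥0∞} {C : ℝ≥0∞}
    (h₁ : ∀ k, ∑' l, w k l ≤ C) (h₂ : ∀ l, ∑' k, w k l ≤ C) :
    ∑' k, ∑' l, w k l * (c k * d l) ≤
      C * (∑' k, c k ^ 2) ^ (1 / 2 : ℝ) * (∑' l, d l ^ 2) ^ (1 / 2 : ℝ) := by
  have key := lintegral_lintegral_schur (m := Measure.count) (n := Measure.count) (w := w)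
    (c := c) (d := d) (C₁ := C) (C₂ := C) (measurable_of_countable _) (measurable_of_countable _)
    (measurable_of_countable _)
    (by simpa only [lintegral_count] using h₁) (by simpa only [lintegral_count] using h₂)
  simp only [lintegral_count] at key
  refine key.trans_eq ?_
  rw [ENNReal.mul_rpow_of_nonneg _ _ (by norm_num), ENNReal.mul_rpow_of_nonneg _ _ (by norm_num),
    mul_mul_mul_comm, ← ENNReal.rpow_add_of_nonneg _ _ (by norm_num) (by norm_num)]
  norm_num
  ring

/-- The inclusion `ℓ^p ⊆ ℓ^2` for `p ≤ 2`. -/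
theorem tsum_sq_le_rpow {ι : Type*} {c : ι → ℝ≥0∞} {p : ℝ} (hp : 0 < p) (hp2 : p ≤ 2) :
    ∑' k, c k ^ 2 ≤ (∑' k, c k ^ p) ^ (2 / p) := by
  set M := ∑' k, c k ^ p with hM
  have hk : ∀ k, c k ^ p ≤ M := fun k => ENNReal.le_tsum k
  have h : ∀ k, c k ^ 2 ≤ M ^ (2 / p - 1) * c k ^ p := fun k => by
    have : c k ^ 2 = (c k ^ p) ^ (2 / p - 1) * c k ^ p := by
      rw [← ENNReal.rpow_mul, ← ENNReal.rpow_add_of_nonneg, ← ENNReal.rpow_natCast]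
      · congr 1; field_simp; push_cast; ring
      · have : 1 ≤ 2 / p := by rwa [le_div_iff₀ hp, one_mul]
        have := mul_nonneg hp.le (sub_nonneg.2 this)
        linarith
      · exact hp.le
    rw [this]
    gcongr
    · rw [sub_nonneg, le_div_iff₀ hp, one_mul]; exact hp2
    · exact hk k
  calc ∑' k, c k ^ 2 ≤ ∑' k, M ^ (2 / p - 1) * c k ^ p := ENNReal.tsum_le_tsum h
    _ = M ^ (2 / p - 1) * M := by rw [ENNReal.tsum_mul_left]
    _ = M ^ (2 / p) := by
      conv_lhs => rw [← ENNReal.rpow_one M, ← ENNReal.rpow_mul, one_mul]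
      rw [← ENNReal.rpow_add_of_nonneg _ _ _ zero_le_one]
      · congr 1; ring
      · rw [sub_nonneg, le_div_iff₀ hp, one_mul]; exact hp2

theorem min_le_rpow_mul_rpow (a b : ℝ≥0∞) {θ : ℝ} (h0 : 0 ≤ θ) (h1 : θ ≤ 1) :
    min a b ≤ a ^ θ * b ^ (1 - θ) := by
  calc min a b = (min a b) ^ θ * (min a b) ^ (1 - θ) := by
        rw [← ENNReal.rpow_add_of_nonneg _ _ h0 (by linarith)]; simp
    _ ≤ _ := mul_le_mul' (ENNReal.rpow_le_rpow (min_le_left _ _) h0)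
        (ENNReal.rpow_le_rpow (min_le_right _ _) (by linarith))

/-! ### Dyadic levels of a function -/

section Level

variable {Y : Type*} [MeasurableSpace Y] {μ : Measure Y}

/-- The decreasing rearrangement of `f` at `2 ^ k`: the least height `lam` such that `f` exceeds
`lam` on a set of measure at most `2 ^ k`. -/
noncomputable def level (μ : Measure Y) (f : Y → ℝ≥0∞) (k : ℤ) : ℝ≥0∞ :=
  sInf {lam : ℝ≥0∞ | μ {x | lam < f x} ≤ (2 : ℝ≥0∞) ^ (k : ℝ)}

theorem level_le {f : Y → ℝ≥0∞} {k : ℤ} {lam : ℝ≥0∞}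
    (h : μ {x | lam < f x} ≤ (2 : ℝ≥0∞) ^ (k : ℝ)) : level μ f k ≤ lam := sInf_le h

theorem measure_level_lt_le (f : Y → ℝ≥0∞) (k : ℤ) :
    μ {x | level μ f k < f x} ≤ (2 : ℝ≥0∞) ^ (k : ℝ) := by
  set S := {lam : ℝ≥0∞ | μ {x | lam < f x} ≤ (2 : ℝ≥0∞) ^ (k : ℝ)} with hS
  have hne : S.Nonempty := ⟨∞, by simp [hS]⟩
  obtain ⟨u, hu, -, hulim, huS⟩ := exists_seq_tendsto_sInf hne (OrderBot.bddBelow S) |>.imp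
    fun u h => (⟨h.1, trivial, h.2.1, h.2.2⟩ : Antitone u ∧ True ∧ _ ∧ _)
  have hU : {x | level μ f k < f x} = ⋃ n, {x | u n < f x} := by
    ext x
    simp only [Set.mem_ofPred_eq, Set.mem_iUnion]
    constructor
    · intro hx
      exact (hulim.eventually (gt_mem_nhds hx)).exists
    · rintro ⟨n, hn⟩
      exact (sInf_le (huS n)).trans_lt hn
  have hmono : Monotone fun n => {x | u n < f x} := fun i j hij x hx => (hu hij).trans_lt hx
  rw [hU, hmono.measure_iUnion]
  exact iSup_le huS

theorem le_level_iff {f : Y → ℝ≥0∞} {k : ℤ} {lam : ℝ≥0∞} :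
    level μ f k ≤ lam ↔ μ {x | lam < f x} ≤ (2 : ℝ≥0∞) ^ (k : ℝ) :=
  ⟨fun h => (measure_mono fun _ hx => h.trans_lt hx).trans (measure_level_lt_le f k), level_le⟩

theorem level_antitone (f : Y → ℝ≥0∞) : Antitone (level μ f) := fun k l hkl =>
  level_le ((measure_level_lt_le f k).trans
    (ENNReal.rpow_le_rpow_of_exponent_le (by norm_num) (by exact_mod_cast hkl)))

theorem level_le_of_forall_le {f : Y → ℝ≥0∞} {B : ℝ≥0∞} (h : ∀ x, f x ≤ B) (k : ℤ) :
    level μ f k ≤ B := by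
  refine level_le ?_
  have : {x | B < f x} = ∅ := by ext x; simp [h x]
  simp [this]

theorem measurable_level {T : Type*} [MeasurableSpace T] [SFinite μ] {f : T → Y → ℝ≥0∞}
    (hf : Measurable (Function.uncurry f)) (k : ℤ) : Measurable fun t => level μ (f t) k := by
  refine measurable_of_Iic fun lam => ?_
  have : (fun t => level μ (f t) k) ⁻¹' Set.Iic lam =
      {t | μ (Prod.mk t ⁻¹' {z : T × Y | lam < Function.uncurry f z}) ≤ (2 : ℝ≥0∞) ^ (k : ℝ)} := by
    ext t
    exact le_level_iff
  rw [this]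
  exact measurableSet_le (measurable_measure_prodMk_left (measurableSet_lt measurable_const hf))
    measurable_const

/-- The levels at the powers of two control the `L^p` norm: by the layer cake formula it suffices to
compare, for each height `t`, the sum of those `2 ^ k` whose level exceeds `t` with the measure of
`{t < f}`. The constant does not depend on `f` or on the space. -/
theorem exists_tsum_level_rpow_le :
    ∃ C : ℝ≥0∞, C ≠ ∞ ∧ ∀ {Y : Type*} [MeasurableSpace Y] (μ : Measure Y) (f : Y → ℝ≥0∞)
      {B : ℝ≥0∞} {p : ℝ}, Measurable f → B ≠ ∞ → (∀ x, f x ≤ B) → 0 < p →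
      ∑' k : ℤ, (2 : ℝ≥0∞) ^ (k : ℝ) * level μ f k ^ p ≤ C * ∫⁻ x, f x ^ p ∂μ := by
  obtain ⟨C, hC, hgeom⟩ := exists_tsum_two_rpow_le one_pos
  refine ⟨C, hC, fun {Y} _ μ f B p hf hB hfB hp => ?_⟩
  set h : ℤ → ℝ≥0∞ := fun k => (2 : ℝ≥0∞) ^ (k : ℝ)
  set m : Measure ℤ := Measure.count.withDensity h
  have hlB : ∀ k, level μ f k ≠ ∞ := fun k => ne_top_of_le_ne_top hB (level_le_of_forall_le hfB k)
  have hfB' : ∀ x, f x ≠ ∞ := fun x => ne_top_of_le_ne_top hB (hfB x)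
  have e1 : ∑' k : ℤ, (2 : ℝ≥0∞) ^ (k : ℝ) * level μ f k ^ p =
      ∫⁻ k, ENNReal.ofReal ((level μ f k).toReal ^ p) ∂m := by
    rw [lintegral_withDensity_eq_lintegral_mul _ (measurable_of_countable _)
      (measurable_of_countable _), lintegral_count]
    refine tsum_congr fun k => ?_
    simp only [Pi.mul_apply]
    rw [← ENNReal.ofReal_rpow_of_nonneg ENNReal.toReal_nonneg hp.le, ENNReal.ofReal_toReal (hlB k)]
  have e2 : ∫⁻ x, f x ^ p ∂μ = ∫⁻ x, ENNReal.ofReal ((f x).toReal ^ p) ∂μ := by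
    refine lintegral_congr fun x => ?_
    rw [← ENNReal.ofReal_rpow_of_nonneg ENNReal.toReal_nonneg hp.le, ENNReal.ofReal_toReal (hfB' x)]
  rw [e1, e2, lintegral_rpow_eq_lintegral_meas_lt_mul _ (ae_of_all _ fun _ => ENNReal.toReal_nonneg)
    (measurable_of_countable _).aemeasurable hp,
    lintegral_rpow_eq_lintegral_meas_lt_mul _ (ae_of_all _ fun _ => ENNReal.toReal_nonneg)
    hf.ennreal_toReal.aemeasurable hp, mul_left_comm]
  gcongr
  rw [← lintegral_const_mul' _ _ hC]
  refine setLIntegral_mono' measurableSet_Ioi fun t ht => ?_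
  rw [← mul_assoc]
  gcongr
  -- the levels above `t` have `2 ^ k < μ {t < f}`
  have hset : {x | t < (f x).toReal} = {x | ENNReal.ofReal t < f x} := by
    ext x; exact (ENNReal.ofReal_lt_iff_lt_toReal (le_of_lt ht) (hfB' x)).symm
  rw [hset]
  set M := μ {x | ENNReal.ofReal t < f x} with hM
  have hk : ∀ k : ℤ, t < (level μ f k).toReal → (2 : ℝ≥0∞) ^ (k : ℝ) < M := fun k hk => by
    rw [← ENNReal.ofReal_lt_iff_lt_toReal (le_of_lt ht) (hlB k)] at hk
    by_contra hcon
    exact absurd (level_le (not_lt.1 hcon)) (not_le.2 hk)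
  have e3 : m {k | t < (level μ f k).toReal} ≤
      ∑' k : ℤ, {k : ℤ | (2 : ℝ≥0∞) ^ (k : ℝ) < M}.indicator h k := by
    rw [withDensity_apply _ (measurableSet_lt measurable_const (measurable_of_countable _)),
      ← lintegral_indicator (measurableSet_lt measurable_const (measurable_of_countable _)),
      lintegral_count]
    refine ENNReal.tsum_le_tsum fun k => Set.indicator_le_indicator_of_subset hk (fun _ => zero_le) k
  refine e3.trans ?_
  rcases eq_or_ne M ∞ with hMt | hMt
  · have hC0 : C ≠ 0 := by
      intro h0
      have := (ENNReal.le_tsum (f := fun m : ℤ => (2 : ℝ≥0∞) ^ (-1 * |(m : ℝ) - 0|)) 0).trans (hgeom 0)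
      simp [h0] at this
    rw [hMt, ENNReal.mul_top hC0]
    exact le_top
  rcases eq_or_ne M 0 with hM0 | hM0
  · simp [hM0]
  have hM' : 0 < M.toReal := ENNReal.toReal_pos hM0 hMt
  obtain ⟨x, hMx⟩ : ∃ x : ℝ, M = (2 : ℝ≥0∞) ^ x := by
    refine ⟨Real.logb 2 M.toReal, ?_⟩
    have : (2 : ℝ≥0∞) = ENNReal.ofReal 2 := by simp
    rw [this, ENNReal.ofReal_rpow_of_pos (by norm_num), Real.rpow_logb (by norm_num) (by norm_num) hM',
      ENNReal.ofReal_toReal hMt]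
  calc _ ≤ ∑' k : ℤ, M * (2 : ℝ≥0∞) ^ (-1 * |(k : ℝ) - x|) := by
        refine ENNReal.tsum_le_tsum fun k => ?_
        by_cases hk : (2 : ℝ≥0∞) ^ (k : ℝ) < M
        swap
        · rw [Set.indicator_of_notMem (by exact hk)]
          exact zero_le
        rw [Set.indicator_of_mem (by exact hk)]
        rw [hMx] at hk ⊢
        rw [← ENNReal.rpow_add _ _ (by norm_num) (by norm_num)]
        refine ENNReal.rpow_le_rpow_of_exponent_le (by norm_num) ?_
        have : (k : ℝ) ≤ x := by
          by_contra hcon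
          exact absurd hk (not_lt.2 (ENNReal.rpow_le_rpow_of_exponent_le (by norm_num)
            (not_le.1 hcon).le))
        rw [abs_of_nonpos (by linarith)]
        linarith
    _ ≤ C * M := by rw [ENNReal.tsum_mul_left, mul_comm]; gcongr; exact hgeom _

/-- The part of the space on which `f` lies between two consecutive levels. -/
def levelSet (μ : Measure Y) (f : Y → ℝ≥0∞) (k : ℤ) : Set Y :=
  {x | level μ f (k + 1) < f x ∧ f x ≤ level μ f k}

theorem measurableSet_levelSet {f : Y → ℝ≥0∞} (hf : Measurable f) (k : ℤ) :
    MeasurableSet (levelSet μ f k) :=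
  (measurableSet_lt measurable_const hf).inter (measurableSet_le hf measurable_const)

theorem measure_levelSet_le (f : Y → ℝ≥0∞) (k : ℤ) :
    μ (levelSet μ f k) ≤ 2 * (2 : ℝ≥0∞) ^ (k : ℝ) := by
  refine (measure_mono fun x hx => hx.1).trans ((measure_level_lt_le f (k + 1)).trans_eq ?_)
  push_cast
  rw [ENNReal.rpow_add _ _ (by norm_num) (by norm_num), ENNReal.rpow_one, mul_comm]

theorem pairwise_disjoint_levelSet (f : Y → ℝ≥0∞) :
    Pairwise (Function.onFun Disjoint (levelSet μ f)) := by
  have aux : ∀ k l : ℤ, k < l → Disjoint (levelSet μ f k) (levelSet μ f l) := fun k l hkl => by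
    rw [Set.disjoint_left]
    intro x hk hl
    exact absurd (hl.2.trans (level_antitone f (Int.add_one_le_iff.2 hkl))) (not_le.2 hk.1)
  intro k l hkl
  rcases lt_or_gt_of_ne hkl with h | h
  · exact aux k l h
  · exact (aux l k h).symm

/-- If `f` lives on a set of finite measure, its levels vanish from some index on. -/
theorem exists_level_eq_zero {f : Y → ℝ≥0∞} {m : ℝ≥0∞} (hm : m ≠ ∞)
    (h : μ {x | f x ≠ 0} ≤ m) : ∃ k : ℕ, ∀ l : ℤ, (k : ℤ) ≤ l → level μ f l = 0 := by
  obtain ⟨k, hk⟩ := ENNReal.exists_nat_gt hm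
  refine ⟨k, fun l hl => le_antisymm ((level_antitone f hl).trans (level_le ?_)) zero_le⟩
  have : {x | 0 < f x} = {x | f x ≠ 0} := by ext x; exact pos_iff_ne_zero (a := f x)
  rw [this]
  refine h.trans (hk.le.trans ?_)
  push_cast
  rw [ENNReal.rpow_natCast]
  exact_mod_cast k.lt_two_pow_self.le

/-- The level sets exhaust the set where `f` does not vanish if the latter has finite measure. -/
theorem ae_exists_mem_levelSet {f : Y → ℝ≥0∞} (h : μ {x | f x ≠ 0} ≠ ∞) :
    ∀ᵐ x ∂μ, f x ≠ 0 → ∃ k, x ∈ levelSet μ f k := by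
  have h0 : μ {x | ∀ k : ℤ, level μ f k < f x} = 0 := by
    refine le_antisymm (le_of_forall_gt_imp_ge_of_dense fun ε hε => ?_) zero_le
    obtain ⟨n, hn⟩ := ENNReal.exists_inv_two_pow_lt hε.ne'
    calc μ {x | ∀ k : ℤ, level μ f k < f x} ≤ μ {x | level μ f (-n) < f x} :=
          measure_mono fun x hx => hx _
      _ ≤ (2 : ℝ≥0∞) ^ ((-n : ℤ) : ℝ) := measure_level_lt_le f _
      _ ≤ ε := by
          refine le_trans (le_of_eq ?_) hn.le
          push_cast
          rw [ENNReal.rpow_neg, ENNReal.rpow_natCast, ENNReal.inv_pow]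
  obtain ⟨K, hK⟩ := exists_level_eq_zero h le_rfl
  filter_upwards [measure_eq_zero_iff_ae_notMem.1 h0] with x hx hfx
  have hex : ∃ k : ℤ, f x ≤ level μ f k := by
    by_contra! hcon
    exact hx hcon
  obtain ⟨k, hk, hmax⟩ := Int.exists_greatest_of_bdd (P := fun k => f x ≤ level μ f k)
    ⟨K, fun z hz => by
      by_contra! hcon
      rw [hK z hcon.le] at hz
      exact hfx (le_antisymm hz zero_le)⟩ hex
  refine ⟨k, ?_, hk⟩
  by_contra! hcon
  have := hmax _ hcon
  omega

end Level

/-! ### Slices of functions of two variables -/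

theorem tendsto_eLpNorm_of_dominated {Y E : Type*} [MeasurableSpace Y] {μ : Measure Y}
    [TopologicalSpace E] [ESeminormedAddMonoid E] {p : ℝ≥0∞} (hp0 : p ≠ 0) (hp : p ≠ ∞) {f : ℕ → Y → E}
    {g : Y → ℝ≥0∞} (hf : ∀ n, AEStronglyMeasurable (f n) μ)
    (hg : eLpNorm g p μ ≠ ∞) (hfg : ∀ n, ∀ᵐ x ∂μ, ‖f n x‖ₑ ≤ g x)
    (hlim : ∀ᵐ x ∂μ, Tendsto (fun n => f n x) atTop (𝓝 0)) :
    Tendsto (fun n => eLpNorm (f n) p μ) atTop (𝓝 0) := by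
  have hp' : 0 < p.toReal := ENNReal.toReal_pos hp0 hp
  simp only [eLpNorm_eq_lintegral_rpow_enorm_toReal hp0 hp]
  have key : Tendsto (fun n => ∫⁻ x, ‖f n x‖ₑ ^ p.toReal ∂μ) atTop (𝓝 (∫⁻ _, 0 ∂μ)) := by
    refine tendsto_lintegral_of_dominated_convergence' (fun x => g x ^ p.toReal)
      (fun n => (hf n).enorm.pow_const _) (fun n => (hfg n).mono fun x hx =>
        ENNReal.rpow_le_rpow hx hp'.le) ?_ ?_
    · rw [eLpNorm_eq_lintegral_rpow_enorm_toReal hp0 hp] at hg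
      intro h
      simp only [enorm_eq_self] at hg
      rw [h, ENNReal.top_rpow_of_pos (by positivity)] at hg
      exact hg rfl
    · filter_upwards [hlim] with x hx
      have h0 : Tendsto (fun n => ‖f n x‖ₑ) atTop (𝓝 0) := by
        simpa [Function.comp_def] using (continuous_enorm.tendsto (0 : E)).comp hx
      simpa [ENNReal.zero_rpow_of_pos hp', Function.comp_def] using
        ((ENNReal.continuous_rpow_const (y := p.toReal)).tendsto 0).comp h0
  rw [lintegral_zero] at key
  have := ((ENNReal.continuous_rpow_const (y := 1 / p.toReal)).tendsto 0).comp key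
  simpa [ENNReal.zero_rpow_of_pos (inv_pos.2 hp'), Function.comp_def] using this

section Slice

variable {T X : Type*} [MeasurableSpace X] {μ : Measure X}

open Classical in
/-- The slice `F t` of a function of two variables as an element of `L²`; it is `0` if `F t` is
not square integrable. -/
noncomputable def slice (μ : Measure X) (F : T → X → ℂ) (t : T) : Lp ℂ 2 μ :=
  if h : MemLp (F t) 2 μ then h.toLp else 0

theorem slice_of_memLp {F : T → X → ℂ} {t : T} (h : MemLp (F t) 2 μ) : slice μ F t = h.toLp :=
  dif_pos h

theorem coeFn_slice {F : T → X → ℂ} {t : T} (h : MemLp (F t) 2 μ) : slice μ F t =ᵐ[μ] F t := by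
  rw [slice_of_memLp h]; exact h.coeFn_toLp

theorem measure_prodMk_inter_ne_top {S : Set X} (hSt : μ S ≠ ∞) (A : Set X) : μ (A ∩ S) ≠ ∞ :=
  ne_top_of_le_ne_top hSt (measure_mono Set.inter_subset_right)

/-- The indicator functions of the sections of a measurable set depend measurably on `t`. For
rectangles the dependence is through an indicator function, and the general case follows by the π-λ
theorem. -/
theorem stronglyMeasurable_indicatorConstLp_slice [MeasurableSpace T] {S : Set X} (hS : MeasurableSet S)
    (hSt : μ S ≠ ∞) {A : Set (T × X)} (hA : MeasurableSet A) :
    StronglyMeasurable fun t => indicatorConstLp (μ := μ) 2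
      ((measurable_prodMk_left (x := t) hA).inter hS) (measure_prodMk_inter_ne_top hSt _) (1 : ℂ) := by
  induction A, hA using MeasurableSpace.induction_on_inter generateFrom_prod.symm
    isPiSystem_prod with
  | empty => 
    convert! stronglyMeasurable_const (b := (0 : Lp ℂ 2 μ)) using 2 with t
    simp
  | basic A hA =>
    obtain ⟨P, hP, Q, hQ, rfl⟩ := hA
    have : (fun t => indicatorConstLp (μ := μ) 2
      ((measurable_prodMk_left (x := t) (hP.prod hQ)).inter hS)
      (measure_prodMk_inter_ne_top hSt _) (1 : ℂ)) = P.indicator fun _ => indicatorConstLp (μ := μ) 2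
      (MeasurableSet.inter hQ hS) (measure_prodMk_inter_ne_top hSt _) (1 : ℂ) := by
      ext1 t
      by_cases ht : t ∈ P
      · rw [Set.indicator_of_mem ht]; congr 1; ext x; simp [ht]
      · rw [Set.indicator_of_notMem ht]
        have : Prod.mk t ⁻¹' P ×ˢ Q ∩ S = ∅ := by ext x; simp [ht]
        simp [this]
    rw [this]
    exact stronglyMeasurable_const.indicator hP
  | compl A hA ih =>
    have : (fun t => indicatorConstLp (μ := μ) 2
      ((measurable_prodMk_left (x := t) hA.compl).inter hS)
      (measure_prodMk_inter_ne_top hSt _) (1 : ℂ)) = fun t => indicatorConstLp (μ := μ) 2 hS hSt (1 : ℂ) -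
      indicatorConstLp (μ := μ) 2 ((measurable_prodMk_left (x := t) hA).inter hS)
      (measure_prodMk_inter_ne_top hSt _) (1 : ℂ) := by
      ext1 t
      have hd : Disjoint (Prod.mk t ⁻¹' A ∩ S) (Prod.mk t ⁻¹' Aᶜ ∩ S) :=
        (Disjoint.preimage _ disjoint_compl_right).mono Set.inter_subset_left Set.inter_subset_left
      rw [eq_sub_iff_add_eq', ← indicatorConstLp_disjoint_union _ _ _ _ hd]
      congr 1
      ext x; simp; tauto
    rw [this]
    exact stronglyMeasurable_const.sub ih
  | iUnion f hd hf ih =>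
    have hm : ∀ n : ℕ, ∀ t, MeasurableSet (⋃ i ∈ Finset.range n, (Prod.mk t ⁻¹' f i ∩ S)) :=
      fun n t => Finset.measurableSet_biUnion _ fun i _ => (measurable_prodMk_left (hf i)).inter hS
    have hsub : ∀ n : ℕ, ∀ t, (⋃ i ∈ Finset.range n, (Prod.mk t ⁻¹' f i ∩ S)) ⊆ S := fun n t =>
      Set.iUnion₂_subset fun i _ => Set.inter_subset_right
    have hfin : ∀ n : ℕ, ∀ t, μ (⋃ i ∈ Finset.range n, (Prod.mk t ⁻¹' f i ∩ S)) ≠ ∞ := fun n t =>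
      ne_top_of_le_ne_top hSt (measure_mono (hsub n t))
    refine stronglyMeasurable_of_tendsto atTop (f := fun n t => indicatorConstLp (μ := μ) 2
      (hm n t) (hfin n t) (1 : ℂ)) (fun n => ?_) ?_
    · induction n with
      | zero =>
        convert! stronglyMeasurable_const (b := (0 : Lp ℂ 2 μ)) using 2 with t
        simp
      | succ n IH =>
        have : (fun t => indicatorConstLp (μ := μ) 2 (hm (n + 1) t) (hfin (n + 1) t) (1 : ℂ)) =
          fun t => indicatorConstLp (μ := μ) 2 ((measurable_prodMk_left (x := t) (hf n)).inter hS)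
            (measure_prodMk_inter_ne_top hSt _) (1 : ℂ) +
            indicatorConstLp (μ := μ) 2 (hm n t) (hfin n t) (1 : ℂ) := by
          ext1 t
          rw [← indicatorConstLp_disjoint_union]
          · congr 1
            rw [Finset.range_add_one, Finset.set_biUnion_insert]
          · rw [Set.disjoint_iUnion₂_right]
            intro i hi
            refine (Disjoint.preimage _ (hd ?_)).mono Set.inter_subset_left Set.inter_subset_left
            rw [Finset.mem_range] at hi
            omega
        rw [this]
        exact (ih n).add IH
    · rw [tendsto_pi_nhds]
      intro t
      refine tendsto_indicatorConstLp_set (by norm_num) ?_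
      have hmono : Antitone fun n : ℕ => (Prod.mk t ⁻¹' (⋃ i, f i) ∩ S) \
          ⋃ i ∈ Finset.range n, (Prod.mk t ⁻¹' f i ∩ S) := fun m n hmn =>
        Set.sdiff_subset_sdiff_right (Set.biUnion_subset_biUnion_left (by simpa using hmn))
      have key := tendsto_measure_iInter_atTop (μ := μ) (fun n : ℕ =>
        (((measurable_prodMk_left (x := t) (MeasurableSet.iUnion hf)).inter hS).diff
          (hm n t)).nullMeasurableSet) hmono ⟨0, ne_top_of_le_ne_top hSt
          (measure_mono (Set.sdiff_subset.trans Set.inter_subset_right))⟩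
      have hempty : (⋂ n : ℕ, (Prod.mk t ⁻¹' (⋃ i, f i) ∩ S) \
          ⋃ i ∈ Finset.range n, (Prod.mk t ⁻¹' f i ∩ S)) = ∅ := by
        ext x
        simp only [Set.mem_iInter, Set.mem_sdiff, Set.mem_inter_iff, Set.mem_preimage,
          Set.mem_iUnion, Set.mem_empty_iff_false, iff_false, not_forall]
        by_cases hx : (∃ i, (t, x) ∈ f i) ∧ x ∈ S
        · obtain ⟨⟨i, hi⟩, hxS⟩ := hx
          exact ⟨i + 1, fun h => h.2 ⟨i, by simp, hi, hxS⟩⟩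
        · exact ⟨0, fun h => hx h.1⟩
      rw [hempty, measure_empty] at key
      refine key.congr fun n => ?_
      simp only [Function.comp_apply]
      congr 1
      have hsub' : (⋃ i ∈ Finset.range n, (Prod.mk t ⁻¹' f i ∩ S)) ⊆ Prod.mk t ⁻¹' (⋃ i, f i) ∩ S :=
        Set.iUnion₂_subset fun i _ x hx => ⟨Set.mem_iUnion.2 ⟨i, hx.1⟩, hx.2⟩
      rw [Set.symmDiff_def, Set.sdiff_eq_empty.2 hsub', Set.empty_union]

/-- A jointly measurable function with square integrable slices is a measurable function of `t` with
values in `L²`, also if the σ-algebra of `X` is not countably generated. -/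
theorem stronglyMeasurable_slice [MeasurableSpace T] [SigmaFinite μ] {F : T → X → ℂ}
    (hF : StronglyMeasurable (Function.uncurry F)) (h2 : ∀ t, MemLp (F t) 2 μ) :
    StronglyMeasurable (slice μ F) := by
  set f := Function.uncurry F with hf
  set S := spanningSets μ
  set A := fun n : ℕ => SimpleFunc.approxOn f hF.measurable Set.univ 0 (Set.mem_univ 0) n
  set G : ℕ → T → X → ℂ := fun n t => (S n).indicator fun x => A n (t, x) with hG
  have hGle : ∀ n t x, ‖G n t x‖ ≤ ‖F t x‖ + ‖F t x‖ := fun n t x =>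
    (norm_indicator_le_norm_self _ _).trans (SimpleFunc.norm_approxOn_zero_le hF.measurable
      (Set.mem_univ 0) (t, x) n)
  have hGm : ∀ n t, AEStronglyMeasurable (G n t) μ := fun n t =>
    (((A n).measurable.comp measurable_prodMk_left).indicator
      (measurableSet_spanningSets μ n)).aestronglyMeasurable
  have hG2 : ∀ n t, MemLp (G n t) 2 μ := fun n t =>
    ((h2 t).norm.add (h2 t).norm).mono (hGm n t) (ae_of_all _ fun x => by
      refine (hGle n t x).trans (le_of_eq ?_)
      simp only [Pi.add_apply]
      rw [Real.norm_of_nonneg (by positivity)])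
  refine stronglyMeasurable_of_tendsto atTop (f := fun n => slice μ (G n)) (fun n => ?_) ?_
  · have hfin : ∀ t : T, ∀ c : ℂ, μ (Prod.mk t ⁻¹' (A n ⁻¹' {c}) ∩ S n) ≠ ∞ := fun t c =>
      measure_prodMk_inter_ne_top (measure_spanningSets_lt_top μ n).ne _
    have hmeas : ∀ t : T, ∀ c : ℂ, MeasurableSet (Prod.mk t ⁻¹' (A n ⁻¹' {c}) ∩ S n) := fun t c =>
      (measurable_prodMk_left ((A n).measurableSet_fiber c)).inter (measurableSet_spanningSets μ n)
    have : slice μ (G n) = fun t => ∑ c ∈ (A n).range, c • indicatorConstLp (μ := μ) 2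
        (hmeas t c) (hfin t c) (1 : ℂ) := by
      ext1 t
      refine Lp.ext ((coeFn_slice (hG2 n t)).trans ?_)
      have hae : ∀ᵐ x ∂μ, ∀ c ∈ (A n).range, indicatorConstLp (μ := μ) 2
          (hmeas t c) (hfin t c) (1 : ℂ) x =
          (Prod.mk t ⁻¹' (A n ⁻¹' {c}) ∩ S n).indicator (fun _ => (1 : ℂ)) x := by
        rw [Finset.eventually_all]
        exact fun c _ => indicatorConstLp_coeFn
      have hsm : ∀ᵐ x ∂μ, ∀ c ∈ (A n).range, (c • indicatorConstLp (μ := μ) 2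
          (hmeas t c) (hfin t c) (1 : ℂ) : Lp ℂ 2 μ) x = c * indicatorConstLp (μ := μ) 2
          (hmeas t c) (hfin t c) (1 : ℂ) x := by
        rw [Finset.eventually_all]
        exact fun c _ => Lp.coeFn_smul c _
      filter_upwards [hae, hsm, Lp.coeFn_finsetSum (A n).range fun c => c • indicatorConstLp (μ := μ) 2
          (hmeas t c) (hfin t c) (1 : ℂ)] with x h1 h2 h3
      rw [h3, Finset.sum_apply, Finset.sum_congr rfl (fun c hc => (h2 c hc).trans
        (congrArg _ (h1 c hc)))]
      by_cases hx : x ∈ S n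
      · simp only [hG, Set.indicator_of_mem hx]
        rw [Finset.sum_eq_single (A n (t, x))]
        · rw [Set.indicator_of_mem (show x ∈ Prod.mk t ⁻¹' (A n ⁻¹' {A n (t, x)}) ∩ S n from ⟨rfl, hx⟩),
            mul_one]
        · intro c _ hc
          rw [Set.indicator_of_notMem, mul_zero]
          exact fun h => hc h.1.symm
        · intro h
          exact absurd ((A n).mem_range_self _) h
      · simp only [hG, Set.indicator_of_notMem hx]
        symm
        refine Finset.sum_eq_zero fun c _ => ?_
        rw [Set.indicator_of_notMem (fun h => hx h.2), mul_zero]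
    rw [this]
    refine Finset.stronglyMeasurable_fun_sum _ fun c _ => ?_
    exact (stronglyMeasurable_indicatorConstLp_slice (measurableSet_spanningSets μ n)
      (measure_spanningSets_lt_top μ n).ne ((A n).measurableSet_fiber c)).const_smul c
  · rw [tendsto_pi_nhds]
    intro t
    rw [Lp.tendsto_Lp_iff_tendsto_eLpNorm']
    have key := tendsto_eLpNorm_of_dominated (μ := μ) (p := 2) (by norm_num) (by norm_num)
      (f := fun n => G n t - F t) (g := fun x => ‖F t x‖ₑ + ‖F t x‖ₑ + ‖F t x‖ₑ)
      (fun n => (hGm n t).sub (h2 t).1) ?_ ?_ ?_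
    · refine key.congr fun n => eLpNorm_congr_ae ?_
      filter_upwards [coeFn_slice (hG2 n t), coeFn_slice (h2 t)] with x h1 h2
      simp [h1, h2]
    · refine ((eLpNorm_add_le (((h2 t).1.enorm.add (h2 t).1.enorm).aestronglyMeasurable)
        ((h2 t).1.enorm.aestronglyMeasurable) (by norm_num)).trans_lt ?_).ne
      refine ENNReal.add_lt_top.2 ⟨(eLpNorm_add_le ((h2 t).1.enorm.aestronglyMeasurable)
        ((h2 t).1.enorm.aestronglyMeasurable) (by norm_num)).trans_lt ?_, ?_⟩
      · rw [eLpNorm_enorm]; exact ENNReal.add_lt_top.2 ⟨(h2 t).2, (h2 t).2⟩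
      · rw [eLpNorm_enorm]; exact (h2 t).2
    · intro n
      refine ae_of_all _ fun x => (enorm_sub_le).trans ?_
      gcongr
      have := hGle n t x
      rw [← enorm_norm (F t x), ← enorm_norm (G n t x), Real.enorm_of_nonneg (norm_nonneg _),
        Real.enorm_of_nonneg (norm_nonneg _), ← ENNReal.ofReal_add (norm_nonneg _) (norm_nonneg _)]
      exact ENNReal.ofReal_le_ofReal this
    · refine ae_of_all _ fun x => ?_
      have h1 : Tendsto (fun n => A n (t, x)) atTop (𝓝 (F t x)) :=
        SimpleFunc.tendsto_approxOn hF.measurable (Set.mem_univ 0) (by simp)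
      have h3 : ∀ᶠ n in atTop, G n t x = A n (t, x) := by
        filter_upwards [eventually_ge_atTop (spanningSetsIndex μ x)] with n hn
        exact Set.indicator_of_mem (monotone_spanningSets μ hn (mem_spanningSetsIndex μ x)) _
      have h4 := (h1.congr' (h3.mono fun n hn => hn.symm)).sub_const (F t x)
      simpa using h4

/-- A measurable function of `t` with values in `L²` has a jointly measurable version: choose
approximations with countably many values, converging so fast that they converge pointwise almost
everywhere for every `t`. -/
theorem exists_stronglyMeasurable_uncurry_ae_eq [MeasurableSpace T] {u : T → Lp ℂ 2 μ}
    (hu : StronglyMeasurable u) :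
    ∃ v : T → X → ℂ, StronglyMeasurable (Function.uncurry v) ∧ ∀ t, u t =ᵐ[μ] v t := by
  classical
  have hex : ∀ (k : ℕ) (t : T), ∃ N, dist (hu.approx N t) (u t) < (1 / 4) ^ k := fun k t =>
    ((tendsto_iff_dist_tendsto_zero.1 (hu.tendsto_approx t)).eventually
      (gt_mem_nhds (by positivity))).exists
  set N : ℕ → T → ℕ := fun k t => Nat.find (hex k t) with hN
  have hNm : ∀ k, Measurable (N k) := fun k => measurable_find (hex k) fun n => by
    exact (((hu.approx n).stronglyMeasurable.dist hu).measurable measurableSet_Iio)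
  have hNs : ∀ k t, dist (hu.approx (N k t) t) (u t) < (1 / 4) ^ k := fun k t => Nat.find_spec (hex k t)
  set w : ℕ → T → Lp ℂ 2 μ := fun k t => hu.approx (N k t) t with hw
  have hwm : ∀ k, StronglyMeasurable fun z : T × X => (w k z.1 : X → ℂ) z.2 := fun k => by
    have h1 : ∀ n, Measurable fun z : T × X => (hu.approx n z.1 : X → ℂ) z.2 := fun n => by
      intro B hB
      have : (fun z : T × X => (hu.approx n z.1 : X → ℂ) z.2) ⁻¹' B =
          ⋃ c ∈ (hu.approx n).range, (hu.approx n ⁻¹' {c}) ×ˢ ((c : X → ℂ) ⁻¹' B) := by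
        ext ⟨t, x⟩
        simp only [Set.mem_preimage, Set.mem_iUnion, Set.mem_prod, Set.mem_singleton_iff]
        constructor
        · intro h
          exact ⟨_, (hu.approx n).mem_range_self t, rfl, h⟩
        · rintro ⟨c, -, rfl, h⟩
          exact h
      rw [this]
      exact Finset.measurableSet_biUnion _ fun c _ => ((hu.approx n).measurableSet_fiber c).prod
        ((Lp.stronglyMeasurable c).measurable hB)
    -- the index of the approximation depends on `t`
    have h2 : Measurable fun q : ℕ × (T × X) => (hu.approx q.1 q.2.1 : X → ℂ) q.2.2 :=
      measurable_from_prod_countable_right h1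
    exact (h2.comp ((hNm k).comp measurable_fst |>.prodMk measurable_id)).stronglyMeasurable
  refine ⟨fun t x => limUnder atTop fun k => (w k t : X → ℂ) x,
    StronglyMeasurable.limUnder (l := atTop) (f := fun k (z : T × X) => (w k z.1 : X → ℂ) z.2) hwm, fun t => ?_⟩
  have hlim : Tendsto (fun k => w k t) atTop (𝓝 (u t)) := by
    rw [tendsto_iff_dist_tendsto_zero]
    exact squeeze_zero (fun _ => dist_nonneg) (fun k => (hNs k t).le)
      (tendsto_pow_atTop_nhds_zero_of_lt_one (by norm_num) (by norm_num))
  have hB : ∑' k : ℕ, ENNReal.ofReal (2 * (1 / 4) ^ k) ≠ ∞ := by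
    refine Summable.tsum_ofReal_ne_top ?_
    exact (summable_geometric_of_lt_one (by norm_num) (by norm_num)).mul_left _
  have hae := Lp.ae_tendsto_of_cauchy_eLpNorm (μ := μ) (p := 2) (f := fun k => (w k t : X → ℂ))
    (fun k => (Lp.stronglyMeasurable _).aestronglyMeasurable) (by norm_num) hB ?_
  · obtain ⟨ns, hns, hsub⟩ := (tendstoInMeasure_of_tendsto_Lp hlim).exists_seq_tendsto_ae
    filter_upwards [hae, hsub] with x ⟨l, hl⟩ hx
    rw [hl.limUnder_eq]
    exact tendsto_nhds_unique hx (hl.comp hns.tendsto_atTop)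
  · intro K n m hn hm
    rw [eLpNorm_congr_ae (Lp.coeFn_sub _ _).symm, ← Lp.enorm_def, ← ofReal_norm,
      ENNReal.ofReal_lt_ofReal_iff (by positivity), ← dist_eq_norm]
    calc dist (w n t) (w m t) ≤ dist (w n t) (u t) + dist (w m t) (u t) := dist_triangle_right _ _ _
      _ < (1 / 4) ^ n + (1 / 4) ^ m := add_lt_add (hNs n t) (hNs m t)
      _ ≤ (1 / 4) ^ K + (1 / 4) ^ K := add_le_add
          (pow_le_pow_of_le_one (by norm_num) (by norm_num) hn)
          (pow_le_pow_of_le_one (by norm_num) (by norm_num) hm)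
      _ = 2 * (1 / 4) ^ K := by ring

end Slice

/-! ### Test functions and dispersive families -/

section Test

variable {X : Type*} [MeasurableSpace X] {μ : Measure X}

/-- Test functions: jointly measurable and bounded functions of `(t, x)`, which vanish outside of
a product of a bounded time interval and a set of finite measure, and at all times `t ∉ J`. -/
structure IsTest (μ : Measure X) (J : Set ℝ) (F : ℝ → X → ℂ) : Prop where
  meas : StronglyMeasurable (Function.uncurry F)
  bound : ∃ (B : ℝ≥0) (R : ℝ) (S : Set X), MeasurableSet S ∧ μ S ≠ ∞ ∧
    ∀ t x, ‖F t x‖ₑ ≤ (Set.Icc (-R) R ×ˢ S).indicator (fun _ => (B : ℝ≥0∞)) (t, x)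
  supp : ∀ t ∉ J, ∀ x, F t x = 0

namespace IsTest

variable {J : Set ℝ} {F G : ℝ → X → ℂ}

theorem of_le (hF : IsTest μ J F) (hG : StronglyMeasurable (Function.uncurry G))
    (h : ∀ t x, ‖G t x‖ₑ ≤ ‖F t x‖ₑ) : IsTest μ J G where
  meas := hG
  bound := by
    obtain ⟨B, R, S, hS, hSt, hb⟩ := hF.bound
    exact ⟨B, R, S, hS, hSt, fun t x => (h t x).trans (hb t x)⟩
  supp t ht x := by
    have := h t x
    rw [hF.supp t ht x] at this
    simpa using this

theorem indicator (hF : IsTest μ J F) {E : Set ℝ} (hE : MeasurableSet E) :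
    IsTest μ J (E.indicator F) := by
  refine hF.of_le ?_ fun t x => ?_
  · have : Function.uncurry (E.indicator F) = (Prod.fst ⁻¹' E).indicator (Function.uncurry F) := by
      ext ⟨t, x⟩
      by_cases ht : t ∈ E <;> simp [ht]
    rw [this]
    exact hF.meas.indicator (measurable_fst hE)
  · by_cases ht : t ∈ E <;> simp [ht]

theorem measurable_enorm (hF : IsTest μ J F) :
    Measurable fun z : ℝ × X => ‖F z.1 z.2‖ₑ := hF.meas.enorm

theorem stronglyMeasurable_apply (hF : IsTest μ J F) (t : ℝ) : StronglyMeasurable (F t) :=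
  hF.meas.comp_measurable measurable_prodMk_left

theorem exists_eLpNorm_le (hF : IsTest μ J F) (p : ℝ≥0∞) : ∃ (M : ℝ≥0∞) (R : ℝ), M ≠ ∞ ∧
    ∀ t, eLpNorm (F t) p μ ≤ (Set.Icc (-R) R).indicator (fun _ => M) t := by
  obtain ⟨B, R, S, hS, hSt, hb⟩ := hF.bound
  refine ⟨B * μ S ^ (1 / p.toReal), R, ENNReal.mul_ne_top (by simp)
    (ENNReal.rpow_ne_top_of_nonneg (by positivity) hSt), fun t => ?_⟩
  by_cases ht : t ∈ Set.Icc (-R) R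
  · rw [Set.indicator_of_mem ht]
    refine le_trans (eLpNorm_mono_enorm (g := S.indicator fun _ => (B : ℝ≥0∞)) fun x => ?_)
      ((eLpNorm_indicator_const_le _ p).trans_eq (by simp))
    refine (hb t x).trans (le_of_eq ?_)
    by_cases hx : x ∈ S <;> simp [ht.1, ht.2, hx]
  · rw [Set.indicator_of_notMem ht]
    have : F t = 0 := by
      ext x
      have := hb t x
      rw [Set.indicator_of_notMem (fun h => ht h.1)] at this
      simpa using this
    simp [this]

theorem memLp (hF : IsTest μ J F) (p : ℝ≥0∞) (t : ℝ) : MemLp (F t) p μ := by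
  refine ⟨(hF.stronglyMeasurable_apply t).aestronglyMeasurable, ?_⟩
  obtain ⟨M, R, hM, h⟩ := hF.exists_eLpNorm_le p
  exact (h t).trans_lt ((Set.indicator_le_self _ _ t).trans_lt hM.lt_top)

theorem measurable_eLpNorm [SFinite μ] (hF : IsTest μ J F) {p : ℝ≥0∞} (hp0 : p ≠ 0) (hp : p ≠ ∞) :
    Measurable fun t => eLpNorm (F t) p μ := by
  simp only [eLpNorm_eq_lintegral_rpow_enorm_toReal hp0 hp]
  exact ((hF.measurable_enorm.pow_const _).lintegral_prod_right').pow_const _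

theorem enorm_slice (hF : IsTest μ J F) (t : ℝ) : ‖slice μ F t‖ₑ = eLpNorm (F t) 2 μ := by
  rw [slice_of_memLp (hF.memLp 2 t), Lp.enorm_toLp]

theorem coeFn_slice (hF : IsTest μ J F) (t : ℝ) : slice μ F t =ᵐ[μ] F t :=
  _root_.coeFn_slice (hF.memLp 2 t)

theorem slice_of_notMem (hF : IsTest μ J F) {t : ℝ} (ht : t ∉ J) : slice μ F t = 0 := by
  rw [← enorm_eq_zero, hF.enorm_slice, show F t = 0 from funext (hF.supp t ht), eLpNorm_zero]

/-- Decomposition of a test function into pieces adapted to the level sets of `|F t|`: the `k`-th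
piece behaves like `c k t * 2 ^ (-k / p)` times the characteristic function of a set of measure
`2 ^ k`, and the square sum of the coefficients is controlled by the `L^p` norm as `p ≤ 2`. -/
theorem exists_atoms {p : ℝ≥0∞} (hp0 : 1 ≤ p) (hp2 : p ≤ 2) :
    ∃ C : ℝ≥0∞, C ≠ ∞ ∧ ∀ {X : Type*} [MeasurableSpace X] {μ : Measure X} [SFinite μ] {J : Set ℝ}
      {F : ℝ → X → ℂ}, IsTest μ J F →
      ∃ (f : ℤ → ℝ → X → ℂ) (c : ℤ → ℝ → ℝ≥0∞), (∀ k, IsTest μ J (f k)) ∧ (∀ k, Measurable (c k)) ∧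
        (∀ k t, eLpNorm (f k t) 1 μ ≤ c k t * (2 : ℝ≥0∞) ^ (k * (1 - 1 / p.toReal))) ∧
        (∀ k t, eLpNorm (f k t) 2 μ ≤ c k t * (2 : ℝ≥0∞) ^ (k * (1 / 2 - 1 / p.toReal))) ∧
        (∀ t, ∑' k, c k t ^ 2 ≤ C * eLpNorm (F t) p μ ^ 2) ∧
        (∀ t, HasSum (fun k => slice μ (f k) t) (slice μ F t)) ∧
        ∃ (M : ℝ≥0∞) (R : ℝ), M ≠ ∞ ∧
          ∀ t, ∑' k, ‖slice μ (f k) t‖ₑ ≤ (Set.Icc (-R) R).indicator (fun _ => M) t := by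
  have hp : p ≠ ∞ := ne_top_of_le_ne_top (by norm_num) hp2
  have hp00 : p ≠ 0 := (zero_lt_one.trans_le hp0).ne'
  set q := p.toReal with hq
  have hq0 : 0 < q := ENNReal.toReal_pos hp00 hp
  have hq2 : q ≤ 2 := by simpa using ENNReal.toReal_mono (by norm_num) hp2
  obtain ⟨C, hC, hlev⟩ := exists_tsum_level_rpow_le
  refine ⟨4 * C ^ (2 / q), ENNReal.mul_ne_top (by norm_num)
    (ENNReal.rpow_ne_top_of_nonneg (by positivity) hC), ?_⟩
  intro X _ μ _ J F hF
  obtain ⟨B, R, S, hS, hSt, hb⟩ := hF.bound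
  set e : ℝ → X → ℝ≥0∞ := fun t x => ‖F t x‖ₑ with he
  have hem : Measurable (Function.uncurry e) := hF.measurable_enorm
  have het : ∀ t, Measurable (e t) := fun t => hem.comp measurable_prodMk_left
  have heB : ∀ t x, e t x ≤ B := fun t x => (hb t x).trans (Set.indicator_le_self _ _ _)
  have hlm : ∀ k, Measurable fun t => level μ (e t) k := measurable_level hem
  set f : ℤ → ℝ → X → ℂ := fun k t => (levelSet μ (e t) k).indicator (F t) with hf
  have hfle : ∀ k t x, ‖f k t x‖ₑ ≤ ‖F t x‖ₑ := fun k t x => enorm_indicator_le_enorm_self _ _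
  have hfT : ∀ k, IsTest μ J (f k) := fun k => by
    refine hF.of_le ?_ (hfle k)
    have : Function.uncurry (f k) = {z : ℝ × X | level μ (e z.1) (k + 1) < Function.uncurry e z ∧
        Function.uncurry e z ≤ level μ (e z.1) k}.indicator (Function.uncurry F) := by
      ext ⟨t, x⟩
      rfl
    rw [this]
    exact hF.meas.indicator ((measurableSet_lt ((hlm _).comp measurable_fst) hem).inter
      (measurableSet_le hem ((hlm _).comp measurable_fst)))
  -- each piece is at most `level k` on a set of measure at most `2 ^ (k + 1)`
  have hpiece : ∀ r : ℝ≥0∞, 1 ≤ r → r ≠ ∞ → ∀ k t, eLpNorm (f k t) r μ ≤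
      level μ (e t) k * (2 * (2 : ℝ≥0∞) ^ ((k : ℝ) * (1 / r.toReal))) := fun r hr hr' k t => by
    have hr1 : 1 ≤ r.toReal := by simpa using ENNReal.toReal_mono hr' hr
    refine le_trans (eLpNorm_mono_enorm (g := (levelSet μ (e t) k).indicator
      fun _ => level μ (e t) k) fun x => ?_) ?_
    · rw [enorm_eq_self]
      by_cases hx : x ∈ levelSet μ (e t) k
      · rw [Set.indicator_of_mem hx, hf]
        simp only [Set.indicator_of_mem hx]
        exact hx.2
      · simp [hf, hx]
    · refine (eLpNorm_indicator_const_le _ r).trans ?_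
      rw [enorm_eq_self]
      gcongr
      refine (ENNReal.rpow_le_rpow (measure_levelSet_le (e t) k) (by positivity)).trans ?_
      rw [ENNReal.mul_rpow_of_nonneg _ _ (by positivity), ← ENNReal.rpow_mul]
      gcongr
      refine (ENNReal.rpow_le_rpow_of_exponent_le (by norm_num) ?_).trans_eq (ENNReal.rpow_one 2)
      rw [div_le_one (by linarith)]
      exact hr1
  set c : ℤ → ℝ → ℝ≥0∞ := fun k t => level μ (e t) k * (2 * (2 : ℝ≥0∞) ^ ((k : ℝ) * (1 / q))) with hc
  have hcr : ∀ r : ℝ, ∀ k t, level μ (e t) k * (2 * (2 : ℝ≥0∞) ^ ((k : ℝ) * r)) =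
      c k t * (2 : ℝ≥0∞) ^ (k * (r - 1 / q)) := fun r k t => by
    simp only [hc]
    rw [mul_assoc, mul_assoc, ← ENNReal.rpow_add _ _ (by norm_num) (by norm_num)]
    congr 3
    ring
  -- the pieces with large `k` vanish
  have hsupp : ∀ t, μ {x | e t x ≠ 0} ≤ μ S := fun t => measure_mono fun x hx => by
    by_contra hxS
    have := hb t x
    rw [Set.indicator_of_notMem (fun h => hxS h.2)] at this
    exact hx (le_antisymm this zero_le)
  obtain ⟨K, hK⟩ : ∃ K : ℕ, ∀ t, ∀ l : ℤ, (K : ℤ) ≤ l → level μ (e t) l = 0 := by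
    obtain ⟨k, hk⟩ := ENNReal.exists_nat_gt hSt
    refine ⟨k, fun t l hl => le_antisymm ((level_antitone _ hl).trans (level_le ?_)) zero_le⟩
    have : {x | 0 < e t x} = {x | e t x ≠ 0} := by ext x; exact pos_iff_ne_zero (a := e t x)
    rw [this]
    refine (hsupp t).trans (hk.le.trans ?_)
    push_cast
    rw [ENNReal.rpow_natCast]
    exact_mod_cast k.lt_two_pow_self.le
  -- for small `k` the pieces decay geometrically, since they are bounded
  obtain ⟨D, hD, hgeom⟩ := exists_tsum_two_rpow_le (δ := 1 / 2) (by norm_num)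
  have hsumm : ∀ t, ∑' k, ‖slice μ (f k) t‖ₑ ≤ (Set.Icc (-R) R).indicator
      (fun _ => B * (2 * (2 : ℝ≥0∞) ^ ((K : ℝ) * (1 / 2))) * D) t := fun t => by
    by_cases ht : t ∈ Set.Icc (-R) R
    · rw [Set.indicator_of_mem ht]
      refine le_trans ?_ (mul_le_mul_right (hgeom K) _)
      rw [← ENNReal.tsum_mul_left]
      refine ENNReal.tsum_le_tsum fun k => ?_
      rw [(hfT k).enorm_slice]
      refine (hpiece 2 (by norm_num) (by norm_num) k t).trans ?_
      rcases le_or_gt (K : ℤ) k with hk | hk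
      · rw [hK t k hk, zero_mul]
        exact zero_le
      · have hk' : (k : ℝ) ≤ K := by exact_mod_cast hk.le
        rw [mul_assoc, mul_assoc, ← ENNReal.rpow_add _ _ (by norm_num) (by norm_num)]
        gcongr
        · exact level_le_of_forall_le (heB t) k
        · norm_num
        · rw [abs_of_nonpos (by linarith)]
          simp only [ENNReal.toReal_ofNat]
          linarith
    · have : ∀ x, F t x = 0 := fun x => by
        have := hb t x
        rw [Set.indicator_of_notMem (fun h => ht h.1)] at this
        simpa using this
      have h0 : ∀ k, f k t = 0 := fun k => by
        ext x
        have := hfle k t x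
        rw [‹∀ x, F t x = 0› x] at this
        simpa using this
      simp [(hfT _).enorm_slice, h0]
  have hDfin : B * (2 * (2 : ℝ≥0∞) ^ ((K : ℝ) * (1 / 2))) * D ≠ ∞ := by
    refine ENNReal.mul_ne_top (ENNReal.mul_ne_top (by simp) (ENNReal.mul_ne_top (by simp) ?_)) hD
    exact ENNReal.rpow_ne_top_of_nonneg (by positivity) (by simp)
  refine ⟨f, c, hfT, fun k => (hlm k).mul_const _, fun k t => ?_, fun k t => ?_, fun t => ?_,
    fun t => ?_, _, R, hDfin, hsumm⟩
  · rw [← hcr]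
    simpa using hpiece 1 le_rfl (by norm_num) k t
  · rw [← hcr]
    simpa using hpiece 2 (by norm_num) (by norm_num) k t
  · have h4 : ∀ k, c k t ^ 2 = 4 * (level μ (e t) k * (2 : ℝ≥0∞) ^ ((k : ℝ) * (1 / q))) ^ 2 :=
      fun k => by simp only [hc]; ring
    simp only [h4]
    rw [ENNReal.tsum_mul_left, mul_assoc]
    gcongr
    refine (tsum_sq_le_rpow hq0 hq2).trans ?_
    have h5 : ∀ k : ℤ, (level μ (e t) k * (2 : ℝ≥0∞) ^ ((k : ℝ) * (1 / q))) ^ q =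
        (2 : ℝ≥0∞) ^ (k : ℝ) * level μ (e t) k ^ q := fun k => by
      rw [ENNReal.mul_rpow_of_nonneg _ _ hq0.le, ← ENNReal.rpow_mul, mul_comm]
      congr 2
      field_simp
    simp only [h5]
    refine (ENNReal.rpow_le_rpow (hlev μ (e t) (het t) (by simp) (heB t) hq0) (by positivity)).trans ?_
    rw [ENNReal.mul_rpow_of_nonneg _ _ (by positivity),
      eLpNorm_eq_lintegral_rpow_enorm_toReal hp00 hp, ← ENNReal.rpow_natCast, ← ENNReal.rpow_mul]
    refine le_of_eq ?_
    congr 2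
    push_cast
    ring
  · have hsum : Summable fun k => slice μ (f k) t := by
      refine Summable.of_enorm ?_
      exact ne_top_of_le_ne_top hDfin ((hsumm t).trans (Set.indicator_le_self _ _ t))
    convert! hsum.hasSum using 1
    -- identify the limit of the partial sums by almost everywhere convergence of a subsequence
    have hI : Tendsto (fun n : ℕ => Finset.Icc (-(n : ℤ)) n) atTop atTop := by
      refine tendsto_atTop_finset_of_monotone (fun m n hmn => Finset.Icc_subset_Icc ?_ ?_)
        fun k => ⟨k.natAbs, ?_⟩
      · simpa using hmn
      · simpa using hmn
      · rw [Finset.mem_Icc]; omega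
    have hlim := hsum.hasSum.comp hI
    obtain ⟨ns, hns, hsub⟩ := (tendstoInMeasure_of_tendsto_Lp hlim).exists_seq_tendsto_ae
    have hpc : ∀ᵐ x ∂μ, ∀ k, slice μ (f k) t x = f k t x :=
      ae_all_iff.2 fun k => (hfT k).coeFn_slice t
    have hsm : ∀ᵐ x ∂μ, ∀ n : ℕ, (∑ k ∈ Finset.Icc (-(n : ℤ)) n, slice μ (f k) t : Lp ℂ 2 μ) x =
        ∑ k ∈ Finset.Icc (-(n : ℤ)) n, slice μ (f k) t x := by
      refine ae_all_iff.2 fun n => ?_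
      filter_upwards [Lp.coeFn_finsetSum (Finset.Icc (-(n : ℤ)) n) fun k => slice μ (f k) t] with x hx
      rw [hx, Finset.sum_apply]
    have hex := ae_exists_mem_levelSet (ne_top_of_le_ne_top hSt (hsupp t))
    refine Lp.ext ?_
    filter_upwards [hsub, hpc, hsm, hF.coeFn_slice t, hex] with x h1 h2 h3 h4 h5
    rw [h4]
    refine tendsto_nhds_unique ?_ h1
    rcases eq_or_ne (e t x) 0 with h0 | h0
    · have hF0 : F t x = 0 := by simpa [he] using h0
      refine tendsto_const_nhds.congr fun n => ?_
      simp only [Function.comp_apply]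
      rw [h3, Finset.sum_eq_zero fun k _ => ?_, hF0]
      rw [h2, hf]
      exact Set.indicator_apply_eq_zero.2 fun _ => hF0
    · obtain ⟨k, hk⟩ := h5 h0
      refine tendsto_const_nhds.congr' ?_
      filter_upwards [(hI.comp hns.tendsto_atTop).eventually (eventually_ge_atTop {k})] with n hn
      simp only [Function.comp_apply]
      rw [h3, Finset.sum_eq_single_of_mem k (show k ∈ Finset.Icc (-(ns n : ℤ)) (ns n) from
        hn (Finset.mem_singleton_self k)), h2, hf]
      · simp only [Set.indicator_of_mem hk]
      · intro l _ hl
        rw [h2, hf]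
        refine Set.indicator_of_notMem (fun hxl => ?_) _
        exact Set.disjoint_left.1 (pairwise_disjoint_levelSet (e t) hl) hxl hk

end IsTest

end Test

section Push

variable {X : Type*} [MeasurableSpace X] {μ : Measure X}
  {𝓗 : Type*} [NormedAddCommGroup 𝓗] [InnerProductSpace ℂ 𝓗]

/-- The hypotheses of the abstract Strichartz estimates: a strongly continuous family of
contractions `V t : L² → 𝓗` such that `(V t)† V s` satisfies a dispersive estimate with rate
`|s - t| ^ (-σ)` for all times `s, t ∈ J`. -/
structure IsDispersive (V : ℝ → Lp ℂ 2 μ →L[ℂ] 𝓗) (J : Set ℝ) (σ : ℝ) (A : ℝ≥0∞) : Prop where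
  norm_le : ∀ t φ, ‖V t φ‖ₑ ≤ ‖φ‖ₑ
  cont : ∀ φ, Continuous fun t => V t φ
  ne_top : A ≠ ∞
  disp : ∀ s ∈ J, ∀ t ∈ J, ∀ φ ψ : Lp ℂ 2 μ, MemLp φ 1 μ → MemLp ψ 1 μ →
    ‖inner ℂ (V s φ) (V t ψ)‖ₑ ≤
      A * ENNReal.ofReal |s - t| ^ (-σ) * (eLpNorm φ 1 μ * eLpNorm ψ 1 μ)

/-- The image `V t (F t)` of a slice in the Hilbert space. -/
noncomputable def push (V : ℝ → Lp ℂ 2 μ →L[ℂ] 𝓗) (F : ℝ → X → ℂ) (t : ℝ) : 𝓗 := V t (slice μ F t)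

theorem enorm_inner_le (x y : 𝓗) : ‖inner ℂ x y‖ₑ ≤ ‖x‖ₑ * ‖y‖ₑ := by
  simp only [enorm_eq_nnnorm]
  exact_mod_cast nnnorm_inner_le_nnnorm (𝕜 := ℂ) x y

theorem enorm_self_sq_eq (x : 𝓗) : ‖x‖ₑ ^ 2 = ‖inner ℂ x x‖ₑ := by
  rw [inner_self_eq_norm_sq_to_K, enorm_pow]
  congr 1
  simp [← ofReal_norm]

variable {V : ℝ → Lp ℂ 2 μ →L[ℂ] 𝓗} {J : Set ℝ} {σ : ℝ} {A : ℝ≥0∞} {F G : ℝ → X → ℂ}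

namespace IsDispersive

theorem stronglyMeasurable_push [SigmaFinite μ] (hV : IsDispersive V J σ A) (hF : IsTest μ J F) :
    StronglyMeasurable (push V F) := by
  have h := stronglyMeasurable_slice hF.meas fun t => hF.memLp 2 t
  have := stronglyMeasurable_uncurry_of_continuous_of_stronglyMeasurable
    (u := fun (s t : ℝ) => V s (slice μ F t)) (fun t => hV.cont _)
    (fun s => (V s).continuous.comp_stronglyMeasurable h)
  exact this.comp_measurable (measurable_id.prodMk measurable_id)

theorem enorm_push_le (hV : IsDispersive V J σ A) (hF : IsTest μ J F) (t : ℝ) :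
    ‖push V F t‖ₑ ≤ eLpNorm (F t) 2 μ :=
  (hV.norm_le _ _).trans_eq (hF.enorm_slice t)

theorem exists_enorm_push_le (hV : IsDispersive V J σ A) (hF : IsTest μ J F) :
    ∃ (M : ℝ≥0∞) (R : ℝ), M ≠ ∞ ∧
      ∀ t, ‖push V F t‖ₑ ≤ (Set.Icc (-R) R).indicator (fun _ => M) t := by
  obtain ⟨M, R, hM, h⟩ := hF.exists_eLpNorm_le 2
  exact ⟨M, R, hM, fun t => (hV.enorm_push_le hF t).trans (h t)⟩

theorem lintegral_enorm_push_ne_top (hV : IsDispersive V J σ A) (hF : IsTest μ J F) :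
    ∫⁻ t, ‖push V F t‖ₑ ≠ ∞ := by
  obtain ⟨M, R, hM, h⟩ := hV.exists_enorm_push_le hF
  refine ne_top_of_le_ne_top ?_ (lintegral_mono h)
  rw [lintegral_indicator_const measurableSet_Icc]
  exact ENNReal.mul_ne_top hM measure_Icc_lt_top.ne

theorem integrable_push [SigmaFinite μ] (hV : IsDispersive V J σ A) (hF : IsTest μ J F) :
    Integrable (push V F) :=
  ⟨(hV.stronglyMeasurable_push hF).aestronglyMeasurable,
    (hV.lintegral_enorm_push_ne_top hF).lt_top⟩

theorem push_of_notMem (hF : IsTest μ J F) {t : ℝ} (ht : t ∉ J) : push V F t = 0 := by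
  rw [push, hF.slice_of_notMem ht, map_zero]

/-- The dispersive bound, from `L¹ × L¹`. -/
theorem enorm_inner_push_le (hV : IsDispersive V J σ A) (hF : IsTest μ J F) (hG : IsTest μ J G)
    (s t : ℝ) : ‖inner ℂ (push V F s) (push V G t)‖ₑ ≤
      A * ENNReal.ofReal |s - t| ^ (-σ) * (eLpNorm (F s) 1 μ * eLpNorm (G t) 1 μ) := by
  by_cases hs : s ∈ J
  swap
  · simp [push_of_notMem hF hs]
  by_cases ht : t ∈ J
  swap
  · simp [push_of_notMem hG ht]
  have h1 := hF.coeFn_slice s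
  have h2 := hG.coeFn_slice t
  refine (hV.disp s hs t ht _ _ ((hF.memLp 1 s).ae_eq h1.symm) ((hG.memLp 1 t).ae_eq h2.symm)).trans ?_
  rw [eLpNorm_congr_ae h1, eLpNorm_congr_ae h2]

/-- The energy bound, from `L² × L²`. -/
theorem enorm_inner_push_le_two (hV : IsDispersive V J σ A) (hF : IsTest μ J F)
    (hG : IsTest μ J G) (s t : ℝ) : ‖inner ℂ (push V F s) (push V G t)‖ₑ ≤
      eLpNorm (F s) 2 μ * eLpNorm (G t) 2 μ :=
  (enorm_inner_le _ _).trans (mul_le_mul' (hV.enorm_push_le hF s) (hV.enorm_push_le hG t))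

theorem push_indicator {E : Set ℝ} :
    push V (E.indicator F) = E.indicator (push V F) := by
  ext1 t
  have h : slice μ (E.indicator F) t = slice μ (fun _ : ℝ => E.indicator F t) t := rfl
  by_cases ht : t ∈ E
  · rw [push, h, Set.indicator_of_mem ht, Set.indicator_of_mem ht]
    rfl
  · have h0 : slice μ (fun _ : ℝ => (0 : X → ℂ)) t = 0 :=
      (slice_of_memLp (F := fun _ : ℝ => (0 : X → ℂ)) MemLp.zero).trans (MemLp.toLp_zero _)
    rw [push, h, Set.indicator_of_notMem ht, Set.indicator_of_notMem ht, h0, map_zero]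

end IsDispersive

end Push

/-! ### The non-endpoint estimate -/

theorem enorm_inner_le_tsum_tsum {𝓗 : Type*} [NormedAddCommGroup 𝓗] [InnerProductSpace ℂ 𝓗]
    {ι κ : Type*} {a : ι → 𝓗} {b : κ → 𝓗} {x y : 𝓗} (ha : HasSum a x) (hb : HasSum b y) :
    ‖inner ℂ x y‖ₑ ≤ ∑' i, ∑' j, ‖inner ℂ (a i) (b j)‖ₑ := by
  have h1 : ∀ z : 𝓗, ‖inner ℂ z y‖ₑ ≤ ∑' j, ‖inner ℂ z (b j)‖ₑ := fun z => by
    rw [← ((innerSL ℂ z).hasSum hb).tsum_eq.trans (innerSL_apply_apply ℂ z y)]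
    exact enorm_tsum_le_tsum_enorm
  have hcomm : ∀ u v : 𝓗, ‖inner ℂ u v‖ₑ = ‖inner ℂ v u‖ₑ := fun u v => by
    rw [← inner_conj_symm, RCLike.enorm_conj]
  calc ‖inner ℂ x y‖ₑ = ‖inner ℂ y x‖ₑ := hcomm _ _
    _ ≤ ∑' i, ‖inner ℂ y (a i)‖ₑ := by
        rw [← ((innerSL ℂ y).hasSum ha).tsum_eq.trans (innerSL_apply_apply ℂ y x)]
        exact enorm_tsum_le_tsum_enorm
    _ ≤ _ := ENNReal.tsum_le_tsum fun i => by rw [hcomm]; exact h1 _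

/-- A sum of two geometric tails which meet at `2 ^ m = α ^ (-2)`. In the interpolation `x` is `1 / p`,
and `2 ^ m` is the product of the measures of the supports of two atoms. -/
theorem exists_tsum_min_le {x : ℝ} (hx1 : 1 / 2 < x) (hx2 : x < 1) :
    ∃ C : ℝ≥0∞, C ≠ ∞ ∧ ∀ α : ℝ≥0∞, ∑' m : ℤ, min (α * (2 : ℝ≥0∞) ^ (m * (1 - x)))
      ((2 : ℝ≥0∞) ^ (m * (1 / 2 - x))) ≤ C * α ^ (2 * x - 1) := by
  set δ := min (1 - x) (x - 1 / 2) with hδ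
  have hδ0 : 0 < δ := lt_min (by linarith) (by linarith)
  obtain ⟨C, hC, hgeom⟩ := exists_tsum_two_rpow_le hδ0
  refine ⟨C + 1, by simp [hC], fun α => ?_⟩
  rcases eq_or_ne α 0 with h0 | h0
  · simp [h0]
  rcases eq_or_ne α ∞ with h1 | h1
  · rw [h1, ENNReal.top_rpow_of_pos (by linarith), ENNReal.mul_top (by simp)]
    exact le_top
  obtain ⟨y, hy⟩ : ∃ y : ℝ, α = (2 : ℝ≥0∞) ^ y := by
    refine ⟨Real.logb 2 α.toReal, ?_⟩
    have : (2 : ℝ≥0∞) = ENNReal.ofReal 2 := by simp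
    rw [this, ENNReal.ofReal_rpow_of_pos (by norm_num), Real.rpow_logb (by norm_num) (by norm_num)
      (ENNReal.toReal_pos h0 h1), ENNReal.ofReal_toReal h1]
  rw [hy, ← ENNReal.rpow_mul]
  calc _ ≤ ∑' m : ℤ, (2 : ℝ≥0∞) ^ (y * (2 * x - 1)) * (2 : ℝ≥0∞) ^ (-δ * |(m : ℝ) - (-2 * y)|) := by
        refine ENNReal.tsum_le_tsum fun m => ?_
        rw [← ENNReal.rpow_add _ _ (by norm_num) (by norm_num),
          ← ENNReal.rpow_add _ _ (by norm_num) (by norm_num)]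
        -- the dispersive term is the smaller one below the crossing point, the energy term above it
        rcases le_total (m : ℝ) (-2 * y) with hm | hm
        · refine (min_le_left _ _).trans (ENNReal.rpow_le_rpow_of_exponent_le (by norm_num) ?_)
          rw [abs_of_nonpos (by linarith)]
          have h2 : δ ≤ 1 - x := min_le_left _ _
          nlinarith
        · refine (min_le_right _ _).trans (ENNReal.rpow_le_rpow_of_exponent_le (by norm_num) ?_)
          rw [abs_of_nonneg (by linarith)]
          have h2 : δ ≤ x - 1 / 2 := min_le_right _ _
          nlinarith
    _ ≤ _ := by
        rw [ENNReal.tsum_mul_left, mul_comm]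
        gcongr
        exact (hgeom _).trans le_self_add

/-- Interpolation between the dispersive estimate and the energy estimate. -/
theorem exists_enorm_inner_push_le_rpow {p : ℝ≥0∞} (hp1 : 1 < p) (hp2 : p < 2) :
    ∃ C : ℝ≥0∞, C ≠ ∞ ∧ ∀ {X : Type*} [MeasurableSpace X] {μ : Measure X} [SFinite μ]
      {𝓗 : Type*} [NormedAddCommGroup 𝓗] [InnerProductSpace ℂ 𝓗]
      {V : ℝ → Lp ℂ 2 μ →L[ℂ] 𝓗} {J : Set ℝ} {σ : ℝ} {A : ℝ≥0∞} {F G : ℝ → X → ℂ},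
      IsDispersive V J σ A → IsTest μ J F → IsTest μ J G → ∀ s t,
      ‖inner ℂ (push V F s) (push V G t)‖ₑ ≤
        C * (A * ENNReal.ofReal |s - t| ^ (-σ)) ^ (2 / p.toReal - 1) *
          (eLpNorm (F s) p μ * eLpNorm (G t) p μ) := by
  have hp : p ≠ ∞ := (hp2.trans (by norm_num)).ne
  have hq1 : 1 < p.toReal := by simpa using (ENNReal.toReal_lt_toReal (by norm_num) hp).2 hp1
  have hq2 : p.toReal < 2 := by simpa using (ENNReal.toReal_lt_toReal hp (by norm_num)).2 hp2
  obtain ⟨C, hC, hatoms⟩ := IsTest.exists_atoms hp1.le hp2.le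
  obtain ⟨D, hD, hmin⟩ := exists_tsum_min_le (x := 1 / p.toReal)
    (by rw [div_lt_div_iff₀ (by norm_num) (by linarith)]; linarith)
    (by rw [div_lt_one (by linarith)]; linarith)
  refine ⟨D * C, ENNReal.mul_ne_top hD hC, ?_⟩
  intro X _ μ _ 𝓗 _ _ V J σ A F G hV hF hG s t
  obtain ⟨f, c, hf, -, hf1, hf2, hc, hfs, -⟩ := hatoms hF
  obtain ⟨g, d, hg, -, hg1, hg2, hd, hgs, -⟩ := hatoms hG
  set α := A * ENNReal.ofReal |s - t| ^ (-σ) with hα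
  -- the interaction of the `k`-th and the `l`-th atom depends on `k + l` only: the dispersive and the
  -- energy bound compete
  set h : ℤ → ℝ≥0∞ := fun m => min (α * (2 : ℝ≥0∞) ^ (m * (1 - 1 / p.toReal)))
      ((2 : ℝ≥0∞) ^ (m * (1 / 2 - 1 / p.toReal))) with hh
  have hsplit : ∀ (k l : ℤ) (y : ℝ), (2 : ℝ≥0∞) ^ (((k + l : ℤ) : ℝ) * y) =
      (2 : ℝ≥0∞) ^ (k * y) * (2 : ℝ≥0∞) ^ (l * y) := fun k l y => by
    rw [← ENNReal.rpow_add _ _ (by norm_num) (by norm_num)]; push_cast; congr 1; ring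
  have hkl : ∀ k l, ‖inner ℂ (push V (f k) s) (push V (g l) t)‖ₑ ≤ h (k + l) * (c k s * d l t) :=
    fun k l => by
      rw [hh, min_mul_of_nonneg _ _ zero_le]
      refine le_min ?_ ?_
      · refine (hV.enorm_inner_push_le (hf k) (hg l) s t).trans ?_
        refine (mul_le_mul_right (mul_le_mul' (hf1 k s) (hg1 l t)) _).trans_eq ?_
        rw [hsplit]; ring
      · refine (hV.enorm_inner_push_le_two (hf k) (hg l) s t).trans ?_
        refine (mul_le_mul' (hf2 k s) (hg2 l t)).trans_eq ?_
        rw [hsplit]; ring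
  have hsum : ∀ k : ℤ, ∑' l : ℤ, h (k + l) ≤ D * α ^ (2 / p.toReal - 1) := fun k => by
    refine ((Equiv.addLeft k).tsum_eq h).trans_le ((hmin α).trans_eq ?_)
    congr 2; ring
  have hsum' : ∀ l : ℤ, ∑' k : ℤ, h (k + l) ≤ D * α ^ (2 / p.toReal - 1) := fun l => by
    simpa only [add_comm] using hsum l
  have hsq : ∀ {u v : ℝ≥0∞}, u ≤ C * v ^ 2 → u ^ (1 / 2 : ℝ) ≤ C ^ (1 / 2 : ℝ) * v := fun {u v} huv => by
    refine (ENNReal.rpow_le_rpow huv (by norm_num)).trans_eq ?_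
    rw [ENNReal.mul_rpow_of_nonneg _ _ (by norm_num), ← ENNReal.rpow_natCast, ← ENNReal.rpow_mul]
    norm_num
  have hCC : C ^ (1 / 2 : ℝ) * C ^ (1 / 2 : ℝ) = C := by
    rw [← ENNReal.rpow_add_of_nonneg _ _ (by norm_num) (by norm_num)]; norm_num
  calc ‖inner ℂ (push V F s) (push V G t)‖ₑ
      ≤ ∑' k, ∑' l, ‖inner ℂ (push V (f k) s) (push V (g l) t)‖ₑ :=
        enorm_inner_le_tsum_tsum ((V s).hasSum (hfs s)) ((V t).hasSum (hgs t))
    _ ≤ ∑' k, ∑' l, h (k + l) * (c k s * d l t) :=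
        ENNReal.tsum_le_tsum fun k => ENNReal.tsum_le_tsum fun l => hkl k l
    _ ≤ D * α ^ (2 / p.toReal - 1) * (∑' k, c k s ^ 2) ^ (1 / 2 : ℝ) *
          (∑' l, d l t ^ 2) ^ (1 / 2 : ℝ) := tsum_tsum_schur hsum hsum'
    _ ≤ D * α ^ (2 / p.toReal - 1) * (C ^ (1 / 2 : ℝ) * eLpNorm (F s) p μ) *
          (C ^ (1 / 2 : ℝ) * eLpNorm (G t) p μ) := by
        gcongr
        · exact hsq (hc s)
        · exact hsq (hd t)
    _ = D * C * α ^ (2 / p.toReal - 1) * (eLpNorm (F s) p μ * eLpNorm (G t) p μ) := by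
        conv_rhs => rw [← hCC]
        ring

theorem exists_lintegral_abs_rpow_le {lam : ℝ} (h1 : lam < 1) :
    ∃ C : ℝ≥0∞, C ≠ ∞ ∧ ∀ (R : ℝ), 0 < R → ∀ t : ℝ,
      ∫⁻ s, (Set.Icc (-R) R).indicator (fun τ => ENNReal.ofReal |τ| ^ (-lam)) (s - t) ≤
        C * ENNReal.ofReal R ^ (1 - lam) := by
  refine ⟨2 * ENNReal.ofReal (1 / (1 - lam)), by finiteness, fun R hR t => ?_⟩
  rw [lintegral_sub_right_eq_self
    (fun s => (Set.Icc (-R) R).indicator (fun τ => ENNReal.ofReal |τ| ^ (-lam)) s) t]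
  set φ : ℝ → ℝ≥0∞ := (Set.Ioc 0 R).indicator fun τ => ENNReal.ofReal (τ ^ (-lam)) with hφ
  have hφm : Measurable φ := by
    refine Measurable.indicator ?_ measurableSet_Ioc
    fun_prop
  have hφint : ∫⁻ s, φ s = ENNReal.ofReal (1 / (1 - lam)) * ENNReal.ofReal R ^ (1 - lam) := by
    rw [hφ, lintegral_indicator measurableSet_Ioc, ← ofReal_integral_eq_lintegral_ofReal]
    · rw [← intervalIntegral.integral_of_le hR.le, integral_rpow (Or.inl (by linarith)),
        Real.zero_rpow (by linarith), ENNReal.ofReal_rpow_of_pos hR, ← ENNReal.ofReal_mul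
        (by have : 0 < 1 - lam := by linarith
            positivity)]
      congr 1
      rw [show -lam + 1 = 1 - lam by ring]
      ring
    · exact (intervalIntegrable_iff_integrableOn_Ioc_of_le hR.le).1
        (intervalIntegral.intervalIntegrable_rpow' (by linarith))
    · refine (ae_restrict_iff' measurableSet_Ioc).2 (ae_of_all _ fun s hs => ?_)
      exact Real.rpow_nonneg hs.1.le _
  calc _ ≤ ∫⁻ s, (φ s + φ (-s)) := by
        refine lintegral_mono_ae ?_
        filter_upwards [Measure.ae_ne volume (0 : ℝ)] with s hs
        by_cases hsR : s ∈ Set.Icc (-R) R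
        · rw [Set.indicator_of_mem hsR]
          rcases lt_or_gt_of_ne hs with h | h
          · refine le_trans ?_ le_add_self
            rw [hφ, Set.indicator_of_mem (by constructor <;> linarith [hsR.1]), abs_of_neg h,
              ENNReal.ofReal_rpow_of_pos (by linarith)]
          · refine le_trans ?_ le_self_add
            rw [hφ, Set.indicator_of_mem (by constructor <;> linarith [hsR.2]), abs_of_pos h,
              ENNReal.ofReal_rpow_of_pos (by linarith)]
        · rw [Set.indicator_of_notMem hsR]; exact zero_le
    _ = 2 * ENNReal.ofReal (1 / (1 - lam)) * ENNReal.ofReal R ^ (1 - lam) := by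
        rw [lintegral_add_left hφm, lintegral_neg_eq_self (μ := volume) φ, hφint]
        ring

/-- The fractional integral of two sets of measures about `2 ^ k` and `2 ^ l`. The bound is asymmetric
in the two sets, and it is the better one of the two if `k ≤ l`. -/
theorem exists_lintegral_abs_rpow_indicator_le {lam : ℝ} (h0 : 0 < lam) (h1 : lam < 1) :
    ∃ C : ℝ≥0∞, C ≠ ∞ ∧ ∀ {S T : Set ℝ} (k l : ℤ), MeasurableSet S → MeasurableSet T →
      volume S ≤ 2 * (2 : ℝ≥0∞) ^ (k : ℝ) → volume T ≤ 2 * (2 : ℝ≥0∞) ^ (l : ℝ) →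
      ∫⁻ s, ∫⁻ t, ENNReal.ofReal |s - t| ^ (-lam) *
          (S.indicator (fun _ => 1) s * T.indicator (fun _ => 1) t) ≤
        C * (2 : ℝ≥0∞) ^ (k + (l - lam * l)) := by
  obtain ⟨C, hC, hker⟩ := exists_lintegral_abs_rpow_le h1
  refine ⟨(C + 2) * 2, by finiteness, fun {S T} k l hS hT hSk hTl => ?_⟩
  have h2 : ∀ y : ℝ, ENNReal.ofReal ((2 : ℝ) ^ y) = (2 : ℝ≥0∞) ^ y := fun y => by
    rw [← ENNReal.ofReal_rpow_of_pos (by norm_num)]; simp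
  set R : ℝ := (2 : ℝ) ^ (l : ℝ) with hR
  have hR0 : 0 < R := by positivity
  -- split the kernel at `|s - t| = 2 ^ l`
  have hin : ∀ s : ℝ, ∫⁻ t, ENNReal.ofReal |s - t| ^ (-lam) * T.indicator (fun _ => 1) t ≤
      (C + 2) * (2 : ℝ≥0∞) ^ (l - lam * l) := fun s => by
    calc ∫⁻ t, ENNReal.ofReal |s - t| ^ (-lam) * T.indicator (fun _ => 1) t
        ≤ ∫⁻ t, ((Set.Icc (-R) R).indicator (fun τ => ENNReal.ofReal |τ| ^ (-lam)) (t - s) +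
            ENNReal.ofReal R ^ (-lam) * T.indicator (fun _ => 1) t) := by
          refine lintegral_mono fun t => ?_
          by_cases ht : t ∈ T
          swap
          · simp [ht]
          rw [Set.indicator_of_mem ht, mul_one, mul_one, abs_sub_comm]
          by_cases hts : t - s ∈ Set.Icc (-R) R
          · rw [Set.indicator_of_mem hts]
            exact le_self_add
          · refine le_trans ?_ le_add_self
            rw [ENNReal.rpow_neg, ENNReal.rpow_neg, ENNReal.inv_le_inv]
            gcongr
            by_contra! hcon
            exact hts (abs_le.1 hcon.le)
      _ ≤ C * ENNReal.ofReal R ^ (1 - lam) + ENNReal.ofReal R ^ (-lam) *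
            (2 * (2 : ℝ≥0∞) ^ (l : ℝ)) := by
          rw [lintegral_add_right _ (by
            refine Measurable.const_mul ?_ _
            exact measurable_const.indicator hT)]
          gcongr
          · exact hker R hR0 s
          · rw [lintegral_const_mul _ (measurable_const.indicator hT), lintegral_indicator_const hT,
              one_mul]
            gcongr
      _ = (C + 2) * (2 : ℝ≥0∞) ^ (l - lam * l) := by
          rw [hR, h2, ← ENNReal.rpow_mul, ← ENNReal.rpow_mul, mul_left_comm,
            ← ENNReal.rpow_add _ _ (by norm_num) (by norm_num), add_mul]
          congr 3 <;> ring
  calc _ ≤ ∫⁻ s, S.indicator (fun _ => (C + 2) * (2 : ℝ≥0∞) ^ (l - lam * l)) s := by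
        refine lintegral_mono fun s => ?_
        by_cases hs : s ∈ S
        · simp only [Set.indicator_of_mem hs, one_mul]
          exact hin s
        · simp [hs]
    _ ≤ (C + 2) * (2 : ℝ≥0∞) ^ (l - lam * l) * (2 * (2 : ℝ≥0∞) ^ (k : ℝ)) := by
        rw [lintegral_indicator_const hS]
        gcongr
    _ = _ := by
        rw [ENNReal.rpow_add _ _ (by norm_num) (by norm_num)]
        ring

theorem lintegral_tsum_tsum {α ι κ : Type*} [MeasurableSpace α] {m : Measure α} [Countable ι]
    [Countable κ] {φ : ι → κ → α → ℝ≥0∞} (h : ∀ i j, Measurable (φ i j)) :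
    ∫⁻ x, ∑' i, ∑' j, φ i j x ∂m = ∑' i, ∑' j, ∫⁻ x, φ i j x ∂m := by
  rw [lintegral_tsum fun i => (Measurable.tsum (h i)).aemeasurable]
  exact tsum_congr fun i => lintegral_tsum fun j => (h i j).aemeasurable

/-- The Hardy–Littlewood–Sobolev inequality on the line, in the symmetric case, for bounded
functions on sets of finite measure. -/
theorem exists_lintegral_lintegral_abs_rpow_le {lam : ℝ} (h0 : 0 < lam) (h1 : lam < 1) :
    ∃ C : ℝ≥0∞, C ≠ ∞ ∧ ∀ {f g : ℝ → ℝ≥0∞} {B : ℝ≥0∞}, Measurable f → Measurable g → B ≠ ∞ →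
      (∀ t, f t ≤ B) → (∀ t, g t ≤ B) → volume {t | f t ≠ 0} ≠ ∞ → volume {t | g t ≠ 0} ≠ ∞ →
      ∫⁻ s, ∫⁻ t, ENNReal.ofReal |s - t| ^ (-lam) * (f s * g t) ≤
        C * (∫⁻ s, f s ^ (1 / (1 - lam / 2))) ^ (1 - lam / 2) *
          (∫⁻ t, g t ^ (1 / (1 - lam / 2))) ^ (1 - lam / 2) := by
  set x := 1 - lam / 2 with hx
  have hx0 : 0 < x := by linarith
  have hx2 : 1 / x ≤ 2 := by rw [div_le_iff₀ hx0]; linarith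
  obtain ⟨C₁, hC₁, hker⟩ := exists_lintegral_abs_rpow_indicator_le h0 h1
  obtain ⟨C₂, hC₂, hlev⟩ := exists_tsum_level_rpow_le.{0}
  obtain ⟨C₃, hC₃, hgeom⟩ := exists_tsum_two_rpow_le (δ := lam / 2) (by linarith)
  refine ⟨C₁ * (C₃ * (C₂ ^ x * C₂ ^ x)), by finiteness, ?_⟩
  intro f g B hf hg hB hfB hgB hf0 hg0
  -- replace the functions by sums of indicator functions of their level sets
  have key : ∀ {f : ℝ → ℝ≥0∞}, volume {t | f t ≠ 0} ≠ ∞ → ∀ᵐ s : ℝ, f s ≤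
      ∑' k : ℤ, level volume f k * (levelSet volume f k).indicator (fun _ => 1) s := fun {f} hf0 => by
    filter_upwards [ae_exists_mem_levelSet hf0] with s hs
    rcases eq_or_ne (f s) 0 with h | h
    · rw [h]; exact zero_le
    · obtain ⟨k, hk⟩ := hs h
      refine le_trans ?_ (ENNReal.le_tsum k)
      rw [Set.indicator_of_mem hk, mul_one]
      exact hk.2
  have hind : ∀ {f : ℝ → ℝ≥0∞} (hf : Measurable f) (k : ℤ), Measurable fun s =>
      (levelSet volume f k).indicator (fun _ => (1 : ℝ≥0∞)) s := fun hf k =>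
    measurable_const.indicator (measurableSet_levelSet hf k)
  have hsq : ∀ {f : ℝ → ℝ≥0∞}, Measurable f → (∀ t, f t ≤ B) →
      (∑' k : ℤ, (level volume f k * (2 : ℝ≥0∞) ^ (k * x)) ^ 2) ^ (1 / 2 : ℝ) ≤
        C₂ ^ x * (∫⁻ s, f s ^ (1 / x)) ^ x := fun {f} hf hfB => by
    rw [← ENNReal.mul_rpow_of_nonneg _ _ hx0.le]
    have h3 : ∀ k : ℤ, (level volume f k * (2 : ℝ≥0∞) ^ (k * x)) ^ (1 / x) =
        (2 : ℝ≥0∞) ^ (k : ℝ) * level volume f k ^ (1 / x) := fun k => by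
      rw [ENNReal.mul_rpow_of_nonneg _ _ (by positivity), ← ENNReal.rpow_mul, mul_comm]
      congr 2
      field_simp
    have h4 := tsum_sq_le_rpow (c := fun k : ℤ => level volume f k * (2 : ℝ≥0∞) ^ (k * x))
      (p := 1 / x) (by positivity) hx2
    simp only [h3] at h4
    refine (ENNReal.rpow_le_rpow (h4.trans (ENNReal.rpow_le_rpow (hlev volume f hf hB hfB
      (by positivity)) (by positivity))) (by norm_num)).trans_eq ?_
    rw [← ENNReal.rpow_mul]
    congr 1
    field_simp
  set a := level volume f
  set b := level volume g
  set S := levelSet volume f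
  set T := levelSet volume g
  -- the bound for two sets is best with the larger set as the inner variable; this yields decay in
  -- `|k - l|`
  have hM : ∀ k l : ℤ, ∫⁻ s, ∫⁻ t, ENNReal.ofReal |s - t| ^ (-lam) *
      ((S k).indicator (fun _ => 1) s * (T l).indicator (fun _ => 1) t) ≤
      C₁ * ((2 : ℝ≥0∞) ^ (k * x) * (2 : ℝ≥0∞) ^ (l * x) *
        (2 : ℝ≥0∞) ^ (-(lam / 2) * |(k : ℝ) - l|)) := fun k l => by
    rw [← ENNReal.rpow_add _ _ (by norm_num) (by norm_num),
      ← ENNReal.rpow_add _ _ (by norm_num) (by norm_num)]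
    rcases le_total (k : ℝ) l with h | h
    · refine (hker k l (measurableSet_levelSet hf k) (measurableSet_levelSet hg l)
        (measure_levelSet_le f k) (measure_levelSet_le g l)).trans_eq ?_
      rw [abs_of_nonpos (by linarith)]
      congr 2
      rw [hx]; ring
    · rw [lintegral_lintegral_swap]
      · refine le_trans (le_of_eq ?_) ((hker l k (measurableSet_levelSet hg l)
          (measurableSet_levelSet hf k) (measure_levelSet_le g l) (measure_levelSet_le f k)).trans_eq ?_)
        · refine lintegral_congr fun t => lintegral_congr fun s => ?_
          rw [abs_sub_comm, mul_comm ((T l).indicator _ t)]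
        · rw [abs_of_nonneg (by linarith)]
          congr 2
          rw [hx]; ring
      · refine Measurable.aemeasurable ?_
        exact Measurable.mul (by fun_prop)
          (((hind hf k).comp measurable_fst).mul ((hind hg l).comp measurable_snd))
  calc ∫⁻ s, ∫⁻ t, ENNReal.ofReal |s - t| ^ (-lam) * (f s * g t)
      ≤ ∫⁻ s, ∫⁻ t, ∑' k, ∑' l, a k * b l * (ENNReal.ofReal |s - t| ^ (-lam) *
          ((S k).indicator (fun _ => 1) s * (T l).indicator (fun _ => 1) t)) := by
        refine lintegral_mono_ae ((key hf0).mono fun s hs => lintegral_mono_ae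
          ((key hg0).mono fun t ht => ?_))
        refine (mul_le_mul_right (mul_le_mul' hs ht) _).trans_eq ?_
        rw [← ENNReal.tsum_mul_right, ← ENNReal.tsum_mul_left]
        refine tsum_congr fun k => ?_
        rw [← ENNReal.tsum_mul_left, ← ENNReal.tsum_mul_left]
        refine tsum_congr fun l => ?_
        ring
    _ = ∑' k, ∑' l, a k * b l * ∫⁻ s, ∫⁻ t, ENNReal.ofReal |s - t| ^ (-lam) *
          ((S k).indicator (fun _ => 1) s * (T l).indicator (fun _ => 1) t) := by
        have hmeas : ∀ k l, Measurable fun z : ℝ × ℝ => a k * b l *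
            (ENNReal.ofReal |z.1 - z.2| ^ (-lam) * ((S k).indicator (fun _ => 1) z.1 *
              (T l).indicator (fun _ => 1) z.2)) := fun k l =>
          (Measurable.mul (by fun_prop)
            (((hind hf k).comp measurable_fst).mul ((hind hg l).comp measurable_snd))).const_mul _
        have hmeas' : ∀ k l, Measurable fun z : ℝ × ℝ => 
            (ENNReal.ofReal |z.1 - z.2| ^ (-lam) * ((S k).indicator (fun _ => 1) z.1 *
              (T l).indicator (fun _ => 1) z.2)) := fun k l =>
          (Measurable.mul (by fun_prop)
            (((hind hf k).comp measurable_fst).mul ((hind hg l).comp measurable_snd)))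
        have e1 : ∀ s, ∫⁻ t, ∑' k, ∑' l, a k * b l * (ENNReal.ofReal |s - t| ^ (-lam) *
            ((S k).indicator (fun _ => 1) s * (T l).indicator (fun _ => 1) t)) =
            ∑' k, ∑' l, a k * b l * ∫⁻ t, (ENNReal.ofReal |s - t| ^ (-lam) *
            ((S k).indicator (fun _ => 1) s * (T l).indicator (fun _ => 1) t)) := fun s => by
          refine (lintegral_tsum_tsum fun k l => (hmeas k l).comp
            (measurable_prodMk_left (x := s))).trans ?_
          exact tsum_congr fun k => tsum_congr fun l =>
            lintegral_const_mul _ ((hmeas' k l).comp measurable_prodMk_left)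
        simp only [e1]
        rw [lintegral_tsum_tsum fun k l => (hmeas' k l).lintegral_prod_right'.const_mul _]
        exact tsum_congr fun k => tsum_congr fun l =>
          lintegral_const_mul _ (hmeas' k l).lintegral_prod_right'
    _ ≤ ∑' k, ∑' l, C₁ * ((2 : ℝ≥0∞) ^ (-(lam / 2) * |((k : ℤ) : ℝ) - (l : ℤ)|) *
          ((a k * (2 : ℝ≥0∞) ^ (k * x)) * (b l * (2 : ℝ≥0∞) ^ (l * x)))) := by
        refine ENNReal.tsum_le_tsum fun k => ENNReal.tsum_le_tsum fun l => ?_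
        refine (mul_le_mul_right (hM k l) _).trans_eq ?_
        ring
    _ = C₁ * ∑' k, ∑' l, (2 : ℝ≥0∞) ^ (-(lam / 2) * |((k : ℤ) : ℝ) - (l : ℤ)|) *
          ((a k * (2 : ℝ≥0∞) ^ (k * x)) * (b l * (2 : ℝ≥0∞) ^ (l * x))) := by
        rw [← ENNReal.tsum_mul_left]
        exact tsum_congr fun k => ENNReal.tsum_mul_left
    _ ≤ C₁ * (C₃ * (C₂ ^ x * (∫⁻ s, f s ^ (1 / x)) ^ x) * (C₂ ^ x * (∫⁻ s, g s ^ (1 / x)) ^ x)) := by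
        refine mul_le_mul_right ((tsum_tsum_schur (C := C₃) (fun k => ?_) (fun l => ?_)).trans ?_) _
        · simpa only [abs_sub_comm] using hgeom k
        · exact hgeom l
        · exact mul_le_mul' (mul_le_mul_right (hsq hf hfB) _) (hsq hg hgB)
    _ = _ := by ring

theorem enorm_inner_integral_le {α β 𝓗 : Type*} [MeasurableSpace α] [MeasurableSpace β]
    {m : Measure α} {n : Measure β} [NormedAddCommGroup 𝓗]
    [InnerProductSpace ℂ 𝓗] [CompleteSpace 𝓗] {Φ : α → 𝓗} {Ψ : β → 𝓗} (hΦ : Integrable Φ m)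
    (hΨ : Integrable Ψ n) :
    ‖inner ℂ (∫ s, Φ s ∂m) (∫ t, Ψ t ∂n)‖ₑ ≤ ∫⁻ s, ∫⁻ t, ‖inner ℂ (Φ s) (Ψ t)‖ₑ ∂n ∂m := by
  have hcomm : ∀ u v : 𝓗, ‖inner ℂ u v‖ₑ = ‖inner ℂ v u‖ₑ := fun u v => by
    rw [← inner_conj_symm, RCLike.enorm_conj]
  rw [hcomm, ← integral_inner hΦ]
  refine (enorm_integral_le_lintegral_enorm _).trans (lintegral_mono fun s => ?_)
  simp only
  rw [hcomm, ← integral_inner hΨ]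
  exact enorm_integral_le_lintegral_enorm _

section NonEndpoint

variable {X : Type*} [MeasurableSpace X] {μ : Measure X}
  {𝓗 : Type*} [NormedAddCommGroup 𝓗] [InnerProductSpace ℂ 𝓗] [CompleteSpace 𝓗]
  {V : ℝ → Lp ℂ 2 μ →L[ℂ] 𝓗} {J : Set ℝ} {σ : ℝ} {A : ℝ≥0∞}

theorem IsTest.mixedNorm_eq {F : ℝ → X → ℂ} (hF : IsTest μ J F) (hJ : MeasurableSet J) (p q : ℝ≥0∞) :
    mixedNorm μ J p q F = eLpNorm (fun t => eLpNorm (F t) q μ) p volume := by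
  rw [mixedNorm, ← eLpNorm_indicator_eq_eLpNorm_restrict hJ]
  congr 1
  ext1 t
  by_cases ht : t ∈ J
  · rw [Set.indicator_of_mem ht]
  · rw [Set.indicator_of_notMem ht, show F t = 0 from funext (hF.supp t ht), eLpNorm_zero]

namespace IsDispersive

/-- The dual Strichartz estimate away from the endpoints. By the `TT*` method, interpolation between
the dispersive and the energy bound reduces it to the Hardy–Littlewood–Sobolev inequality. -/
theorem exists_enorm_integral_push_le_of_lt [SigmaFinite μ] (hV : IsDispersive V J σ A)
    (hJ : MeasurableSet J) {p q : ℝ≥0∞} (hq1 : 1 < q) (hq2 : q < 2)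
    (h0 : 0 < σ * (2 / q.toReal - 1)) (h1 : σ * (2 / q.toReal - 1) < 1) (hp : p ≠ ∞)
    (hpq : 1 / p.toReal = 1 - σ * (2 / q.toReal - 1) / 2) :
    ∃ C : ℝ≥0∞, C ≠ ∞ ∧ ∀ F : ℝ → X → ℂ, IsTest μ J F →
      ‖∫ t, push V F t‖ₑ ≤ C * mixedNorm μ J p q F := by
  set lam := σ * (2 / q.toReal - 1) with hlam
  have hqt : q ≠ ∞ := (hq2.trans (by norm_num)).ne
  have hq0 : q ≠ 0 := (zero_lt_one.trans hq1).ne'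
  have hqr : q.toReal < 2 := by simpa using (ENNReal.toReal_lt_toReal hqt (by norm_num)).2 hq2
  have hqr1 : 1 < q.toReal := by simpa using (ENNReal.toReal_lt_toReal (by norm_num) hqt).2 hq1
  have hpr : 0 < p.toReal := by
    have : 0 < 1 / p.toReal := by rw [hpq]; linarith
    exact one_div_pos.1 this
  have hp0 : p ≠ 0 := fun h => by simp [h] at hpr
  have hpr' : 1 / (1 - lam / 2) = p.toReal := by rw [← hpq, one_div_one_div]
  obtain ⟨C₁, hC₁, hRT⟩ := exists_enorm_inner_push_le_rpow hq1 hq2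
  obtain ⟨C₂, hC₂, hHLS⟩ := exists_lintegral_lintegral_abs_rpow_le h0 h1
  set y := 2 / q.toReal - 1 with hy
  have hy0 : 0 < y := by rw [hy, sub_pos, one_lt_div (by linarith)]; exact hqr
  set D := C₁ * A ^ y * C₂ with hD
  have hDt : D ≠ ∞ := ENNReal.mul_ne_top (ENNReal.mul_ne_top hC₁
    (ENNReal.rpow_ne_top_of_nonneg hy0.le hV.ne_top)) hC₂
  refine ⟨D ^ (1 / 2 : ℝ), ENNReal.rpow_ne_top_of_nonneg (by norm_num) hDt, fun F hF => ?_⟩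
  set N : ℝ → ℝ≥0∞ := fun t => eLpNorm (F t) q μ with hN
  have hNm : Measurable N := hF.measurable_eLpNorm hq0 hqt
  obtain ⟨M, R, hM, hNb⟩ := hF.exists_eLpNorm_le q
  have hNM : ∀ t, N t ≤ M := fun t => (hNb t).trans (Set.indicator_le_self _ _ t)
  have hNsupp : volume {t | N t ≠ 0} ≠ ∞ := by
    refine ne_top_of_le_ne_top (measure_Icc_lt_top (a := -R) (b := R)).ne (measure_mono fun t ht => ?_)
    by_contra hcon
    have := hNb t
    rw [Set.indicator_of_notMem hcon] at this
    exact ht (le_antisymm this zero_le)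
  have hmix : mixedNorm μ J p q F = (∫⁻ t, N t ^ p.toReal) ^ (1 / p.toReal) := by
    rw [hF.mixedNorm_eq hJ, eLpNorm_eq_lintegral_rpow_enorm_toReal hp0 hp]
    simp only [enorm_eq_self, hN]
  -- expand the square of the norm
  have hsq : ‖∫ t, push V F t‖ₑ ^ 2 ≤ D * mixedNorm μ J p q F ^ 2 := by
    have hint := hV.integrable_push hF
    calc ‖∫ t, push V F t‖ₑ ^ 2 = ‖inner ℂ (∫ t, push V F t) (∫ t, push V F t)‖ₑ :=
          enorm_self_sq_eq _
      _ ≤ ∫⁻ s, ∫⁻ t, ‖inner ℂ (push V F s) (push V F t)‖ₑ := enorm_inner_integral_le hint hint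
      _ ≤ ∫⁻ s, ∫⁻ t, C₁ * A ^ y * (ENNReal.ofReal |s - t| ^ (-lam) * (N s * N t)) := by
          refine lintegral_mono fun s => lintegral_mono fun t => (hRT hV hF hF s t).trans_eq ?_
          rw [ENNReal.mul_rpow_of_nonneg _ _ hy0.le, ← ENNReal.rpow_mul, hlam, neg_mul]
          simp only [hN]
          ring
      _ = C₁ * A ^ y * ∫⁻ s, ∫⁻ t, ENNReal.ofReal |s - t| ^ (-lam) * (N s * N t) := by
          have hm : Measurable fun z : ℝ × ℝ => ENNReal.ofReal |z.1 - z.2| ^ (-lam) *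
            (N z.1 * N z.2) := by fun_prop
          rw [← lintegral_const_mul _ hm.lintegral_prod_right']
          exact lintegral_congr fun s => lintegral_const_mul _ (hm.comp measurable_prodMk_left)
      _ ≤ C₁ * A ^ y * (C₂ * (∫⁻ s, N s ^ p.toReal) ^ (1 / p.toReal) *
            (∫⁻ s, N s ^ p.toReal) ^ (1 / p.toReal)) := by
          have := hHLS hNm hNm hM hNM hNM hNsupp hNsupp
          rw [hpr', ← hpq] at this
          gcongr
      _ = D * mixedNorm μ J p q F ^ 2 := by rw [hmix, hD]; ring
  have h2 : ∀ u : ℝ≥0∞, (u ^ 2) ^ (1 / 2 : ℝ) = u := fun u => by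
    rw [← ENNReal.rpow_natCast, ← ENNReal.rpow_mul]; norm_num
  have := ENNReal.rpow_le_rpow hsq (z := 1 / 2) (by norm_num)
  rwa [ENNReal.mul_rpow_of_nonneg _ _ (by norm_num), h2, h2] at this

omit [CompleteSpace 𝓗] in
/-- The dual Strichartz estimate for the couple `(∞, 2)`, which is conservation of energy. -/
theorem enorm_integral_push_le_one_two (hV : IsDispersive V J σ A)
    (hJ : MeasurableSet J) {F : ℝ → X → ℂ} (hF : IsTest μ J F) :
    ‖∫ t, push V F t‖ₑ ≤ mixedNorm μ J 1 2 F := by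
  rw [hF.mixedNorm_eq hJ, eLpNorm_one_eq_lintegral_enorm]
  exact (enorm_integral_le_lintegral_enorm _).trans (lintegral_mono fun t => hV.enorm_push_le hF t)

end IsDispersive

end NonEndpoint

/-! ### The bilinear form of pairs of times -/

section Pairing

variable {𝓗 : Type*} [NormedAddCommGroup 𝓗] [InnerProductSpace ℂ 𝓗]

/-- The sesquilinear form `∫∫_R ⟨Φ s, Ψ t⟩ ds dt` for a set `R` of pairs of times `(s, t)`. -/
noncomputable def pairing (Φ Ψ : ℝ → 𝓗) (R : Set (ℝ × ℝ)) : ℂ :=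
  ∫ z in R, inner ℂ (Φ z.1) (Ψ z.2)

variable {Φ Ψ : ℝ → 𝓗} {R : Set (ℝ × ℝ)}

theorem integrable_inner_prod (hΦ : Integrable Φ) (hΨ : Integrable Ψ) :
    Integrable fun z : ℝ × ℝ => inner ℂ (Φ z.1) (Ψ z.2) := by
  refine (hΦ.norm.mul_prod hΨ.norm).mono (hΦ.1.comp_fst.inner hΨ.1.comp_snd) (ae_of_all _ fun z => ?_)
  rw [Real.norm_of_nonneg (by positivity)]
  exact norm_inner_le_norm _ _

theorem pairing_swap : pairing Ψ Φ (Prod.swap ⁻¹' R) = conj (pairing Φ Ψ R) := by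
  rw [pairing, pairing, ← integral_conj]
  simp only [inner_conj_symm]
  exact (Measure.measurePreserving_swap (μ := volume) (ν := volume)).setIntegral_preimage_emb
    MeasurableEquiv.prodComm.measurableEmbedding (fun z : ℝ × ℝ => inner ℂ (Ψ z.2) (Φ z.1)) R

theorem enorm_pairing_swap : ‖pairing Ψ Φ (Prod.swap ⁻¹' R)‖ₑ = ‖pairing Φ Ψ R‖ₑ := by
  rw [pairing_swap, RCLike.enorm_conj]

theorem enorm_pairing_le_tsum_left {ι : Type*} [Countable ι] {φ : ι → ℝ → 𝓗}
    (hΨ : Integrable Ψ) (hφ : ∀ i, Integrable (φ i))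
    (hs : ∀ s, HasSum (fun i => φ i s) (Φ s)) (hfin : ∫⁻ s, ∑' i, ‖φ i s‖ₑ ≠ ∞) :
    ‖pairing Φ Ψ R‖ₑ ≤ ∑' i, ‖pairing (φ i) Ψ R‖ₑ := by
  have e1 : pairing Φ Ψ R = ∫ z in R, ∑' i, inner ℂ (φ i z.1) (Ψ z.2) := by
    rw [pairing]
    congr 1
    ext1 z
    have h := ((innerSL ℂ (Ψ z.2)).hasSum (hs z.1)).map (starRingEnd ℂ) Complex.continuous_conj
    simp only [Function.comp_def, innerSL_apply_apply, inner_conj_symm] at h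
    exact h.tsum_eq.symm
  rw [e1, integral_tsum]
  · exact enorm_tsum_le_tsum_enorm
  · exact fun i => (integrable_inner_prod (hφ i) hΨ).1.restrict
  · have hle : ∀ i, ∫⁻ z in R, ‖inner ℂ (φ i z.1) (Ψ z.2)‖ₑ ≤ (∫⁻ s, ‖φ i s‖ₑ) * ∫⁻ t, ‖Ψ t‖ₑ :=
      fun i => by
        rw [← lintegral_prod_mul (hφ i).1.enorm hΨ.1.enorm]
        exact (setLIntegral_le_lintegral _ _).trans (lintegral_mono fun z => enorm_inner_le _ _)
    refine ne_top_of_le_ne_top ?_ (ENNReal.tsum_le_tsum hle)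
    rw [ENNReal.tsum_mul_right, ← lintegral_tsum fun i => (hφ i).1.enorm]
    exact ENNReal.mul_ne_top hfin hΨ.2.ne

theorem enorm_pairing_le_tsum_right {ι : Type*} [Countable ι] {ψ : ι → ℝ → 𝓗}
    (hΦ : Integrable Φ) (hψ : ∀ i, Integrable (ψ i))
    (hs : ∀ s, HasSum (fun i => ψ i s) (Ψ s)) (hfin : ∫⁻ s, ∑' i, ‖ψ i s‖ₑ ≠ ∞) :
    ‖pairing Φ Ψ R‖ₑ ≤ ∑' i, ‖pairing Φ (ψ i) R‖ₑ := by
  rw [← enorm_pairing_swap]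
  refine (enorm_pairing_le_tsum_left hΦ hψ hs hfin).trans_eq (tsum_congr fun i => ?_)
  rw [enorm_pairing_swap]

theorem enorm_pairing_le_lintegral (hΦ : Integrable Φ) (hΨ : Integrable Ψ) (hR : MeasurableSet R) :
    ‖pairing Φ Ψ R‖ₑ ≤ ∫⁻ s, ∫⁻ t, R.indicator (fun z => ‖inner ℂ (Φ z.1) (Ψ z.2)‖ₑ) (s, t) := by
  refine (enorm_integral_le_lintegral_enorm _).trans_eq ?_
  rw [← lintegral_indicator hR, Measure.volume_eq_prod, lintegral_prod]
  exact ((integrable_inner_prod hΦ hΨ).1.enorm.indicator hR)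

/-- Integration in `s` first. -/
theorem pairing_eq_integral_inner [CompleteSpace 𝓗] (hΦ : Integrable Φ)
    (hΨ : Integrable Ψ) (hR : MeasurableSet R) :
    pairing Φ Ψ R = ∫ t, inner ℂ (∫ s in {s | (s, t) ∈ R}, Φ s) (Ψ t) := by
  have hsec : ∀ t : ℝ, MeasurableSet {s : ℝ | (s, t) ∈ R} := fun t => measurable_prodMk_right hR
  rw [pairing, ← integral_indicator hR, Measure.volume_eq_prod, integral_prod_symm]
  · refine integral_congr_ae (ae_of_all _ fun t => ?_)
    simp only
    rw [← inner_conj_symm, ← integral_inner hΦ.restrict, ← integral_conj, ← integral_indicator (hsec t)]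
    congr 1
    ext1 s
    by_cases h : (s, t) ∈ R
    · rw [Set.indicator_of_mem h, Set.indicator_of_mem (by exact h), inner_conj_symm]
    · rw [Set.indicator_of_notMem h, Set.indicator_of_notMem (by exact h)]
  · exact (integrable_inner_prod hΦ hΨ).indicator hR

theorem pairing_univ [CompleteSpace 𝓗] (hΦ : Integrable Φ) (hΨ : Integrable Ψ) :
    pairing Φ Ψ Set.univ = inner ℂ (∫ s, Φ s) (∫ t, Ψ t) := by
  rw [pairing_eq_integral_inner hΦ hΨ MeasurableSet.univ, ← integral_inner hΨ]
  simp

theorem enorm_pairing_le_lintegral_enorm_setIntegral [CompleteSpace 𝓗] (hΦ : Integrable Φ)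
    (hΨ : Integrable Ψ) (hR : MeasurableSet R) :
    ‖pairing Φ Ψ R‖ₑ ≤ ∫⁻ t, ‖∫ s in {s | (s, t) ∈ R}, Φ s‖ₑ * ‖Ψ t‖ₑ := by
  rw [pairing_eq_integral_inner hΦ hΨ hR]
  exact (enorm_integral_le_lintegral_enorm _).trans (lintegral_mono fun t => enorm_inner_le _ _)

end Pairing

/-! ### The endpoint estimate -/

section Window

variable {X : Type*} [MeasurableSpace X] {μ : Measure X} [SigmaFinite μ]
  {𝓗 : Type*} [NormedAddCommGroup 𝓗] [InnerProductSpace ℂ 𝓗] [CompleteSpace 𝓗]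
  {V : ℝ → Lp ℂ 2 μ →L[ℂ] 𝓗} {J : Set ℝ} {σ : ℝ} {A : ℝ≥0∞} {F G : ℝ → X → ℂ}

namespace IsDispersive

/-- The contribution of a time window of length `l`: the local integrability of `|τ| ^ (-1/2)`,
a geometric mean of the dispersive and of the trivial bound, replaces the Strichartz estimate
with non-endpoint exponents. -/
theorem exists_enorm_setIntegral_push_sq_le (hσ : 1 < σ) :
    ∃ C : ℝ≥0∞, C ≠ ∞ ∧ ∀ {X : Type*} [MeasurableSpace X] {μ : Measure X} [SigmaFinite μ]
      {𝓗 : Type*} [NormedAddCommGroup 𝓗] [InnerProductSpace ℂ 𝓗] [CompleteSpace 𝓗]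
      {V : ℝ → Lp ℂ 2 μ →L[ℂ] 𝓗} {J : Set ℝ} {A : ℝ≥0∞} {F : ℝ → X → ℂ} {c : ℝ → ℝ≥0∞}
      {α β : ℝ≥0∞} {E : Set ℝ} {l : ℝ}, IsDispersive V J σ A → IsTest μ J F → Measurable c →
      (∀ t, eLpNorm (F t) 1 μ ≤ c t * α) → (∀ t, eLpNorm (F t) 2 μ ≤ c t * β) →
      MeasurableSet E → 0 < l → (∀ s ∈ E, ∀ t ∈ E, |s - t| ≤ l) →
      ‖∫ s in E, push V F s‖ₑ ^ 2 ≤ C * (A * α ^ 2) ^ (1 / (2 * σ)) *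
        (β ^ 2) ^ (1 - 1 / (2 * σ)) * ENNReal.ofReal l ^ (1 / 2 : ℝ) * ∫⁻ s in E, c s ^ 2 := by
  obtain ⟨C, hC, hker⟩ := exists_lintegral_abs_rpow_le (lam := 1 / 2) (by norm_num)
  refine ⟨C, hC, ?_⟩
  intro X _ μ _ 𝓗 _ _ _ V J A F c α β E l hV hF hc hα hβ hE hl hEl
  -- the weight which turns the decay `|τ| ^ (-σ)` into `|τ| ^ (-1 / 2)`
  set θ := 1 / (2 * σ) with hθ
  have hσ0 : 0 < σ := by linarith
  have hθ0 : 0 ≤ θ := by positivity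
  have hθ1 : θ ≤ 1 := by rw [hθ, div_le_one (by positivity)]; linarith
  set K := (A * α ^ 2) ^ θ * (β ^ 2) ^ (1 - θ) with hK
  have hint := (hV.integrable_push hF).restrict (s := E)
  have hpt : ∀ s t, ‖inner ℂ (push V F s) (push V F t)‖ₑ ≤
      K * (ENNReal.ofReal |s - t| ^ (-(1 / 2 : ℝ)) * (c s * c t)) := fun s t => by
    have h1 : ‖inner ℂ (push V F s) (push V F t)‖ₑ ≤
        min (A * α ^ 2 * ENNReal.ofReal |s - t| ^ (-σ)) (β ^ 2) * (c s * c t) := by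
      rw [min_mul_of_nonneg _ _ zero_le]
      refine le_min ?_ ?_
      · refine (hV.enorm_inner_push_le hF hF s t).trans ?_
        refine (mul_le_mul_right (mul_le_mul' (hα s) (hα t)) _).trans_eq ?_
        ring
      · refine (hV.enorm_inner_push_le_two hF hF s t).trans ?_
        refine (mul_le_mul' (hβ s) (hβ t)).trans_eq ?_
        ring
    refine h1.trans ((mul_le_mul_left (min_le_rpow_mul_rpow _ _ hθ0 hθ1) _).trans_eq ?_)
    rw [ENNReal.mul_rpow_of_nonneg _ _ hθ0, ← ENNReal.rpow_mul,
      show -σ * θ = -(1 / 2 : ℝ) by rw [hθ]; field_simp, hK]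
    ring
  -- within the window the kernel is integrable, so that Schur's test applies
  set w : ℝ → ℝ≥0∞ := (Set.Icc (-l) l).indicator fun τ => ENNReal.ofReal |τ| ^ (-(1 / 2 : ℝ)) with hw
  have hwm : Measurable w := Measurable.indicator (by fun_prop) measurableSet_Icc
  have hw1 : ∀ s, ∫⁻ t, w (t - s) ≤ C * ENNReal.ofReal l ^ (1 / 2 : ℝ) := fun s => by
    refine (hker l hl s).trans_eq ?_
    norm_num
  have hw2 : ∀ t, w (-t) = w t := fun t => by
    rw [hw]
    by_cases h : t ∈ Set.Icc (-l) l
    · rw [Set.indicator_of_mem h, Set.indicator_of_mem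
        (show -t ∈ Set.Icc (-l) l from ⟨by linarith [h.2], by linarith [h.1]⟩), abs_neg]
    · rw [Set.indicator_of_notMem h, Set.indicator_of_notMem
        (fun h' => h ⟨by linarith [h'.2], by linarith [h'.1]⟩)]
  have hm : Measurable fun z : ℝ × ℝ => w (z.2 - z.1) * (c z.1 * c z.2) := by fun_prop
  calc ‖∫ s in E, push V F s‖ₑ ^ 2
      ≤ ∫⁻ s in E, ∫⁻ t in E, ‖inner ℂ (push V F s) (push V F t)‖ₑ := by
        rw [enorm_self_sq_eq]
        exact enorm_inner_integral_le hint hint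
    _ ≤ ∫⁻ s in E, ∫⁻ t in E, K * (w (t - s) * (c s * c t)) := by
        refine setLIntegral_mono' hE fun s hs => setLIntegral_mono' hE fun t ht => (hpt s t).trans ?_
        rw [hw, Set.indicator_of_mem (show t - s ∈ Set.Icc (-l) l from abs_le.1 (hEl t ht s hs)),
          abs_sub_comm]
    _ = K * ∫⁻ s in E, ∫⁻ t in E, w (t - s) * (c s * c t) := by
        rw [← lintegral_const_mul _ hm.lintegral_prod_right']
        exact lintegral_congr fun s => lintegral_const_mul _ (hm.comp measurable_prodMk_left)
    _ ≤ K * ((C * ENNReal.ofReal l ^ (1 / 2 : ℝ) * ∫⁻ s in E, c s ^ 2) ^ (1 / 2 : ℝ) *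
          (C * ENNReal.ofReal l ^ (1 / 2 : ℝ) * ∫⁻ s in E, c s ^ 2) ^ (1 / 2 : ℝ)) := by
        refine mul_le_mul_right (lintegral_lintegral_schur (w := fun s t => w (t - s))
          (by unfold Function.uncurry; fun_prop) hc hc (fun s => ?_) (fun t => ?_)) _
        · exact (setLIntegral_le_lintegral _ _).trans (hw1 s)
        · refine (setLIntegral_le_lintegral _ _).trans (le_trans (le_of_eq ?_) (hw1 t))
          refine lintegral_congr fun s => ?_
          rw [← hw2]
          congr 1
          ring
    _ = _ := by
        rw [← ENNReal.rpow_add_of_nonneg _ _ (by norm_num) (by norm_num), hK]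
        norm_num
        ring

end IsDispersive

end Window

section Shell

variable {X : Type*} [MeasurableSpace X] {μ : Measure X} [SigmaFinite μ]
  {𝓗 : Type*} [NormedAddCommGroup 𝓗] [InnerProductSpace ℂ 𝓗] [CompleteSpace 𝓗]
  {V : ℝ → Lp ℂ 2 μ →L[ℂ] 𝓗} {J : Set ℝ} {σ : ℝ} {A : ℝ≥0∞} {F G : ℝ → X → ℂ}

theorem lintegral_indicator_sub_right {T : Set ℝ} (hT : MeasurableSet T) (s : ℝ) :
    ∫⁻ t, T.indicator (fun _ => (1 : ℝ≥0∞)) (t - s) = volume T := by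
  rw [lintegral_sub_right_eq_self (T.indicator fun _ => (1 : ℝ≥0∞)) s, lintegral_indicator hT]
  simp

theorem lintegral_indicator_sub_left {T : Set ℝ} (hT : MeasurableSet T) (t : ℝ) :
    ∫⁻ s, T.indicator (fun _ => (1 : ℝ≥0∞)) (t - s) = volume T := by
  rw [lintegral_sub_left_eq_self (T.indicator fun _ => (1 : ℝ≥0∞)) t, lintegral_indicator hT]
  simp

theorem measurableSet_sub_mem {T : Set ℝ} (hT : MeasurableSet T) :
    MeasurableSet {z : ℝ × ℝ | z.2 - z.1 ∈ T} :=
  (show Measurable fun z : ℝ × ℝ => z.2 - z.1 by fun_prop) hT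

namespace IsDispersive

omit [CompleteSpace 𝓗] in
/-- On a set of pairs of times at mutual distance at least `l`, the dispersive bound. -/
theorem enorm_pairing_push_le (hσ : 0 < σ) (hV : IsDispersive V J σ A) (hF : IsTest μ J F)
    (hG : IsTest μ J G) {c d : ℝ → ℝ≥0∞} (hc : Measurable c) (hd : Measurable d) {α α' : ℝ≥0∞}
    (hα : ∀ t, eLpNorm (F t) 1 μ ≤ c t * α) (hα' : ∀ t, eLpNorm (G t) 1 μ ≤ d t * α')
    {T : Set ℝ} (hT : MeasurableSet T) {l : ℝ} (hl : 0 < l) (hTl : ∀ τ ∈ T, l ≤ |τ|)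
    (hTv : volume T ≤ ENNReal.ofReal l) :
    ‖pairing (push V F) (push V G) {z | z.2 - z.1 ∈ T}‖ₑ ≤ A * α * α' * ENNReal.ofReal l ^ (1 - σ) *
      ((∫⁻ t, c t ^ 2) ^ (1 / 2 : ℝ) * (∫⁻ t, d t ^ 2) ^ (1 / 2 : ℝ)) := by
  set w : ℝ → ℝ≥0∞ := T.indicator fun _ => 1 with hw
  have hwm : Measurable w := measurable_const.indicator hT
  have hl0 : ENNReal.ofReal l ≠ 0 := by simpa using hl
  refine (enorm_pairing_le_lintegral (hV.integrable_push hF) (hV.integrable_push hG)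
    (measurableSet_sub_mem hT)).trans ?_
  have hpt : ∀ s t, Set.indicator {z : ℝ × ℝ | z.2 - z.1 ∈ T}
      (fun z => ‖inner ℂ (push V F z.1) (push V G z.2)‖ₑ) (s, t) ≤
      A * α * α' * ENNReal.ofReal l ^ (-σ) * (w (t - s) * (c s * d t)) := fun s t => by
    by_cases h : t - s ∈ T
    · rw [Set.indicator_of_mem (by exact h), hw, Set.indicator_of_mem h, one_mul]
      refine (hV.enorm_inner_push_le hF hG s t).trans ?_
      have h1 : ENNReal.ofReal |s - t| ^ (-σ) ≤ ENNReal.ofReal l ^ (-σ) := by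
        rw [ENNReal.rpow_neg, ENNReal.rpow_neg]
        refine ENNReal.inv_le_inv.2 (ENNReal.rpow_le_rpow (ENNReal.ofReal_le_ofReal ?_) hσ.le)
        rw [abs_sub_comm]
        exact hTl _ h
      refine (mul_le_mul' (mul_le_mul' le_rfl h1) (mul_le_mul' (hα s) (hα' t))).trans_eq ?_
      ring
    · rw [Set.indicator_of_notMem (by exact h)]
      exact zero_le
  have hm : Measurable fun z : ℝ × ℝ => w (z.2 - z.1) * (c z.1 * d z.2) := by fun_prop
  calc _ ≤ ∫⁻ s, ∫⁻ t, A * α * α' * ENNReal.ofReal l ^ (-σ) * (w (t - s) * (c s * d t)) :=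
        lintegral_mono fun s => lintegral_mono fun t => hpt s t
    _ = A * α * α' * ENNReal.ofReal l ^ (-σ) * ∫⁻ s, ∫⁻ t, w (t - s) * (c s * d t) := by
        rw [← lintegral_const_mul _ hm.lintegral_prod_right']
        exact lintegral_congr fun s => lintegral_const_mul _ (hm.comp measurable_prodMk_left)
    _ ≤ A * α * α' * ENNReal.ofReal l ^ (-σ) * ((ENNReal.ofReal l * ∫⁻ s, c s ^ 2) ^ (1 / 2 : ℝ) *
          (ENNReal.ofReal l * ∫⁻ s, d s ^ 2) ^ (1 / 2 : ℝ)) := by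
        refine mul_le_mul_right (lintegral_lintegral_schur (w := fun s t => w (t - s))
          (by unfold Function.uncurry; fun_prop) hc hd (fun s => ?_) (fun t => ?_)) _
        · exact (lintegral_indicator_sub_right hT s).trans_le hTv
        · exact (lintegral_indicator_sub_left hT t).trans_le hTv
    _ = A * α * α' * (ENNReal.ofReal l ^ (-σ) *
          (ENNReal.ofReal l ^ (1 / 2 : ℝ) * ENNReal.ofReal l ^ (1 / 2 : ℝ))) *
          ((∫⁻ t, c t ^ 2) ^ (1 / 2 : ℝ) * (∫⁻ t, d t ^ 2) ^ (1 / 2 : ℝ)) := by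
        rw [ENNReal.mul_rpow_of_nonneg _ _ (by norm_num), ENNReal.mul_rpow_of_nonneg _ _ (by norm_num)]
        ring
    _ = _ := by
        rw [← ENNReal.rpow_add _ _ hl0 ENNReal.ofReal_ne_top,
          ← ENNReal.rpow_add _ _ hl0 ENNReal.ofReal_ne_top]
        congr 3
        ring

/-- On a set of pairs of times `(s, t)` with `t - s` in a set of diameter at most `l`, the window
estimate in `s` and the trivial bound in `t`. -/
theorem exists_enorm_pairing_push_le (hσ : 1 < σ) :
    ∃ C : ℝ≥0∞, C ≠ ∞ ∧ ∀ {X : Type*} [MeasurableSpace X] {μ : Measure X} [SigmaFinite μ]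
      {𝓗 : Type*} [NormedAddCommGroup 𝓗] [InnerProductSpace ℂ 𝓗] [CompleteSpace 𝓗]
      {V : ℝ → Lp ℂ 2 μ →L[ℂ] 𝓗} {J : Set ℝ} {A : ℝ≥0∞} {F G : ℝ → X → ℂ} {c d : ℝ → ℝ≥0∞}
      {α β β' : ℝ≥0∞} {T : Set ℝ} {l : ℝ}, IsDispersive V J σ A → IsTest μ J F → IsTest μ J G →
      Measurable c → Measurable d →
      (∀ t, eLpNorm (F t) 1 μ ≤ c t * α) → (∀ t, eLpNorm (F t) 2 μ ≤ c t * β) →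
      (∀ t, eLpNorm (G t) 2 μ ≤ d t * β') →
      MeasurableSet T → 0 < l → (∀ s ∈ T, ∀ t ∈ T, |s - t| ≤ l) → volume T ≤ ENNReal.ofReal l →
      ‖pairing (push V F) (push V G) {z | z.2 - z.1 ∈ T}‖ₑ ≤
        (C * (A * α ^ 2) ^ (1 / (2 * σ)) * (β ^ 2) ^ (1 - 1 / (2 * σ)) *
          ENNReal.ofReal l ^ (1 / 2 : ℝ)) ^ (1 / 2 : ℝ) * ENNReal.ofReal l ^ (1 / 2 : ℝ) * β' *
          ((∫⁻ t, c t ^ 2) ^ (1 / 2 : ℝ) * (∫⁻ t, d t ^ 2) ^ (1 / 2 : ℝ)) := by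
  obtain ⟨C, hC, hwin⟩ := exists_enorm_setIntegral_push_sq_le hσ
  refine ⟨C, hC, ?_⟩
  intro X _ μ _ 𝓗 _ _ _ V J A F G c d α β β' T l hV hF hG hc hd hα hβ hβ' hT hl hTl hTv
  set K := C * (A * α ^ 2) ^ (1 / (2 * σ)) * (β ^ 2) ^ (1 - 1 / (2 * σ)) *
          ENNReal.ofReal l ^ (1 / 2 : ℝ) with hK
  have hE : ∀ t : ℝ, MeasurableSet {s : ℝ | t - s ∈ T} := fun t =>
    (show Measurable fun s : ℝ => t - s by fun_prop) hT
  set w : ℝ → ℝ≥0∞ := T.indicator fun _ => 1 with hw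
  have hwm : Measurable w := measurable_const.indicator hT
  have hcw : ∀ t, ∫⁻ s in {s | t - s ∈ T}, c s ^ 2 = ∫⁻ s, w (t - s) * c s ^ 2 := fun t => by
    rw [← lintegral_indicator (hE t)]
    refine lintegral_congr fun s => ?_
    by_cases h : t - s ∈ T
    · rw [Set.indicator_of_mem (by exact h), hw, Set.indicator_of_mem h, one_mul]
    · rw [Set.indicator_of_notMem (by exact h), hw, Set.indicator_of_notMem h, zero_mul]
  have hm : Measurable fun z : ℝ × ℝ => w (z.2 - z.1) * c z.1 ^ 2 := by fun_prop
  have hm' : Measurable fun t => ∫⁻ s, w (t - s) * c s ^ 2 := hm.lintegral_prod_left'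
  have hpt : ∀ t, ‖∫ s in {s | t - s ∈ T}, push V F s‖ₑ * ‖push V G t‖ₑ ≤
      K ^ (1 / 2 : ℝ) * β' * ((∫⁻ s, w (t - s) * c s ^ 2) ^ (1 / 2 : ℝ) * d t) := fun t => by
    have h1 := hwin hV hF hc hα hβ (hE t) hl
      (fun s hs s' hs' => by simpa [abs_sub_comm] using hTl _ hs _ hs')
    rw [hcw, ← hK] at h1
    have h2 : ‖∫ s in {s | t - s ∈ T}, push V F s‖ₑ ≤
        (K * ∫⁻ s, w (t - s) * c s ^ 2) ^ (1 / 2 : ℝ) := by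
      rw [one_div, ENNReal.le_rpow_inv_iff (by norm_num)]
      simpa using h1
    refine (mul_le_mul' h2 ((hV.enorm_push_le hG t).trans (hβ' t))).trans_eq ?_
    rw [ENNReal.mul_rpow_of_nonneg _ _ (by norm_num)]
    ring
  -- every time `s` is in the windows of a set of times `t` of measure at most `l`
  have hsw : ∫⁻ t, ∫⁻ s, w (t - s) * c s ^ 2 ≤ ENNReal.ofReal l * ∫⁻ s, c s ^ 2 := by
    rw [lintegral_lintegral_swap (f := fun t s => w (t - s) * c s ^ 2)
      (by unfold Function.uncurry; fun_prop)]
    calc ∫⁻ s, ∫⁻ t, w (t - s) * c s ^ 2 = ∫⁻ s, volume T * c s ^ 2 := by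
          refine lintegral_congr fun s => ?_
          rw [lintegral_mul_const _ (by fun_prop), hw, lintegral_indicator_sub_right hT]
      _ ≤ _ := by
          rw [lintegral_const_mul _ (by fun_prop)]
          exact mul_le_mul_left hTv _
  calc _ ≤ ∫⁻ t, ‖∫ s in {s | t - s ∈ T}, push V F s‖ₑ * ‖push V G t‖ₑ :=
        enorm_pairing_le_lintegral_enorm_setIntegral (hV.integrable_push hF) (hV.integrable_push hG)
          (measurableSet_sub_mem hT)
    _ ≤ ∫⁻ t, K ^ (1 / 2 : ℝ) * β' * ((∫⁻ s, w (t - s) * c s ^ 2) ^ (1 / 2 : ℝ) * d t) :=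
        lintegral_mono hpt
    _ = K ^ (1 / 2 : ℝ) * β' * ∫⁻ t, (∫⁻ s, w (t - s) * c s ^ 2) ^ (1 / 2 : ℝ) * d t :=
        lintegral_const_mul _ ((hm'.pow_const _).mul hd)
    _ ≤ K ^ (1 / 2 : ℝ) * β' * ((ENNReal.ofReal l * ∫⁻ s, c s ^ 2) ^ (1 / 2 : ℝ) *
          (∫⁻ t, d t ^ 2) ^ (1 / 2 : ℝ)) := by
        refine mul_le_mul_right ?_ _
        refine (ENNReal.lintegral_mul_le_Lp_mul_Lq volume Real.HolderConjugate.two_two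
          (hm'.pow_const _).aemeasurable hd.aemeasurable).trans (mul_le_mul' ?_ (by simp))
        refine ENNReal.rpow_le_rpow ?_ (by norm_num)
        refine le_trans (le_of_eq (lintegral_congr fun t => ?_)) hsw
        rw [← ENNReal.rpow_mul]
        norm_num
    _ = _ := by
        rw [ENNReal.mul_rpow_of_nonneg (ENNReal.ofReal l) _ (by norm_num)]
        ring

end IsDispersive

end Shell

/-- Three linear forms in `x` and `y` of which one is always nonpositive, with a bound proportional to
`|x| + |y|`. They are the exponents of the dispersive bound and of the two window estimates for the
interaction of two atoms. A combination of the forms with positive weights vanishes: this is where `1 < σ` is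
needed. -/
theorem exists_le_neg_mul_abs_add_abs {σ : ℝ} (hσ : 1 < σ) : ∃ δ : ℝ, 0 < δ ∧ ∀ x y : ℝ,
    (σ - 1) / (2 * σ) * (x + y) ≤ -δ * (|x| + |y|) ∨ -(x + 2 * y) / (4 * σ) ≤ -δ * (|x| + |y|) ∨
      -(2 * x + y) / (4 * σ) ≤ -δ * (|x| + |y|) := by
  have hσ0 : 0 < 4 * σ := by linarith
  obtain ⟨κ, hκ, hκ1, hκ2⟩ : ∃ κ : ℝ, 0 < κ ∧ κ ≤ 1 / 8 ∧ κ ≤ (σ - 1) / 2 :=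
    ⟨min (1 / 8) ((σ - 1) / 2), lt_min (by norm_num) (by linarith), min_le_left _ _, min_le_right _ _⟩
  refine ⟨κ / (4 * σ), by positivity, fun x y => ?_⟩
  have e1 : (σ - 1) / (2 * σ) * (x + y) = 2 * (σ - 1) * (x + y) / (4 * σ) := by
    field_simp
    ring
  have e2 : -(κ / (4 * σ)) * (|x| + |y|) = -κ * (|x| + |y|) / (4 * σ) := by ring
  rw [e1, e2, div_le_div_iff_of_pos_right hσ0, div_le_div_iff_of_pos_right hσ0,
    div_le_div_iff_of_pos_right hσ0]
  have hmax : |x| + |y| = max |x + y| |x - y| := by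
    rcases abs_cases x with h | h <;> rcases abs_cases y with h' | h' <;>
      rcases abs_cases (x + y) with h2 | h2 <;> rcases abs_cases (x - y) with h3 | h3 <;>
      rcases max_cases |x + y| |x - y| with h4 | h4 <;> linarith
  -- for `0 ≤ x + y` one of the last two forms is negative, and so for `x + y < 0` if `|x - y|` is much
  -- larger than `|x + y|`; otherwise the first form is
  rcases le_total 0 (x + y) with hS | hS
  · have h1 : κ * (|x| + |y|) ≤ 1 / 8 * (|x| + |y|) := by gcongr
    rcases le_total x y with hxy | hxy
    · right; left
      rw [hmax, abs_of_nonneg hS, abs_of_nonpos (by linarith : x - y ≤ 0)] at *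
      rcases max_cases (x + y) (-(x - y)) with h | h <;> linarith
    · right; right
      rw [hmax, abs_of_nonneg hS, abs_of_nonneg (by linarith : 0 ≤ x - y)] at *
      rcases max_cases (x + y) (x - y) with h | h <;> linarith
  · by_cases hD : 4 * -(x + y) ≤ |x - y|
    · have h1 : κ * (|x| + |y|) ≤ 1 / 8 * (|x| + |y|) := by gcongr
      have h2 : |x| + |y| = |x - y| := by
        rw [hmax, max_eq_right]
        rw [abs_of_nonpos hS]
        linarith
      rw [h2] at h1 ⊢
      rcases le_total x y with hxy | hxy
      · right; left
        rw [abs_of_nonpos (by linarith : x - y ≤ 0)] at *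
        linarith
      · right; right
        rw [abs_of_nonneg (by linarith : 0 ≤ x - y)] at *
        linarith
    · left
      have h1 : |x| + |y| ≤ 4 * -(x + y) := by
        rw [hmax, abs_of_nonpos hS]
        exact max_le (by linarith) (by linarith)
      have h2 : κ * (|x| + |y|) ≤ (σ - 1) / 2 * (4 * -(x + y)) := by gcongr
      linarith

section Shell

variable {σ : ℝ} {A : ℝ≥0∞}

namespace IsDispersive

/-- The interaction of atoms on sets of measures about `2 ^ k` and `2 ^ l`, at times at distance about
`2 ^ j`: it decays exponentially away from `k = l = j * σ`. -/
theorem exists_enorm_pairing_push_shell_le (hσ : 1 < σ) (hA : A ≠ ∞) :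
    ∃ (δ : ℝ) (C : ℝ≥0∞), 0 < δ ∧ C ≠ ∞ ∧ ∀ {X : Type*} [MeasurableSpace X] {μ : Measure X}
      [SigmaFinite μ] {𝓗 : Type*} [NormedAddCommGroup 𝓗] [InnerProductSpace ℂ 𝓗] [CompleteSpace 𝓗]
      {V : ℝ → Lp ℂ 2 μ →L[ℂ] 𝓗} {J : Set ℝ} {F G : ℝ → X → ℂ} {c d : ℝ → ℝ≥0∞} {k l j : ℤ}
      {T : Set ℝ}, IsDispersive V J σ A → IsTest μ J F → IsTest μ J G → Measurable c → Measurable d →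
      (∀ t, eLpNorm (F t) 1 μ ≤ c t * 2 ^ (k * ((σ - 1) / (2 * σ)))) →
      (∀ t, eLpNorm (F t) 2 μ ≤ c t * 2 ^ (k * (-(1 / (2 * σ))))) →
      (∀ t, eLpNorm (G t) 1 μ ≤ d t * 2 ^ (l * ((σ - 1) / (2 * σ)))) →
      (∀ t, eLpNorm (G t) 2 μ ≤ d t * 2 ^ (l * (-(1 / (2 * σ))))) →
      MeasurableSet T → (∀ t ∈ T, (2 : ℝ) ^ (j : ℝ) ≤ |t|) →
      (∀ s ∈ T, ∀ t ∈ T, |s - t| ≤ (2 : ℝ) ^ (j : ℝ)) →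
      volume T ≤ ENNReal.ofReal ((2 : ℝ) ^ (j : ℝ)) →
      ‖pairing (push V F) (push V G) {z | z.2 - z.1 ∈ T}‖ₑ ≤
        C * (2 ^ (-δ * |k - j * σ|) * 2 ^ (-δ * |l - j * σ|)) *
          ((∫⁻ t, c t ^ 2) ^ (1 / 2 : ℝ) * (∫⁻ t, d t ^ 2) ^ (1 / 2 : ℝ)) := by
  obtain ⟨C, hC, hwin⟩ := exists_enorm_pairing_push_le hσ
  obtain ⟨δ, hδ, hmin⟩ := exists_le_neg_mul_abs_add_abs hσ
  have hσ0 : 0 < σ := by linarith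
  set θ := 1 / (2 * σ) with hθ
  have hθ0 : 0 ≤ θ := by positivity
  have hθ1 : 0 ≤ 1 - θ := by rw [hθ, sub_nonneg, div_le_one (by positivity)]; linarith
  refine ⟨δ, A + (C * A ^ θ) ^ (1 / 2 : ℝ), hδ, ENNReal.add_ne_top.2 ⟨hA,
    ENNReal.rpow_ne_top_of_nonneg (by norm_num) (ENNReal.mul_ne_top hC
      (ENNReal.rpow_ne_top_of_nonneg hθ0 hA))⟩, ?_⟩
  intro X _ μ _ 𝓗 _ _ _ V J F G c d k l j T hV hF hG hc hd hα hβ hα' hβ' hT hTj hTd hTv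
  have hadd : ∀ x y : ℝ, (2 : ℝ≥0∞) ^ x * 2 ^ y = 2 ^ (x + y) := fun x y =>
    (ENNReal.rpow_add x y (by norm_num) (by norm_num)).symm
  have hmono : ∀ {x y : ℝ}, x ≤ y → (2 : ℝ≥0∞) ^ x ≤ 2 ^ y := fun h =>
    ENNReal.rpow_le_rpow_of_exponent_le (by norm_num) h
  have hj : (0 : ℝ) < 2 ^ (j : ℝ) := by positivity
  have hjj : ENNReal.ofReal ((2 : ℝ) ^ (j : ℝ)) = 2 ^ (j : ℝ) := by
    rw [← ENNReal.ofReal_rpow_of_pos (by norm_num)]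
    norm_num
  -- the window estimate, in a form which applies to `(F, G)` and to `(G, F)`
  have hcalc : ∀ k l : ℝ, (C * (A * ((2 : ℝ≥0∞) ^ (k * ((σ - 1) / (2 * σ)))) ^ 2) ^ θ *
      (((2 : ℝ≥0∞) ^ (k * (-(1 / (2 * σ))))) ^ 2) ^ (1 - θ) * (2 ^ (j : ℝ)) ^ (1 / 2 : ℝ)) ^ (1 / 2 : ℝ) *
      (2 ^ (j : ℝ)) ^ (1 / 2 : ℝ) * 2 ^ (l * (-(1 / (2 * σ)))) = (C * A ^ θ) ^ (1 / 2 : ℝ) *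
      2 ^ (-((k - j * σ) + 2 * (l - j * σ)) / (4 * σ)) := fun k l => by
    have h2 : (0 : ℝ) ≤ 1 / 2 := by norm_num
    simp only [ENNReal.mul_rpow_of_nonneg _ _ hθ0, ENNReal.mul_rpow_of_nonneg _ _ h2,
      ← ENNReal.rpow_natCast, ← ENNReal.rpow_mul]
    calc _ = C ^ (1 / 2 : ℝ) * A ^ (θ * (1 / 2)) *
          (((((2 : ℝ≥0∞) ^ (k * ((σ - 1) / (2 * σ)) * (2 : ℕ) * θ * (1 / 2)) *
            2 ^ (k * -(1 / (2 * σ)) * (2 : ℕ) * (1 - θ) * (1 / 2))) *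
            2 ^ (j * (1 / 2 : ℝ) * (1 / 2))) * 2 ^ (j * (1 / 2 : ℝ))) * 2 ^ (l * -(1 / (2 * σ)))) := by
          simp only [← mul_assoc]
      _ = _ := by
          simp only [hadd]
          congr 2
          rw [hθ]
          field_simp
          push_cast
          ring
  have hwin' : ∀ {F G : ℝ → X → ℂ} {c d : ℝ → ℝ≥0∞} {k l : ℤ} {T : Set ℝ}, IsTest μ J F →
      IsTest μ J G → Measurable c → Measurable d →
      (∀ t, eLpNorm (F t) 1 μ ≤ c t * 2 ^ (k * ((σ - 1) / (2 * σ)))) →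
      (∀ t, eLpNorm (F t) 2 μ ≤ c t * 2 ^ (k * (-(1 / (2 * σ))))) →
      (∀ t, eLpNorm (G t) 2 μ ≤ d t * 2 ^ (l * (-(1 / (2 * σ))))) →
      MeasurableSet T → (∀ s ∈ T, ∀ t ∈ T, |s - t| ≤ (2 : ℝ) ^ (j : ℝ)) →
      volume T ≤ ENNReal.ofReal ((2 : ℝ) ^ (j : ℝ)) →
      ‖pairing (push V F) (push V G) {z | z.2 - z.1 ∈ T}‖ₑ ≤ (C * A ^ θ) ^ (1 / 2 : ℝ) *
        2 ^ (-((k - j * σ) + 2 * (l - j * σ)) / (4 * σ)) *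
          ((∫⁻ t, c t ^ 2) ^ (1 / 2 : ℝ) * (∫⁻ t, d t ^ 2) ^ (1 / 2 : ℝ)) := by
    intro F G c d k l T hF hG hc hd hα hβ hβ' hT hTd hTv
    refine (hwin hV hF hG hc hd hα hβ hβ' hT hj hTd hTv).trans_eq ?_
    rw [hjj, hcalc]
  rw [hadd]
  -- use the dispersive bound or the window estimate in either variable, whichever decays
  rcases hmin (k - j * σ) (l - j * σ) with h | h | h
  · refine (hV.enorm_pairing_push_le hσ0 hF hG hc hd hα hα' hT hj hTj hTv).trans
      (mul_le_mul_left ?_ _)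
    calc _ = A * 2 ^ ((σ - 1) / (2 * σ) * (k - j * σ + (l - j * σ))) := by
          rw [hjj, ← ENNReal.rpow_mul, mul_assoc, mul_assoc, hadd, hadd]
          congr 2
          field_simp
          ring
      _ ≤ _ := mul_le_mul' le_self_add (hmono (h.trans_eq (by ring)))
  · refine (hwin' hF hG hc hd hα hβ hβ' hT hTd hTv).trans (mul_le_mul_left ?_ _)
    exact mul_le_mul' le_add_self (hmono (h.trans_eq (by ring)))
  -- exchange the two functions
  · have hsw : {z : ℝ × ℝ | z.2 - z.1 ∈ -T} = Prod.swap ⁻¹' {z : ℝ × ℝ | z.2 - z.1 ∈ T} := by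
      ext z
      simp
    rw [← enorm_pairing_swap, ← hsw]
    refine (hwin' hG hF hd hc hα' hβ' hβ hT.neg (fun s hs t ht => ?_) ?_).trans ?_
    · refine le_trans (le_of_eq ?_) (hTd _ hs _ ht)
      rw [← abs_neg]
      congr 1
      ring
    · rwa [Measure.measure_neg]
    · rw [mul_comm ((∫⁻ t, d t ^ 2) ^ (1 / 2 : ℝ))]
      refine mul_le_mul_left ?_ _
      exact mul_le_mul' le_add_self (hmono (le_trans (le_of_eq (by ring)) (h.trans_eq (by ring))))

end IsDispersive

end Shell

section Endpoint

variable {X : Type*} [MeasurableSpace X] {μ : Measure X} [SigmaFinite μ]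
  {𝓗 : Type*} [NormedAddCommGroup 𝓗] [InnerProductSpace ℂ 𝓗] [CompleteSpace 𝓗]
  {V : ℝ → Lp ℂ 2 μ →L[ℂ] 𝓗} {J : Set ℝ} {σ : ℝ} {A : ℝ≥0∞}

omit [CompleteSpace 𝓗] in
theorem enorm_pairing_iUnion_le {ι : Type*} [Countable ι] {Φ Ψ : ℝ → 𝓗} (hΦ : Integrable Φ)
    (hΨ : Integrable Ψ) {R : ι → Set (ℝ × ℝ)} (hR : ∀ i, MeasurableSet (R i))
    (hd : Pairwise (Function.onFun Disjoint R)) :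
    ‖pairing Φ Ψ (⋃ i, R i)‖ₑ ≤ ∑' i, ‖pairing Φ Ψ (R i)‖ₑ := by
  rw [pairing, integral_iUnion hR hd (integrable_inner_prod hΦ hΨ).integrableOn]
  exact enorm_tsum_le_tsum_enorm

theorem iUnion_sub_mem_Ico_zpow :
    ⋃ j : ℤ, {z : ℝ × ℝ | z.2 - z.1 ∈ Set.Ico ((2 : ℝ) ^ j) (2 ^ (j + 1))} = {z | z.1 < z.2} := by
  ext z
  simp only [Set.mem_iUnion, Set.mem_ofPred_eq]
  constructor
  · rintro ⟨j, hj, -⟩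
    have : (0 : ℝ) < 2 ^ j := by positivity
    linarith
  · intro h
    exact exists_mem_Ico_zpow (sub_pos.2 h) one_lt_two

theorem pairwise_disjoint_sub_mem_Ico_zpow : Pairwise (Function.onFun Disjoint fun j : ℤ =>
    {z : ℝ × ℝ | z.2 - z.1 ∈ Set.Ico ((2 : ℝ) ^ j) (2 ^ (j + 1))}) := by
  have key : ∀ i j : ℤ, i < j → ∀ z : ℝ, z < (2 : ℝ) ^ (i + 1) → ¬ (2 : ℝ) ^ j ≤ z := by
    intro i j hij z h1 h2
    have : (2 : ℝ) ^ (i + 1) ≤ 2 ^ j := zpow_le_zpow_right₀ (by norm_num) (by omega)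
    linarith
  intro i j hij
  rw [Function.onFun, Set.disjoint_left]
  rintro z ⟨h1, h2⟩ ⟨h3, h4⟩
  rcases lt_or_gt_of_ne hij with h | h
  · exact key i j h _ h2 h3
  · exact key j i h _ h4 h1

namespace IsDispersive

omit [SigmaFinite μ] [CompleteSpace 𝓗] in
theorem lintegral_tsum_enorm_push_ne_top (hV : IsDispersive V J σ A) {f : ℤ → ℝ → X → ℂ}
    (h : ∃ (M : ℝ≥0∞) (R : ℝ), M ≠ ∞ ∧
      ∀ t, ∑' k, ‖slice μ (f k) t‖ₑ ≤ (Set.Icc (-R) R).indicator (fun _ => M) t) :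
    ∫⁻ t, ∑' k, ‖push V (f k) t‖ₑ ≠ ∞ := by
  obtain ⟨M, R, hM, h⟩ := h
  have : ∫⁻ t, ∑' k, ‖push V (f k) t‖ₑ ≤ ∫⁻ t, (Set.Icc (-R) R).indicator (fun _ => M) t :=
    lintegral_mono fun t => (ENNReal.tsum_le_tsum fun k => hV.norm_le _ _).trans (h t)
  refine ne_top_of_le_ne_top ?_ this
  rw [lintegral_indicator measurableSet_Icc, setLIntegral_const]
  exact ENNReal.mul_ne_top hM measure_Icc_lt_top.ne

/-- The double endpoint estimate of Keel and Tao for the retarded bilinear form. -/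
theorem exists_enorm_pairing_lt_le_two (hV : IsDispersive V J σ A) (hJ : MeasurableSet J) (hσ : 1 < σ)
    {q : ℝ≥0∞} (hq : 1 / q.toReal = (σ + 1) / (2 * σ)) :
    ∃ C : ℝ≥0∞, C ≠ ∞ ∧ ∀ F G : ℝ → X → ℂ, IsTest μ J F → IsTest μ J G →
      ‖pairing (push V F) (push V G) {z | z.1 < z.2}‖ₑ ≤
        C * (mixedNorm μ J 2 q F * mixedNorm μ J 2 q G) := by
  have hσ0 : 0 < σ := by linarith
  have hqr : 0 < q.toReal := by
    have : 0 < 1 / q.toReal := by rw [hq]; positivity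
    exact one_div_pos.1 this
  have hq0 : q ≠ 0 := fun h => by simp [h] at hqr
  have hqt : q ≠ ∞ := fun h => by simp [h] at hqr
  have hqv : q.toReal = 2 * σ / (σ + 1) := by rw [← one_div_one_div q.toReal, hq, one_div_div]
  have hq1 : 1 ≤ q := by
    rw [← ENNReal.ofReal_toReal hqt, hqv, ← ENNReal.ofReal_one]
    exact ENNReal.ofReal_le_ofReal (by rw [le_div_iff₀ (by linarith)]; linarith)
  have hq2 : q ≤ 2 := by
    rw [← ENNReal.ofReal_toReal hqt, hqv, show (2 : ℝ≥0∞) = ENNReal.ofReal 2 by norm_num]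
    exact ENNReal.ofReal_le_ofReal (by rw [div_le_iff₀ (by linarith)]; linarith)
  have e1 : 1 - 1 / q.toReal = (σ - 1) / (2 * σ) := by rw [hq]; field_simp; ring
  have e2 : 1 / 2 - 1 / q.toReal = -(1 / (2 * σ)) := by rw [hq]; field_simp; ring
  obtain ⟨C₀, hC₀, hatom⟩ := IsTest.exists_atoms hq1 hq2
  obtain ⟨δ, C₁, hδ, hC₁, hshell⟩ := exists_enorm_pairing_push_shell_le hσ hV.ne_top
  obtain ⟨C₂, hC₂, hsum₂⟩ := exists_tsum_two_rpow_le hδ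
  obtain ⟨C₃, hC₃, hsum₃⟩ := exists_tsum_two_rpow_le (mul_pos hδ hσ0)
  refine ⟨C₁ * (C₂ * C₃) * C₀, ENNReal.mul_ne_top (ENNReal.mul_ne_top hC₁
    (ENNReal.mul_ne_top hC₂ hC₃)) hC₀, fun F G hF hG => ?_⟩
  obtain ⟨f, c, hf, hc, hf1, hf2, hcs, hfs, hfb⟩ := hatom hF
  obtain ⟨g, d, hg, hd, hg1, hg2, hds, hgs, hgb⟩ := hatom hG
  rw [e1] at hf1 hg1
  rw [e2] at hf2 hg2
  have hpush : ∀ {F : ℝ → X → ℂ} {f : ℤ → ℝ → X → ℂ},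
      (∀ t, HasSum (fun k => slice μ (f k) t) (slice μ F t)) →
      ∀ t, HasSum (fun k => push V (f k) t) (push V F t) := fun h t => (V t).hasSum (h t)
  have hfI := fun k => hV.integrable_push (hf k)
  have hgI := fun k => hV.integrable_push (hg k)
  set e : ℤ → ℤ → ℝ≥0∞ := fun k j => 2 ^ (-δ * |(k : ℝ) - j * σ|) with he
  set R : ℤ → Set (ℝ × ℝ) := fun j => {z | z.2 - z.1 ∈ Set.Ico ((2 : ℝ) ^ j) (2 ^ (j + 1))} with hR
  set a : ℤ → ℝ≥0∞ := fun k => (∫⁻ t, c k t ^ 2) ^ (1 / 2 : ℝ) with ha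
  set b : ℤ → ℝ≥0∞ := fun k => (∫⁻ t, d k t ^ 2) ^ (1 / 2 : ℝ) with hb
  -- the coefficients of the atoms are square summable, with sum controlled by the norm of `F`
  have hsq : ∀ {F : ℝ → X → ℂ} {c : ℤ → ℝ → ℝ≥0∞}, IsTest μ J F → (∀ k, Measurable (c k)) →
      (∀ t, ∑' k, c k t ^ 2 ≤ C₀ * eLpNorm (F t) q μ ^ 2) →
      (∑' k, ((∫⁻ t, c k t ^ 2) ^ (1 / 2 : ℝ)) ^ 2) ^ (1 / 2 : ℝ) ≤
        C₀ ^ (1 / 2 : ℝ) * mixedNorm μ J 2 q F := by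
    intro F c hF hc hcs
    have h2 : ∀ x : ℝ≥0∞, (x ^ (1 / 2 : ℝ)) ^ 2 = x := fun x => by
      rw [← ENNReal.rpow_natCast, ← ENNReal.rpow_mul]
      norm_num
    simp only [h2]
    rw [← lintegral_tsum fun k => ((hc k).pow_const 2).aemeasurable, hF.mixedNorm_eq hJ,
      eLpNorm_eq_lintegral_rpow_enorm_toReal (by norm_num) (by norm_num),
      ENNReal.toReal_ofNat, ← ENNReal.mul_rpow_of_nonneg _ _ (by norm_num),
      ← lintegral_const_mul _ ((hF.measurable_eLpNorm hq0 hqt).enorm.pow_const _)]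
    refine ENNReal.rpow_le_rpow (lintegral_mono fun t => (hcs t).trans_eq ?_) (by norm_num)
    simp
  -- one pair of atoms, at times at distance about `2 ^ j`
  have hone : ∀ j k l, ‖pairing (push V (f k)) (push V (g l)) (R j)‖ₑ ≤
      C₁ * (e k j * e l j * (a k * b l)) := by
    intro j k l
    have h2j : (2 : ℝ) ^ (j + 1) = 2 ^ j + 2 ^ j := by rw [zpow_add_one₀ (by norm_num)]; ring
    rw [← mul_assoc]
    refine hshell hV (hf k) (hg l) (hc k) (hd l) (hf1 k) (hf2 k) (hg1 l) (hg2 l) measurableSet_Ico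
      (fun t ht => ?_) (fun s hs t ht => ?_) ?_
    · rw [Real.rpow_intCast]
      exact ht.1.trans (le_abs_self t)
    · rw [Real.rpow_intCast, abs_le]
      rw [h2j] at hs ht
      exact ⟨by linarith [hs.1, ht.2], by linarith [ht.1, hs.2]⟩
    · rw [Real.volume_Ico, Real.rpow_intCast, h2j]
      simp
  have hrow : ∀ j, ‖pairing (push V F) (push V G) (R j)‖ₑ ≤
      ∑' k, ∑' l, C₁ * (e k j * e l j * (a k * b l)) := fun j =>
    (enorm_pairing_le_tsum_left (hV.integrable_push hG) hfI (hpush hfs)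
      (hV.lintegral_tsum_enorm_push_ne_top hfb)).trans <| ENNReal.tsum_le_tsum fun k =>
    (enorm_pairing_le_tsum_right (hfI k) hgI (hpush hgs)
      (hV.lintegral_tsum_enorm_push_ne_top hgb)).trans <| ENNReal.tsum_le_tsum fun l => hone j k l
  -- summation over the dyadic distances `2 ^ j`, with `k = j * σ` as the centre
  have hek : ∀ k, ∑' j, e k j ≤ C₃ := fun k => by
    refine le_trans (le_of_eq (tsum_congr fun j => ?_)) (hsum₃ (k / σ))
    have hkj : |(k : ℝ) - j * σ| = σ * |(j : ℝ) - k / σ| := by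
      rw [abs_sub_comm, show (j : ℝ) * σ - k = σ * (j - k / σ) by field_simp, abs_mul,
        abs_of_pos hσ0]
    rw [show e k j = 2 ^ (-δ * |(k : ℝ) - j * σ|) from rfl, hkj]
    congr 1
    ring
  -- after summation over `j` the interaction matrix satisfies Schur's test
  have hw : ∀ k, ∑' l, ∑' j, e k j * e l j ≤ C₂ * C₃ := fun k => by
    rw [ENNReal.tsum_comm]
    calc ∑' j, ∑' l, e k j * e l j ≤ ∑' j, e k j * C₂ := by
          refine ENNReal.tsum_le_tsum fun j => ?_
          rw [ENNReal.tsum_mul_left]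
          exact mul_le_mul_right (hsum₂ _) _
      _ ≤ C₂ * C₃ := by
          rw [ENNReal.tsum_mul_right, mul_comm]
          exact mul_le_mul_right (hek k) _
  calc ‖pairing (push V F) (push V G) {z | z.1 < z.2}‖ₑ
      ≤ ∑' j, ‖pairing (push V F) (push V G) (R j)‖ₑ := by
        rw [← iUnion_sub_mem_Ico_zpow]
        exact enorm_pairing_iUnion_le (hV.integrable_push hF) (hV.integrable_push hG)
          (fun j => measurableSet_sub_mem measurableSet_Ico) pairwise_disjoint_sub_mem_Ico_zpow
    _ ≤ ∑' j, ∑' k, ∑' l, C₁ * (e k j * e l j * (a k * b l)) := ENNReal.tsum_le_tsum hrow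
    _ = C₁ * ∑' k, ∑' l, (∑' j, e k j * e l j) * (a k * b l) := by
        rw [ENNReal.tsum_comm, ← ENNReal.tsum_mul_left]
        refine tsum_congr fun k => ?_
        rw [ENNReal.tsum_comm, ← ENNReal.tsum_mul_left]
        refine tsum_congr fun l => ?_
        rw [← ENNReal.tsum_mul_right, ← ENNReal.tsum_mul_left]
    _ ≤ C₁ * (C₂ * C₃ * (∑' k, a k ^ 2) ^ (1 / 2 : ℝ) * (∑' l, b l ^ 2) ^ (1 / 2 : ℝ)) := by
        refine mul_le_mul_right (tsum_tsum_schur hw fun l => ?_) _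
        refine le_trans (le_of_eq ?_) (hw l)
        simp only [mul_comm]
    _ ≤ C₁ * (C₂ * C₃ * (C₀ ^ (1 / 2 : ℝ) * mixedNorm μ J 2 q F) *
          (C₀ ^ (1 / 2 : ℝ) * mixedNorm μ J 2 q G)) := by
        gcongr
        · exact hsq hF hc hcs
        · exact hsq hG hd hds
    _ = C₁ * (C₂ * C₃) * (C₀ ^ (1 / 2 : ℝ) * C₀ ^ (1 / 2 : ℝ)) *
          (mixedNorm μ J 2 q F * mixedNorm μ J 2 q G) := by ring
    _ = _ := by
        rw [← ENNReal.rpow_add_of_nonneg _ _ (by norm_num) (by norm_num)]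
        norm_num

/-- The bilinear form over all pairs of times is the sum of the retarded and the advanced one. -/
theorem enorm_integral_push_sq_le (hV : IsDispersive V J σ A) {F : ℝ → X → ℂ} (hF : IsTest μ J F) :
    ‖∫ t, push V F t‖ₑ ^ 2 ≤ 2 * ‖pairing (push V F) (push V F) {z | z.1 < z.2}‖ₑ := by
  have hint := hV.integrable_push hF
  set S : Set (ℝ × ℝ) := {z | z.1 < z.2} with hS
  have hSm : MeasurableSet S := measurableSet_lt measurable_fst measurable_snd
  have h1 : inner ℂ (∫ t, push V F t) (∫ t, push V F t) =
      pairing (push V F) (push V F) S + pairing (push V F) (push V F) (Prod.swap ⁻¹' S) := by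
    have hdis : Disjoint S (Prod.swap ⁻¹' S) := Set.disjoint_left.2 fun z h h' => by
      simp only [hS, Set.mem_preimage, Set.mem_ofPred_eq, Prod.fst_swap, Prod.snd_swap] at h h'
      exact lt_asymm h h'
    have hae : (S ∪ Prod.swap ⁻¹' S : Set (ℝ × ℝ)) =ᵐ[volume] Set.univ := by
      rw [ae_eq_univ]
      have hd : MeasurableSet {z : ℝ × ℝ | z.1 = z.2} :=
        measurableSet_eq_fun measurable_fst measurable_snd
      have : (S ∪ Prod.swap ⁻¹' S : Set (ℝ × ℝ))ᶜ = {z : ℝ × ℝ | z.1 = z.2} := by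
        ext z
        simp only [hS, Set.mem_compl_iff, Set.mem_union, Set.mem_preimage, Set.mem_ofPred_eq,
          Prod.fst_swap, Prod.snd_swap, not_or, not_lt]
        exact ⟨fun h => le_antisymm h.2 h.1, fun h => ⟨h.ge, h.le⟩⟩
      rw [this, Measure.volume_eq_prod, Measure.prod_apply hd]
      refine (lintegral_congr fun s => ?_).trans lintegral_zero
      rw [show Prod.mk s ⁻¹' {z : ℝ × ℝ | z.1 = z.2} = {s} by ext t; simp [eq_comm]]
      simp
    rw [← pairing_univ hint hint, pairing, pairing, pairing, ← setIntegral_union hdis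
      (measurable_swap hSm) (integrable_inner_prod hint hint).integrableOn
      (integrable_inner_prod hint hint).integrableOn, setIntegral_congr_set hae]
  rw [enorm_self_sq_eq, h1, two_mul]
  refine (enorm_add_le _ _).trans_eq ?_
  rw [enorm_pairing_swap]

/-- The dual Strichartz estimate at the endpoint, from the retarded bilinear form with `G = F`. -/
theorem exists_enorm_integral_push_le_two (hV : IsDispersive V J σ A) (hJ : MeasurableSet J)
    (hσ : 1 < σ) {q : ℝ≥0∞} (hq : 1 / q.toReal = (σ + 1) / (2 * σ)) :
    ∃ C : ℝ≥0∞, C ≠ ∞ ∧ ∀ F : ℝ → X → ℂ, IsTest μ J F →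
      ‖∫ t, push V F t‖ₑ ≤ C * mixedNorm μ J 2 q F := by
  obtain ⟨C, hC, h⟩ := hV.exists_enorm_pairing_lt_le_two hJ hσ hq
  refine ⟨(2 * C) ^ (1 / 2 : ℝ), ENNReal.rpow_ne_top_of_nonneg (by norm_num)
    (ENNReal.mul_ne_top (by norm_num) hC), fun F hF => ?_⟩
  have hsq : ‖∫ t, push V F t‖ₑ ^ 2 ≤ 2 * C * mixedNorm μ J 2 q F ^ 2 := by
    refine (hV.enorm_integral_push_sq_le hF).trans ((mul_le_mul_right (h F F hF hF) 2).trans_eq ?_)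
    ring
  have h2 : ∀ u : ℝ≥0∞, (u ^ 2) ^ (1 / 2 : ℝ) = u := fun u => by
    rw [← ENNReal.rpow_natCast, ← ENNReal.rpow_mul]; norm_num
  have := ENNReal.rpow_le_rpow hsq (z := 1 / 2) (by norm_num)
  rwa [ENNReal.mul_rpow_of_nonneg _ _ (by norm_num), h2, h2] at this

end IsDispersive

end Endpoint

/-! ### The Christ–Kiselev lemma -/

/-- A finite mass on the line without atoms can be bisected. -/
theorem exists_setLIntegral_le_half {ρ : ℝ → ℝ≥0∞} (hρ : Measurable ρ) {M : ℝ≥0∞} (hM : M ≠ ∞)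
    (h : ∫⁻ t, ρ t ≤ M) :
    ∃ t₀, ∫⁻ t in Set.Iic t₀, ρ t ≤ M / 2 ∧ ∫⁻ t in (Set.Iic t₀)ᶜ, ρ t ≤ M / 2 := by
  have hfin : ∫⁻ t, ρ t ≠ ∞ := ne_top_of_le_ne_top hM h
  have hfin' : ∀ E : Set ℝ, ∫⁻ t in E, ρ t ≠ ∞ := fun E =>
    ne_top_of_le_ne_top hfin (setLIntegral_le_lintegral _ _)
  have hint : Integrable fun t => (ρ t).toReal := integrable_toReal_of_lintegral_ne_top hρ.aemeasurable hfin
  have hE : ∀ E : Set ℝ, ∫ t in E, (ρ t).toReal = (∫⁻ t in E, ρ t).toReal := fun E =>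
    integral_toReal hρ.aemeasurable (ae_restrict_of_ae (ae_lt_top hρ hfin))
  have hsub : ∀ t, ∫ s in Set.Iic t, (ρ s).toReal =
      (∫ s in Set.Iic 0, (ρ s).toReal) + ∫ s in (0 : ℝ)..t, (ρ s).toReal := fun t => by
    rw [← intervalIntegral.integral_Iic_sub_Iic hint.integrableOn hint.integrableOn]
    ring
  have hcont : Continuous fun t => ∫ s in Set.Iic t, (ρ s).toReal := by
    rw [funext hsub]
    exact Continuous.add continuous_const (intervalIntegral.continuous_primitive
      (fun a b => hint.intervalIntegrable) 0)
  have hbot : Tendsto (fun t => ∫ s in Set.Iic t, (ρ s).toReal) atBot (𝓝 0) := by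
    have := (intervalIntegral_tendsto_integral_Iic (0 : ℝ) hint.integrableOn tendsto_id).const_sub
      (∫ s in Set.Iic 0, (ρ s).toReal)
    rw [sub_self] at this
    refine this.congr fun t => ?_
    rw [hsub t, intervalIntegral.integral_symm t, id, sub_eq_add_neg]
  have htop : Tendsto (fun t => ∫ s in Set.Iic t, (ρ s).toReal) atTop (𝓝 (∫ s, (ρ s).toReal)) := by
    have := (intervalIntegral_tendsto_integral_Ioi (0 : ℝ) hint.integrableOn tendsto_id).const_add
      (∫ s in Set.Iic 0, (ρ s).toReal)
    rw [intervalIntegral.integral_Iic_add_Ioi hint.integrableOn hint.integrableOn] at this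
    exact this.congr fun t => (hsub t).symm
  have hI0 : 0 ≤ ∫ s, (ρ s).toReal := integral_nonneg fun s => ENNReal.toReal_nonneg
  rcases hI0.eq_or_lt with h0 | h0
  · have h1 : ∫⁻ t, ρ t = 0 := by
      have := hE Set.univ
      rw [setIntegral_univ, setLIntegral_univ, ← h0] at this
      exact ((ENNReal.toReal_eq_zero_iff _).1 this.symm).resolve_right hfin
    exact ⟨0, ((setLIntegral_le_lintegral _ _).trans_eq h1).trans zero_le,
      ((setLIntegral_le_lintegral _ _).trans_eq h1).trans zero_le⟩
  obtain ⟨t₀, ht₀⟩ : (∫ s, (ρ s).toReal) / 2 ∈ Set.range fun t => ∫ s in Set.Iic t, (ρ s).toReal :=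
    mem_range_of_exists_le_of_exists_ge hcont
      ((hbot.eventually (ge_mem_nhds (half_pos h0))).exists)
      ((htop.eventually (le_mem_nhds (half_lt_self h0))).exists)
  have hhalf : ∀ E : Set ℝ, ∫ s in E, (ρ s).toReal = (∫ s, (ρ s).toReal) / 2 →
      ∫⁻ t in E, ρ t ≤ M / 2 := fun E h' => by
    rw [hE, ← setIntegral_univ, hE, setLIntegral_univ] at h'
    rw [← ENNReal.toReal_le_toReal (hfin' _) (ENNReal.div_ne_top hM (by norm_num)), h',
      ENNReal.toReal_div, ENNReal.toReal_ofNat]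
    have := ENNReal.toReal_mono hM h
    linarith
  refine ⟨t₀, hhalf _ ht₀, hhalf _ ?_⟩
  have := integral_add_compl (measurableSet_Iic (a := t₀)) hint
  simp only at ht₀
  linarith

/-- Hölder's inequality for a sum of two terms, if the `r`-th powers of `a` and `b` add up to at most
that of `c`. -/
theorem mul_rpow_add_le {a b c : ℝ≥0∞} {r : ℝ} (hr : 1 ≤ r) (h : a ^ r + b ^ r ≤ c ^ r) :
    a + b ≤ 2 ^ (1 - 1 / r) * c := by
  have hr0 : 0 < r := by linarith
  rw [← ENNReal.rpow_le_rpow_iff hr0, ENNReal.mul_rpow_of_nonneg _ _ hr0.le, ← ENNReal.rpow_mul,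
    show (1 - 1 / r) * r = r - 1 by field_simp]
  exact (ENNReal.rpow_add_le_mul_rpow_add_rpow a b hr).trans (mul_le_mul_right h _)

section Splitting

variable {X : Type*} [MeasurableSpace X] {μ : Measure X}
  {𝓗 : Type*} [NormedAddCommGroup 𝓗] [InnerProductSpace ℂ 𝓗]
  {V : ℝ → Lp ℂ 2 μ →L[ℂ] 𝓗} {J : Set ℝ} {σ : ℝ} {A : ℝ≥0∞}

theorem enorm_pairing_le_mul {Φ Ψ : ℝ → 𝓗} {R : Set (ℝ × ℝ)} (hΦ : Integrable Φ)
    (hΨ : Integrable Ψ) : ‖pairing Φ Ψ R‖ₑ ≤ (∫⁻ s, ‖Φ s‖ₑ) * ∫⁻ t, ‖Ψ t‖ₑ := by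
  rw [← lintegral_prod_mul hΦ.1.enorm hΨ.1.enorm]
  exact (enorm_integral_le_lintegral_enorm _).trans
    ((setLIntegral_le_lintegral _ _).trans (lintegral_mono fun z => enorm_inner_le _ _))

theorem pairing_indicator {Φ Ψ : ℝ → 𝓗} {R : Set (ℝ × ℝ)} {E E' : Set ℝ} (hE : MeasurableSet E)
    (hE' : MeasurableSet E') :
    pairing (E.indicator Φ) (E'.indicator Ψ) R = pairing Φ Ψ (R ∩ E ×ˢ E') := by
  rw [pairing, pairing, ← setIntegral_indicator (hE.prod hE')]
  congr 1
  ext1 z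
  by_cases h : z.1 ∈ E <;> by_cases h' : z.2 ∈ E' <;> simp [h, h', Set.indicator]

/-- Cutting the time axis at `t₀`, a retarded pair of times is before `t₀`, or after `t₀`, or is
separated by `t₀`; in the last case the variables are decoupled. -/
theorem enorm_pairing_lt_le_split [CompleteSpace 𝓗] {Φ Ψ : ℝ → 𝓗} (hΦ : Integrable Φ) (hΨ : Integrable Ψ)
    (t₀ : ℝ) :
    ‖pairing Φ Ψ {z | z.1 < z.2}‖ₑ ≤
      ‖pairing ((Set.Iic t₀).indicator Φ) ((Set.Iic t₀).indicator Ψ) {z | z.1 < z.2}‖ₑ +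
      ‖pairing ((Set.Iic t₀)ᶜ.indicator Φ) ((Set.Iic t₀)ᶜ.indicator Ψ) {z | z.1 < z.2}‖ₑ +
      ‖∫ s, (Set.Iic t₀).indicator Φ s‖ₑ * ‖∫ t, (Set.Iic t₀)ᶜ.indicator Ψ t‖ₑ := by
  set E := Set.Iic t₀ with hE
  set S : Set (ℝ × ℝ) := {z | z.1 < z.2} with hS
  have hEm : MeasurableSet E := measurableSet_Iic
  have hSm : MeasurableSet S := measurableSet_lt measurable_fst measurable_snd
  have hI := integrable_inner_prod hΦ hΨ
  have hdec : S = (S ∩ E ×ˢ E ∪ S ∩ Eᶜ ×ˢ Eᶜ) ∪ E ×ˢ Eᶜ := by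
    ext z
    simp only [hS, hE, Set.mem_union, Set.mem_inter_iff, Set.mem_prod, Set.mem_compl_iff, Set.mem_Iic,
      Set.mem_ofPred_eq, not_le]
    constructor
    · intro h
      rcases le_or_gt z.1 t₀ with h1 | h1 <;> rcases le_or_gt z.2 t₀ with h2 | h2
      · exact Or.inl (Or.inl ⟨h, h1, h2⟩)
      · exact Or.inr ⟨h1, h2⟩
      · exact absurd (h.trans_le h2) (not_lt.2 h1.le)
      · exact Or.inl (Or.inr ⟨h, h1, h2⟩)
    · rintro ((h | h) | h)
      · exact h.1
      · exact h.1
      · exact h.1.trans_lt h.2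
  have hd1 : Disjoint (S ∩ E ×ˢ E) (S ∩ Eᶜ ×ˢ Eᶜ) :=
    Set.disjoint_left.2 fun z h h' => h'.2.1 h.2.1
  have hd2 : Disjoint (S ∩ E ×ˢ E ∪ S ∩ Eᶜ ×ˢ Eᶜ) (E ×ˢ Eᶜ) :=
    Set.disjoint_left.2 fun z h h' => h.elim (fun h => h'.2 h.2.2) (fun h => h.2.1 h'.1)
  have e : pairing Φ Ψ S = pairing (E.indicator Φ) (E.indicator Ψ) S +
      pairing (Eᶜ.indicator Φ) (Eᶜ.indicator Ψ) S +
      pairing (E.indicator Φ) (Eᶜ.indicator Ψ) Set.univ := by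
    rw [pairing_indicator hEm hEm, pairing_indicator hEm.compl hEm.compl,
      pairing_indicator hEm hEm.compl, Set.univ_inter]
    conv_lhs => rw [hdec]
    rw [pairing, setIntegral_union hd2 (hEm.prod hEm.compl) hI.integrableOn hI.integrableOn,
      setIntegral_union hd1 (hSm.inter (hEm.compl.prod hEm.compl)) hI.integrableOn hI.integrableOn]
    rfl
  rw [e]
  refine (enorm_add_le _ _).trans (add_le_add (enorm_add_le _ _) ?_)
  rw [pairing_univ (hΦ.indicator hEm) (hΨ.indicator hEm.compl)]
  exact enorm_inner_le _ _

theorem IsTest.lintegral_rpow_eq {F : ℝ → X → ℂ} (hF : IsTest μ J F) (hJ : MeasurableSet J)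
    {p q : ℝ≥0∞} (hp0 : p ≠ 0) (hp : p ≠ ∞) :
    ∫⁻ t, eLpNorm (F t) q μ ^ p.toReal = mixedNorm μ J p q F ^ p.toReal := by
  have hpr : 0 < p.toReal := ENNReal.toReal_pos hp0 hp
  rw [hF.mixedNorm_eq hJ, eLpNorm_eq_lintegral_rpow_enorm_toReal hp0 hp, ← ENNReal.rpow_mul,
    one_div_mul_cancel hpr.ne', ENNReal.rpow_one]
  simp only [enorm_eq_self]

namespace IsDispersive

variable [SigmaFinite μ] [CompleteSpace 𝓗]

/-- The bisection argument behind the Christ–Kiselev lemma, after `n` steps. The term with `η` in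
the distribution `ρ` along which the times are bisected serves to make the remainder small. -/
theorem enorm_pairing_lt_le_sum (hV : IsDispersive V J σ A) (hJ : MeasurableSet J)
    {p q p₁ q₁ : ℝ≥0∞} (hp0 : p ≠ 0) (hp : p ≠ ∞) (hq0 : q ≠ 0) (hq : q ≠ ∞)
    (hp₁ : 1 ≤ p₁) (hp₁' : p₁ ≠ ∞) {C C₁ : ℝ≥0∞}
    (h : ∀ F : ℝ → X → ℂ, IsTest μ J F → ‖∫ t, push V F t‖ₑ ≤ C * mixedNorm μ J p q F)
    (h₁ : ∀ F : ℝ → X → ℂ, IsTest μ J F → ‖∫ t, push V F t‖ₑ ≤ C₁ * mixedNorm μ J p₁ q₁ F)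
    {η : ℝ≥0∞} (hη0 : η ≠ 0) (hη : η ≠ ∞) (n : ℕ) :
    ∀ (F G : ℝ → X → ℂ) (M : ℝ≥0∞), IsTest μ J F → IsTest μ J G → M ≠ ∞ →
      ∫⁻ t, (eLpNorm (F t) q μ ^ p.toReal + η * ‖push V F t‖ₑ) ≤ M →
      ‖pairing (push V F) (push V G) {z | z.1 < z.2}‖ₑ ≤
        C * C₁ * (∑ k ∈ Finset.range n, ((2 : ℝ≥0∞) ^ (1 - 1 / p.toReal - 1 / p₁.toReal)) ^ k) *
          (M ^ (1 / p.toReal) * mixedNorm μ J p₁ q₁ G) +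
        (1 / 2) ^ n * M * η⁻¹ * ∫⁻ t, ‖push V G t‖ₑ := by
  have hpr : 0 < p.toReal := ENNReal.toReal_pos hp0 hp
  have hp₁r : 1 ≤ p₁.toReal := by simpa using ENNReal.toReal_mono hp₁' hp₁
  have hp₁0 : p₁ ≠ 0 := (zero_lt_one.trans_le hp₁).ne'
  induction n with
  | zero =>
    -- the trivial bound of the remainder
    intro F G M hF hG hM hFM
    rw [Finset.sum_range_zero, mul_zero, zero_mul, zero_add, pow_zero, one_mul]
    refine (enorm_pairing_le_mul (hV.integrable_push hF) (hV.integrable_push hG)).trans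
      (mul_le_mul_left ?_ _)
    rw [← ENNReal.div_eq_inv_mul.trans (mul_comm _ _), ENNReal.le_div_iff_mul_le (Or.inl hη0) (Or.inl hη),
      mul_comm, ← lintegral_const_mul _ (hV.stronglyMeasurable_push hF).enorm]
    exact (lintegral_mono fun t => le_add_self).trans hFM
  | succ n ih =>
    intro F G M hF hG hM hFM
    set κ := (2 : ℝ≥0∞) ^ (1 - 1 / p.toReal - 1 / p₁.toReal) with hκ
    set S := ∑ k ∈ Finset.range n, κ ^ k with hS
    set ρ : ℝ → ℝ≥0∞ := fun t => eLpNorm (F t) q μ ^ p.toReal + η * ‖push V F t‖ₑ with hρ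
    have hρm : Measurable ρ := ((hF.measurable_eLpNorm hq0 hq).pow_const _).add
      ((hV.stronglyMeasurable_push hF).enorm.const_mul _)
    obtain ⟨t₀, ht₁, ht₂⟩ := exists_setLIntegral_le_half hρm hM hFM
    set E := Set.Iic t₀ with hE
    have hEm : MeasurableSet E := measurableSet_Iic
    have hind : ∀ D : Set ℝ, MeasurableSet D → ∫⁻ t, (eLpNorm (D.indicator F t) q μ ^ p.toReal +
        η * ‖push V (D.indicator F) t‖ₑ) = ∫⁻ t in D, ρ t := fun D hD => by
      rw [← lintegral_indicator hD, push_indicator]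
      refine lintegral_congr fun t => ?_
      by_cases ht : t ∈ D
      · simp [ht, hρ]
      · simp [ht, hpr]
    have hM2 : M / 2 ≠ ∞ := ENNReal.div_ne_top hM (by norm_num)
    have i1 := ih _ _ _ (hF.indicator hEm) (hG.indicator hEm) hM2 ((hind E hEm).trans_le ht₁)
    have i2 := ih _ _ _ (hF.indicator hEm.compl) (hG.indicator hEm.compl) hM2
      ((hind Eᶜ hEm.compl).trans_le ht₂)
    have hGle : ∀ {p q : ℝ≥0∞} {G : ℝ → X → ℂ} {D : Set ℝ},
        mixedNorm μ J p q (D.indicator G) ≤ mixedNorm μ J p q G := by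
      intro p q G D
      refine eLpNorm_mono_enorm fun t => ?_
      by_cases ht : t ∈ D <;> simp [ht]
    -- the pairs separated by `t₀`: the two variables are decoupled, and both estimates apply
    have i3 : ‖∫ s, E.indicator (push V F) s‖ₑ * ‖∫ t, Eᶜ.indicator (push V G) t‖ₑ ≤
        C * C₁ * (M ^ (1 / p.toReal) * mixedNorm μ J p₁ q₁ G) := by
      rw [← push_indicator, ← push_indicator]
      refine (mul_le_mul' (h _ (hF.indicator hEm)) (h₁ _ (hG.indicator hEm.compl))).trans ?_
      have : mixedNorm μ J p q (E.indicator F) ≤ M ^ (1 / p.toReal) := by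
        rw [one_div, ENNReal.le_rpow_inv_iff hpr]
        refine le_trans ?_ hFM
        refine (ENNReal.rpow_le_rpow hGle hpr.le).trans ?_
        rw [← hF.lintegral_rpow_eq hJ hp0 hp]
        exact lintegral_mono fun t => le_self_add
      refine (mul_le_mul' (mul_le_mul_right this C) (mul_le_mul_right hGle C₁)).trans_eq ?_
      ring
    -- the halves of `F` contribute equally, and those of `G` add up by Hölder's inequality for two terms
    have hsum : mixedNorm μ J p₁ q₁ (E.indicator G) + mixedNorm μ J p₁ q₁ (Eᶜ.indicator G) ≤
        2 ^ (1 - 1 / p₁.toReal) * mixedNorm μ J p₁ q₁ G := by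
      refine mul_rpow_add_le hp₁r (le_of_eq ?_)
      rw [← (hG.indicator hEm).lintegral_rpow_eq hJ hp₁0 hp₁',
        ← (hG.indicator hEm.compl).lintegral_rpow_eq hJ hp₁0 hp₁', ← hG.lintegral_rpow_eq hJ hp₁0 hp₁',
        ← lintegral_add_compl (fun t => eLpNorm (G t) q₁ μ ^ p₁.toReal) hEm,
        ← lintegral_indicator hEm, ← lintegral_indicator hEm.compl]
      congr 1 <;>
      · refine lintegral_congr fun t => ?_
        by_cases ht : t ∈ E <;> simp [ht, zero_lt_one.trans_le hp₁r]
    have hpush : (∫⁻ t, ‖push V (E.indicator G) t‖ₑ) + ∫⁻ t, ‖push V (Eᶜ.indicator G) t‖ₑ =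
        ∫⁻ t, ‖push V G t‖ₑ := by
      rw [← lintegral_add_compl (fun t => ‖push V G t‖ₑ) hEm, ← lintegral_indicator hEm,
        ← lintegral_indicator hEm.compl, push_indicator, push_indicator]
      simp only [enorm_indicator_eq_indicator_enorm]
    -- the total gain in one step is `κ`, which is less than `1` if `1 < 1 / p + 1 / p₁`
    have hMκ : (M / 2) ^ (1 / p.toReal) * 2 ^ (1 - 1 / p₁.toReal) = κ * M ^ (1 / p.toReal) := by
      rw [ENNReal.div_rpow_of_nonneg _ _ (by positivity), hκ, ENNReal.div_eq_inv_mul,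
        ← ENNReal.rpow_neg, mul_right_comm, ← ENNReal.rpow_add _ _ (by norm_num) (by norm_num)]
      congr 2
      ring
    have hsplit := enorm_pairing_lt_le_split (hV.integrable_push hF) (hV.integrable_push hG) t₀
    rw [← push_indicator, ← push_indicator, ← push_indicator, ← push_indicator] at hsplit
    rw [← push_indicator, ← push_indicator] at i3
    refine hsplit.trans ((add_le_add (add_le_add i1 i2) i3).trans ?_)
    calc _ = C * C₁ * S * ((M / 2) ^ (1 / p.toReal) *
          (mixedNorm μ J p₁ q₁ (E.indicator G) + mixedNorm μ J p₁ q₁ (Eᶜ.indicator G))) +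
          (1 / 2) ^ n * (M / 2) * η⁻¹ *
            ((∫⁻ t, ‖push V (E.indicator G) t‖ₑ) + ∫⁻ t, ‖push V (Eᶜ.indicator G) t‖ₑ) +
          C * C₁ * (M ^ (1 / p.toReal) * mixedNorm μ J p₁ q₁ G) := by ring
      _ ≤ C * C₁ * S * ((M / 2) ^ (1 / p.toReal) *
          (2 ^ (1 - 1 / p₁.toReal) * mixedNorm μ J p₁ q₁ G)) +
          (1 / 2) ^ n * (M / 2) * η⁻¹ * (∫⁻ t, ‖push V G t‖ₑ) +
          C * C₁ * (M ^ (1 / p.toReal) * mixedNorm μ J p₁ q₁ G) := by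
        rw [hpush]
        gcongr
      _ = C * C₁ * (κ * S + 1) * (M ^ (1 / p.toReal) * mixedNorm μ J p₁ q₁ G) +
          (1 / 2) ^ (n + 1) * M * η⁻¹ * ∫⁻ t, ‖push V G t‖ₑ := by
        rw [← mul_assoc ((M / 2) ^ (1 / p.toReal)), hMκ, pow_succ,
          show M / 2 = 1 / 2 * M by rw [ENNReal.div_eq_inv_mul, one_div]]
        generalize (1 / 2 : ℝ≥0∞) = x
        ring
      _ = _ := by
        rw [Finset.sum_range_succ', pow_zero, hS, Finset.mul_sum]
        simp only [pow_succ, mul_comm]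

/-- The Christ–Kiselev lemma: two estimates for the integral over all times imply the estimate of
the retarded bilinear form. -/
theorem exists_enorm_pairing_lt_le (hV : IsDispersive V J σ A) (hJ : MeasurableSet J)
    {p q p₁ q₁ : ℝ≥0∞} (hp0 : p ≠ 0) (hp : p ≠ ∞) (hq0 : q ≠ 0) (hq : q ≠ ∞)
    (hp₁ : 1 ≤ p₁) (hp₁' : p₁ ≠ ∞) (hpp : 1 < 1 / p.toReal + 1 / p₁.toReal) {C C₁ : ℝ≥0∞}
    (hC : C ≠ ∞) (hC₁ : C₁ ≠ ∞)
    (h : ∀ F : ℝ → X → ℂ, IsTest μ J F → ‖∫ t, push V F t‖ₑ ≤ C * mixedNorm μ J p q F)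
    (h₁ : ∀ F : ℝ → X → ℂ, IsTest μ J F → ‖∫ t, push V F t‖ₑ ≤ C₁ * mixedNorm μ J p₁ q₁ F) :
    ∃ C' : ℝ≥0∞, C' ≠ ∞ ∧ ∀ F G : ℝ → X → ℂ, IsTest μ J F → IsTest μ J G →
      ‖pairing (push V F) (push V G) {z | z.1 < z.2}‖ₑ ≤
        C' * (mixedNorm μ J p q F * mixedNorm μ J p₁ q₁ G) := by
  have hpr : 0 < p.toReal := ENNReal.toReal_pos hp0 hp
  set κ := (2 : ℝ≥0∞) ^ (1 - 1 / p.toReal - 1 / p₁.toReal) with hκ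
  have hκ1 : κ < 1 := ENNReal.rpow_lt_one_of_one_lt_of_neg (by norm_num) (by linarith)
  refine ⟨C * C₁ * (1 - κ)⁻¹ * 2 ^ (1 / p.toReal), ENNReal.mul_ne_top (ENNReal.mul_ne_top
    (ENNReal.mul_ne_top hC hC₁) (ENNReal.inv_ne_top.2 (tsub_pos_of_lt hκ1).ne'))
    (ENNReal.rpow_ne_top_of_nonneg (by positivity) (by norm_num)), fun F G hF hG => ?_⟩
  set P := ∫⁻ t, ‖push V F t‖ₑ with hP
  set Q := ∫⁻ t, ‖push V G t‖ₑ with hQ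
  have hPt : P ≠ ∞ := hV.lintegral_enorm_push_ne_top hF
  have hQt : Q ≠ ∞ := hV.lintegral_enorm_push_ne_top hG
  set m := ∫⁻ t, eLpNorm (F t) q μ ^ p.toReal with hm
  have hNm := hF.measurable_eLpNorm (μ := μ) hq0 hq
  have hmt : m ≠ ∞ := by
    obtain ⟨M, R, hM, hb⟩ := hF.exists_eLpNorm_le q
    refine ne_top_of_le_ne_top (b := ∫⁻ t, (Set.Icc (-R) R).indicator (fun _ => M ^ p.toReal) t) ?_
      (lintegral_mono fun t => ?_)
    · rw [lintegral_indicator_const measurableSet_Icc]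
      exact ENNReal.mul_ne_top (ENNReal.rpow_ne_top_of_nonneg hpr.le hM) measure_Icc_lt_top.ne
    · refine (ENNReal.rpow_le_rpow (hb t) hpr.le).trans (le_of_eq ?_)
      by_cases ht : t ∈ Set.Icc (-R) R
      · rw [Set.indicator_of_mem ht, Set.indicator_of_mem ht]
      · rw [Set.indicator_of_notMem ht, Set.indicator_of_notMem ht, ENNReal.zero_rpow_of_pos hpr]
  by_cases hP0 : P = 0
  · refine (enorm_pairing_le_mul (hV.integrable_push hF) (hV.integrable_push hG)).trans ?_
    rw [← hP, hP0, zero_mul]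
    exact zero_le
  have hm0 : m ≠ 0 := by
    intro hm0
    refine hP0 ?_
    rw [hm, lintegral_eq_zero_iff (hNm.pow_const _)] at hm0
    rw [hP, lintegral_eq_zero_iff (hV.stronglyMeasurable_push hF).enorm]
    filter_upwards [hm0] with t ht
    have h0 : eLpNorm (F t) q μ = 0 := by simpa [hpr, hpr.le, hpr.not_gt] using ht
    rw [eLpNorm_eq_zero_iff (hF.stronglyMeasurable_apply t).aestronglyMeasurable hq0] at h0
    have := hV.enorm_push_le hF t
    rw [eLpNorm_congr_ae h0, eLpNorm_zero] at this
    exact le_antisymm this zero_le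
  -- with this choice both terms of the distribution have the same mass `m`
  set η := m / P with hη
  have hη0 : η ≠ 0 := ENNReal.div_ne_zero.2 ⟨hm0, hPt⟩
  have hηt : η ≠ ∞ := ENNReal.div_ne_top hmt hP0
  have hM : ∫⁻ t, (eLpNorm (F t) q μ ^ p.toReal + η * ‖push V F t‖ₑ) ≤ 2 * m := by
    rw [lintegral_add_left (hNm.pow_const _), lintegral_const_mul _
      (hV.stronglyMeasurable_push hF).enorm, ← hP, hη, ENNReal.div_mul_cancel hP0 hPt, two_mul]
  have hMt : 2 * m ≠ ∞ := ENNReal.mul_ne_top (by norm_num) hmt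
  have hn := fun n => hV.enorm_pairing_lt_le_sum hJ hp0 hp hq0 hq hp₁ hp₁' h h₁ hη0 hηt n F G (2 * m)
    hF hG hMt hM
  -- the remainder after `n` bisections tends to `0`
  have hlim : Tendsto (fun n : ℕ => C * C₁ * (1 - κ)⁻¹ *
      ((2 * m) ^ (1 / p.toReal) * mixedNorm μ J p₁ q₁ G) + (1 / 2) ^ n * (2 * m) * η⁻¹ * Q) atTop
      (𝓝 (C * C₁ * (1 - κ)⁻¹ * ((2 * m) ^ (1 / p.toReal) * mixedNorm μ J p₁ q₁ G) + 0)) := by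
    refine Tendsto.const_add _ ?_
    have h1 : Tendsto (fun n : ℕ => (1 / 2 : ℝ≥0∞) ^ n) atTop (𝓝 0) :=
      ENNReal.tendsto_pow_atTop_nhds_zero_of_lt_one (by simp)
    have h2 := ENNReal.Tendsto.mul_const h1 (b := 2 * m * η⁻¹ * Q) (Or.inr (ENNReal.mul_ne_top
      (ENNReal.mul_ne_top hMt (ENNReal.inv_ne_top.2 hη0)) hQt))
    simpa [mul_assoc] using h2
  have hfin := ge_of_tendsto' hlim fun n => (hn n).trans (add_le_add_left (mul_le_mul_left
    (mul_le_mul_right ?_ _) _) _)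
  · refine hfin.trans_eq ?_
    rw [add_zero, ENNReal.mul_rpow_of_nonneg _ _ (by positivity), hm, hF.lintegral_rpow_eq hJ hp0 hp,
      ← ENNReal.rpow_mul, mul_one_div_cancel hpr.ne', ENNReal.rpow_one]
    ring
  · rw [← ENNReal.tsum_geometric]
    exact ENNReal.sum_le_tsum _

end IsDispersive

end Splitting

/-! ### Truncation and duality with test functions -/

section Truncation

variable {X : Type*} [MeasurableSpace X] {μ : Measure X} {J : Set ℝ}

theorem IsTest.of_le_mul {F G : ℝ → X → ℂ} (hF : IsTest μ J F) {K : ℝ≥0}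
    (hG : StronglyMeasurable (Function.uncurry G)) (h : ∀ t x, ‖G t x‖ₑ ≤ K * ‖F t x‖ₑ) :
    IsTest μ J G where
  meas := hG
  bound := by
    obtain ⟨B, R, S, hS, hSt, hb⟩ := hF.bound
    refine ⟨K * B, R, S, hS, hSt, fun t x => (h t x).trans ((mul_le_mul_right (hb t x) _).trans_eq ?_)⟩
    by_cases hx : (t, x) ∈ Set.Icc (-R) R ×ˢ S
    · rw [Set.indicator_of_mem hx, Set.indicator_of_mem hx, ENNReal.coe_mul]
    · rw [Set.indicator_of_notMem hx, Set.indicator_of_notMem hx, mul_zero]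
  supp t ht x := by
    have := h t x
    rw [hF.supp t ht x] at this
    simpa using this

variable [SigmaFinite μ]

/-- The truncation of `v` at height `n` to times in `J` of size at most `n` and to the `n`-th set
of an exhaustion of the space by sets of finite measure. -/
noncomputable def truncate (μ : Measure X) [SigmaFinite μ] (J : Set ℝ) (v : ℝ → X → ℂ) (n : ℕ) :
    ℝ → X → ℂ := fun t x =>
  ((J ∩ Set.Icc (-n) n) ×ˢ spanningSets μ n ∩ {z | ‖v z.1 z.2‖ ≤ n}).indicator (Function.uncurry v) (t, x)

variable {v : ℝ → X → ℂ}

theorem enorm_truncate_le (n : ℕ) (t : ℝ) (x : X) : ‖truncate μ J v n t x‖ₑ ≤ ‖v t x‖ₑ := by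
  unfold truncate
  exact enorm_indicator_le_enorm_self _ _

theorem truncate_eq_or (n : ℕ) (t : ℝ) (x : X) :
    truncate μ J v n t x = v t x ∨ truncate μ J v n t x = 0 := by
  unfold truncate
  exact (Set.indicator_eq_zero_or_self _ _ _).symm

theorem eventually_truncate_eq {t : ℝ} (ht : t ∈ J) (x : X) :
    ∀ᶠ n in atTop, truncate μ J v n t x = v t x := by
  obtain ⟨n₁, h₁⟩ := exists_nat_ge |t|
  obtain ⟨n₂, h₂⟩ := exists_nat_ge ‖v t x‖
  have hx : x ∈ ⋃ n, spanningSets μ n := by rw [iUnion_spanningSets]; trivial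
  obtain ⟨n₃, h₃⟩ := Set.mem_iUnion.1 hx
  filter_upwards [eventually_ge_atTop n₁, eventually_ge_atTop n₂, eventually_ge_atTop n₃]
    with n g₁ g₂ g₃
  have g₁' : (n₁ : ℝ) ≤ n := by exact_mod_cast g₁
  have g₂' : (n₂ : ℝ) ≤ n := by exact_mod_cast g₂
  unfold truncate
  rw [Set.indicator_of_mem]
  · rfl
  · exact ⟨⟨⟨ht, abs_le.1 (h₁.trans g₁')⟩, monotone_spanningSets μ g₃ h₃⟩, h₂.trans g₂'⟩

theorem isTest_truncate (hJ : MeasurableSet J) (hv : StronglyMeasurable (Function.uncurry v)) (n : ℕ) :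
    IsTest μ J (truncate μ J v n) where
  meas := by
    have : Function.uncurry (truncate μ J v n) =
        ((J ∩ Set.Icc (-n) n) ×ˢ spanningSets μ n ∩ {z | ‖v z.1 z.2‖ ≤ n}).indicator
          (Function.uncurry v) := by
      ext ⟨t, x⟩
      rfl
    rw [this]
    refine hv.indicator (MeasurableSet.inter ((hJ.inter measurableSet_Icc).prod
      (measurableSet_spanningSets μ n)) ?_)
    exact measurableSet_le hv.norm.measurable measurable_const
  bound := by
    refine ⟨n, n, spanningSets μ n, measurableSet_spanningSets μ n, (measure_spanningSets_lt_top μ n).ne,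
      fun t x => ?_⟩
    unfold truncate
    by_cases h : (t, x) ∈ (J ∩ Set.Icc (-n : ℝ) n) ×ˢ spanningSets μ n ∩ {z | ‖v z.1 z.2‖ ≤ n}
    · rw [Set.indicator_of_mem h, Set.indicator_of_mem (show (t, x) ∈ Set.Icc (-n : ℝ) n ×ˢ spanningSets μ n
        from ⟨h.1.1.2, h.1.2⟩), ← ofReal_norm]
      refine (ENNReal.ofReal_le_ofReal h.2).trans_eq ?_
      simp
    · rw [Set.indicator_of_notMem h, enorm_zero]
      exact zero_le
  supp t ht x := by
    unfold truncate
    exact Set.indicator_of_notMem (fun h => ht h.1.1.1) _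

theorem measurable_eLpNorm_apply {F : ℝ → X → ℂ} (hF : StronglyMeasurable (Function.uncurry F)) {q : ℝ≥0∞}
    (hq0 : q ≠ 0) (hq : q ≠ ∞) : Measurable fun t => eLpNorm (F t) q μ := by
  have h : Measurable fun z : ℝ × X => ‖F z.1 z.2‖ₑ := hF.enorm
  simp only [eLpNorm_eq_lintegral_rpow_enorm_toReal hq0 hq]
  exact ((h.pow_const _).lintegral_prod_right').pow_const _

theorem tendsto_mixedNorm_sub_truncate (hJ : MeasurableSet J)
    (hv : StronglyMeasurable (Function.uncurry v)) {p q : ℝ≥0∞} (hp0 : p ≠ 0) (hp : p ≠ ∞)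
    (hq0 : q ≠ 0) (hq : q ≠ ∞) (h : mixedNorm μ J p q v ≠ ∞) :
    Tendsto (fun n => mixedNorm μ J p q (fun t x => v t x - truncate μ J v n t x)) atTop (𝓝 0) := by
  have hmeas : ∀ n, StronglyMeasurable (Function.uncurry fun t x => v t x - truncate μ J v n t x) :=
    fun n => hv.sub (isTest_truncate hJ hv n).meas
  have hle : ∀ n t x, ‖v t x - truncate μ J v n t x‖ₑ ≤ ‖v t x‖ₑ := fun n t x => by
    rcases truncate_eq_or (μ := μ) (J := J) (v := v) n t x with h | h <;> simp [h]
  have hfin : ∀ᵐ t ∂volume.restrict J, eLpNorm (v t) q μ < ∞ := by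
    have h' := h
    rw [mixedNorm, eLpNorm_eq_lintegral_rpow_enorm_toReal hp0 hp] at h'
    have h2 : ∫⁻ t in J, eLpNorm (v t) q μ ^ p.toReal ≠ ∞ := by
      intro h3
      simp only [enorm_eq_self] at h'
      rw [h3, ENNReal.top_rpow_of_pos (one_div_pos.2 (ENNReal.toReal_pos hp0 hp))] at h'
      exact h' rfl
    filter_upwards [ae_lt_top ((measurable_eLpNorm_apply hv hq0 hq).pow_const _) h2] with t ht
    exact (ENNReal.rpow_lt_top_iff_of_pos (ENNReal.toReal_pos hp0 hp)).1 ht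
  refine tendsto_eLpNorm_of_dominated hp0 hp (g := fun t => eLpNorm (v t) q μ) (fun n => ?_) h
    (fun n => ae_of_all _ fun t => ?_) ?_
  · exact (measurable_eLpNorm_apply (hmeas n) hq0 hq).aestronglyMeasurable
  · exact eLpNorm_mono_enorm fun x => hle n t x
  · filter_upwards [hfin, ae_restrict_mem hJ] with t ht htJ
    refine tendsto_eLpNorm_of_dominated hq0 hq (g := fun x => ‖v t x‖ₑ) (fun n => ?_) ?_
      (fun n => ae_of_all _ fun x => hle n t x) (ae_of_all _ fun x => ?_)
    · exact ((hmeas n).comp_measurable measurable_prodMk_left).aestronglyMeasurable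
    · rw [eLpNorm_enorm]
      exact ht.ne
    · refine tendsto_const_nhds.congr' ?_
      filter_upwards [eventually_truncate_eq (μ := μ) (v := v) htJ x] with n hn
      rw [hn, sub_self]

end Truncation

section Duality

variable {X : Type*} [MeasurableSpace X] {μ : Measure X} [SigmaFinite μ] {J : Set ℝ}

/-- By this relation the `L^q'` norm of `|w| ^ (q - 1)` is a power of the `L^q` norm of `w`. -/
theorem mul_ofReal_toReal_sub_one {q q' : ℝ≥0∞} (h : q.HolderConjugate q') (hq1 : 1 < q) (hq : q ≠ ∞) :
    q' * ENNReal.ofReal (q.toReal - 1) = q := by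
  have h1 : ENNReal.ofReal (q.toReal - 1) = q - 1 := by
    rw [ENNReal.ofReal_sub _ zero_le_one, ENNReal.ofReal_toReal hq, ENNReal.ofReal_one]
  rw [h1, h.conj_eq, add_mul, one_mul, ENNReal.inv_mul_cancel (tsub_pos_of_lt hq1).ne'
    (ENNReal.sub_ne_top hq), tsub_add_cancel_of_le hq1.le]

omit [SigmaFinite μ] in
theorem inner_slice_of_ae_eq {G v : X → ℂ} {u : Lp ℂ 2 μ} {t : ℝ} (hu : u =ᵐ[μ] v) (hG : MemLp G 2 μ) :
    inner ℂ u (slice μ (fun _ : ℝ => G) t) = ∫ x, conj (v x) * G x ∂μ := by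
  rw [L2.inner_def]
  refine integral_congr_ae ?_
  filter_upwards [hu, coeFn_slice (F := fun _ : ℝ => G) (t := t) hG] with x h1 h2
  rw [h1, h2, RCLike.inner_apply, mul_comm]

omit [SigmaFinite μ] in
theorem mixedNorm_ne_top_of_isTest {F : ℝ → X → ℂ} (hF : IsTest μ J F) (hJ : MeasurableSet J)
    (p q : ℝ≥0∞) : mixedNorm μ J p q F ≠ ∞ := by
  obtain ⟨M, R, hM, hb⟩ := hF.exists_eLpNorm_le q
  rw [hF.mixedNorm_eq hJ]
  refine ne_top_of_le_ne_top (b := eLpNorm ((Set.Icc (-R) R).indicator fun _ => M) p volume) ?_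
    (eLpNorm_mono_enorm fun t => by simpa using hb t)
  refine ne_top_of_le_ne_top ?_ (eLpNorm_indicator_const_le _ p)
  exact ENNReal.mul_ne_top (by simpa using hM)
    (ENNReal.rpow_ne_top_of_nonneg (by positivity) measure_Icc_lt_top.ne)

/-- If the slices of the test function `w` vanish or have norms bounded below, and `w` is a
truncation of `v`, then testing `v` against the dual function `|w| ^ (q - 2) w ‖w t‖ ^ (p - q)`
bounds the norm of `w`. -/
theorem mixedNorm_le_of_forall_test_of_truncation (hJ : MeasurableSet J) {p q p' q' : ℝ≥0∞}
    (hp2 : 2 ≤ p) (hp : p ≠ ∞) (hq2 : 2 ≤ q) (hq : q ≠ ∞) (hpp : p.HolderConjugate p')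
    (hqq : q.HolderConjugate q') {u : ℝ → Lp ℂ 2 μ} {v w : ℝ → X → ℂ} (huv : ∀ t, u t =ᵐ[μ] v t)
    (hw : IsTest μ J w) (hvw : ∀ t x, w t x = v t x ∨ w t x = 0) {ε : ℝ≥0∞} (hε : ε ≠ 0)
    (hwε : ∀ t, (∀ x, w t x = 0) ∨ ε ≤ eLpNorm (w t) q μ) {B : ℝ≥0∞}
    (h : ∀ G : ℝ → X → ℂ, IsTest μ J G →
      ‖∫ t, inner ℂ (u t) (slice μ G t)‖ₑ ≤ B * mixedNorm μ J p' q' G) :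
    mixedNorm μ J p q w ≤ B := by
  have hp0 : p ≠ 0 := (lt_of_lt_of_le (by norm_num) hp2).ne'
  have hq0 : q ≠ 0 := (lt_of_lt_of_le (by norm_num) hq2).ne'
  set r := p.toReal with hr
  set s := q.toReal with hs
  have hr2 : 2 ≤ r := by simpa using ENNReal.toReal_mono hp hp2
  have hs2 : 2 ≤ s := by simpa using ENNReal.toReal_mono hq hq2
  set N : ℝ → ℝ := fun t => (eLpNorm (w t) q μ).toReal with hN
  have hNt : ∀ t, eLpNorm (w t) q μ = ENNReal.ofReal (N t) := fun t =>
    (ENNReal.ofReal_toReal (hw.memLp q t).2.ne).symm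
  have hNm : Measurable N := (hw.measurable_eLpNorm hq0 hq).ennreal_toReal
  have hN0 : ∀ t, 0 ≤ N t := fun t => ENNReal.toReal_nonneg
  have hw0 : ∀ t, N t = 0 → ∀ x, w t x = 0 := fun t ht => (hwε t).resolve_right fun h' => by
    rw [hNt, ht, ENNReal.ofReal_zero] at h'
    exact hε (le_antisymm h' zero_le)
  obtain ⟨M, R, hM, hNM⟩ := hw.exists_eLpNorm_le q
  obtain ⟨b, R', S, hS, hSt, hb⟩ := hw.bound
  -- the factor `‖w t‖ ^ (p - q)` is bounded
  obtain ⟨K, hK⟩ : ∃ K : ℝ, ∀ t, w t ≠ 0 → N t ^ (r - s) ≤ K := by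
    have hcont : ContinuousOn (fun x : ℝ => x ^ (r - s)) (Set.Icc (min ε 1).toReal M.toReal) := by
      refine ContinuousOn.rpow_const continuousOn_id fun x hx => Or.inl ?_
      have : 0 < (min ε 1).toReal := ENNReal.toReal_pos (by simp [hε]) (by simp)
      exact (this.trans_le hx.1).ne'
    obtain ⟨K, hK⟩ := (isCompact_Icc.image_of_continuousOn hcont).bddAbove
    refine ⟨K, fun t ht => hK ⟨N t, ⟨?_, ?_⟩, rfl⟩⟩
    · have h1 : ε ≤ eLpNorm (w t) q μ := (hwε t).resolve_left fun h' => ht (funext h')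
      exact ENNReal.toReal_mono (hw.memLp q t).2.ne ((min_le_left _ _).trans h1)
    · exact ENNReal.toReal_mono hM ((hNM t).trans (Set.indicator_le_self _ _ t))
  -- the dual function
  set g : ℝ → X → ℝ := fun t x => ‖w t x‖ ^ (s - 2) * N t ^ (r - s) with hg
  set G : ℝ → X → ℂ := fun t x => w t x * (g t x : ℂ) with hG
  have hgm : Measurable (Function.uncurry g) := by
    have h1 : Measurable fun z : ℝ × X => ‖w z.1 z.2‖ := hw.meas.norm.measurable
    exact (h1.pow_const _).mul ((hNm.comp measurable_fst).pow_const _)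
  have hGm : StronglyMeasurable (Function.uncurry G) :=
    hw.meas.mul (Complex.measurable_ofReal.comp hgm).stronglyMeasurable
  have hGT : IsTest μ J G := by
    refine hw.of_le_mul (K := (((b : ℝ) ^ (s - 2)) * K).toNNReal) hGm fun t x => ?_
    by_cases hx : w t x = 0
    · simp [hG, hx]
    have hwt : w t ≠ 0 := fun h' => hx (by rw [h']; rfl)
    have hbx : ‖w t x‖ ≤ b := by
      have h1 := (hb t x).trans (Set.indicator_le_self _ _ _)
      rw [enorm_eq_nnnorm, ENNReal.coe_le_coe] at h1
      exact_mod_cast h1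
    rw [hG, enorm_mul, mul_comm]
    refine mul_le_mul_left ?_ _
    rw [← ofReal_norm, Complex.norm_real, Real.norm_of_nonneg
      (mul_nonneg (by positivity) (Real.rpow_nonneg (hN0 t) _))]
    refine ENNReal.ofReal_le_ofReal ?_
    exact mul_le_mul (Real.rpow_le_rpow (norm_nonneg _) hbx (by linarith)) (hK t hwt)
      (Real.rpow_nonneg (hN0 t) _) (by positivity)
  have hnormG : ∀ t x, ‖G t x‖ₑ = ‖w t x‖ₑ ^ (s - 1) * ENNReal.ofReal (N t ^ (r - s)) := by
    intro t x
    have h1 : ‖w t x‖ * ‖w t x‖ ^ (s - 2) = ‖w t x‖ ^ (s - 1) := by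
      rw [show s - 1 = 1 + (s - 2) by ring, Real.rpow_add_of_nonneg (norm_nonneg _) (by norm_num)
        (by linarith), Real.rpow_one]
    rw [hG, ← ofReal_norm, norm_mul, Complex.norm_real, Real.norm_of_nonneg
      (mul_nonneg (by positivity) (Real.rpow_nonneg (hN0 t) _)), ← mul_assoc, h1,
      ENNReal.ofReal_mul (by positivity), ← ofReal_norm,
      ENNReal.ofReal_rpow_of_nonneg (norm_nonneg _) (by linarith)]
  have hNG : ∀ t, eLpNorm (G t) q' μ = ENNReal.ofReal (N t) ^ (r - 1) := by
    intro t
    have e1 := mul_ofReal_toReal_sub_one hqq (lt_of_lt_of_le (by norm_num) hq2) hq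
    rcases (hN0 t).eq_or_lt with h0 | h0
    · have : G t = 0 := by
        ext x
        simp [hG, hw0 t h0.symm x]
      rw [this, eLpNorm_zero, ← h0, ENNReal.ofReal_zero, ENNReal.zero_rpow_of_pos (by linarith)]
    · have h2 : eLpNorm (G t) q' μ = ENNReal.ofReal (N t ^ (r - s)) *
          eLpNorm (fun x => ‖w t x‖ ^ (s - 1)) q' μ := by
        rw [← Real.enorm_of_nonneg (Real.rpow_nonneg (hN0 t) _), ← eLpNorm_const_smul]
        refine eLpNorm_congr_enorm_ae (ae_of_all _ fun x => ?_)
        rw [hnormG, Pi.smul_apply, smul_eq_mul, enorm_mul, mul_comm,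
          Real.enorm_of_nonneg (Real.rpow_nonneg (hN0 t) _),
          Real.enorm_of_nonneg (Real.rpow_nonneg (norm_nonneg _) _),
          ← ENNReal.ofReal_rpow_of_nonneg (norm_nonneg (w t x)) (by linarith), ofReal_norm]
      rw [h2, eLpNorm_norm_rpow _ (by linarith), e1, hNt, ← ENNReal.ofReal_rpow_of_pos h0,
        ← ENNReal.rpow_add _ _ (by simpa using h0) ENNReal.ofReal_ne_top]
      congr 1
      ring
  have hmixG : mixedNorm μ J p' q' G = mixedNorm μ J p q w ^ (r - 1) := by
    have e1 := mul_ofReal_toReal_sub_one hpp (lt_of_lt_of_le (by norm_num) hp2) hp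
    rw [hGT.mixedNorm_eq hJ, hw.mixedNorm_eq hJ, funext hNG]
    simp only [hNt]
    have := eLpNorm_enorm_rpow (μ := (volume : Measure ℝ)) (p := p') (q := r - 1)
      (fun t => ENNReal.ofReal (N t)) (by linarith)
    rw [e1] at this
    simpa only [enorm_eq_self] using this
  have hinner : ∀ t, inner ℂ (u t) (slice μ G t) = ((N t ^ r : ℝ) : ℂ) := by
    intro t
    have hNs : ∫ x, ‖w t x‖ ^ s ∂μ = N t ^ s := by
      have h1 := (hw.memLp q t).eLpNorm_eq_integral_rpow_norm hq0 hq
      have hI : 0 ≤ ∫ x, ‖w t x‖ ^ s ∂μ := integral_nonneg fun x => by positivity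
      rw [hN]
      simp only
      rw [h1, ENNReal.toReal_ofReal (Real.rpow_nonneg hI _), ← Real.rpow_mul hI,
        inv_mul_cancel₀ (by linarith), Real.rpow_one]
    have hNr : N t ^ r = N t ^ s * N t ^ (r - s) := by
      rcases (hN0 t).eq_or_lt with h0 | h0
      · rw [← h0, Real.zero_rpow (by linarith), Real.zero_rpow (by linarith), zero_mul]
      · rw [← Real.rpow_add h0]
        congr 1
        ring
    rw [show slice μ G t = slice μ (fun _ : ℝ => G t) t from rfl,
      inner_slice_of_ae_eq (huv t) (hGT.memLp 2 t), hNr, ← hNs, ← integral_mul_const,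
      ← integral_complex_ofReal]
    refine integral_congr_ae (ae_of_all _ fun x => ?_)
    by_cases hx : w t x = 0
    · simp [hG, hx, Real.zero_rpow (by linarith : s ≠ 0)]
    · have h1 : ‖w t x‖ ^ s = ‖w t x‖ ^ 2 * ‖w t x‖ ^ (s - 2) := by
        rw [← Real.rpow_natCast, ← Real.rpow_add (norm_pos_iff.2 hx)]
        congr 1
        push_cast
        ring
      simp only [hG, hg]
      rw [← (hvw t x).resolve_right hx, ← mul_assoc, h1]
      push_cast
      rw [← Complex.conj_mul']
      ring
  have hint : ‖∫ t, inner ℂ (u t) (slice μ G t)‖ₑ = mixedNorm μ J p q w ^ r := by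
    have h1 : ∫⁻ t, ENNReal.ofReal (N t ^ r) = mixedNorm μ J p q w ^ r := by
      rw [← hw.lintegral_rpow_eq hJ hp0 hp]
      refine lintegral_congr fun t => ?_
      rw [hNt, ENNReal.ofReal_rpow_of_nonneg (hN0 t) (by linarith)]
    have h2 : 0 ≤ ∫ t, N t ^ r := integral_nonneg fun t => Real.rpow_nonneg (hN0 t) _
    simp only [hinner]
    rw [integral_complex_ofReal, ← ofReal_norm, Complex.norm_real, Real.norm_of_nonneg h2,
      integral_eq_lintegral_of_nonneg_ae (ae_of_all _ fun t => Real.rpow_nonneg (hN0 t) _)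
      (hNm.pow_const r).aestronglyMeasurable, h1, ENNReal.ofReal_toReal]
    exact ENNReal.rpow_ne_top_of_nonneg (by linarith) (mixedNorm_ne_top_of_isTest hw hJ p q)
  have hY : mixedNorm μ J p q w ≠ ∞ := mixedNorm_ne_top_of_isTest hw hJ p q
  rcases eq_or_ne (mixedNorm μ J p q w) 0 with h0 | h0
  · rw [h0]
    exact zero_le
  have hfin := h G hGT
  rw [hint, hmixG, show r = 1 + (r - 1) by ring, ENNReal.rpow_add _ _ h0 hY, ENNReal.rpow_one,
    show 1 + (r - 1) - 1 = r - 1 by ring] at hfin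
  exact (ENNReal.mul_le_mul_iff_left (by simp [h0, hY]) (by simp [h0, hY])).1 hfin

/-- An `L^p L^q` estimate by duality with test functions. -/
theorem mixedNorm_le_of_forall_test (hJ : MeasurableSet J) {p q p' q' : ℝ≥0∞}
    (hp2 : 2 ≤ p) (hp : p ≠ ∞) (hq2 : 2 ≤ q) (hq : q ≠ ∞) (hpp : p.HolderConjugate p')
    (hqq : q.HolderConjugate q') {u : ℝ → Lp ℂ 2 μ} (hu : StronglyMeasurable u) {B : ℝ≥0∞}
    (h : ∀ G : ℝ → X → ℂ, IsTest μ J G →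
      ‖∫ t, inner ℂ (u t) (slice μ G t)‖ₑ ≤ B * mixedNorm μ J p' q' G) :
    mixedNorm μ J p q (fun t => u t) ≤ B := by
  have hp0 : p ≠ 0 := (lt_of_lt_of_le (by norm_num) hp2).ne'
  have hq0 : q ≠ 0 := (lt_of_lt_of_le (by norm_num) hq2).ne'
  have hr : 0 < p.toReal := ENNReal.toReal_pos hp0 hp
  obtain ⟨v, hv, huv⟩ := exists_stronglyMeasurable_uncurry_ae_eq hu
  have e1 : mixedNorm μ J p q (fun t => u t) = mixedNorm μ J p q v := by
    simp only [mixedNorm]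
    congr 1
    ext1 t
    exact eLpNorm_congr_ae (huv t)
  rw [e1]
  have hT := fun n => isTest_truncate (μ := μ) hJ hv n
  -- the truncations with small slices removed
  set D : ℕ → Set ℝ := fun n => {t | (n + 1 : ℝ≥0∞)⁻¹ ≤ eLpNorm (truncate μ J v n t) q μ} with hD
  have hDm : ∀ n, MeasurableSet (D n) := fun n =>
    measurableSet_le measurable_const ((hT n).measurable_eLpNorm hq0 hq)
  set w : ℕ → ℝ → X → ℂ := fun n => (D n).indicator (truncate μ J v n) with hw
  have hwT : ∀ n, IsTest μ J (w n) := fun n => (hT n).indicator (hDm n)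
  have hwB : ∀ n, mixedNorm μ J p q (w n) ≤ B := fun n => by
    refine mixedNorm_le_of_forall_test_of_truncation hJ hp2 hp hq2 hq hpp hqq huv (hwT n)
      (fun t x => ?_) (ε := (n + 1 : ℝ≥0∞)⁻¹) (by simp) (fun t => ?_) h
    · by_cases ht : t ∈ D n
      · simp only [hw, Set.indicator_of_mem ht]
        exact truncate_eq_or n t x
      · right
        simp [hw, ht]
    · by_cases ht : t ∈ D n
      · right
        simp only [hw, Set.indicator_of_mem ht]
        exact ht
      · left
        intro x
        simp [hw, ht]
  have hlow : ∀ t ∈ J, eLpNorm (v t) q μ ≤ liminf (fun n => eLpNorm (w n t) q μ) atTop := by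
    intro t ht
    have hlim : ∀ x, Tendsto (fun n => truncate μ J v n t x) atTop (𝓝 (v t x)) := fun x =>
      tendsto_const_nhds.congr' ((eventually_truncate_eq (μ := μ) ht x).mono fun n hn => hn.symm)
    have h1 := Lp.eLpNorm_lim_le_liminf_eLpNorm (p := q) (μ := μ) (f := fun n => truncate μ J v n t)
      (fun n => ((hT n).stronglyMeasurable_apply t).aestronglyMeasurable) (v t) (ae_of_all _ hlim)
    rcases eq_or_ne (eLpNorm (v t) q μ) 0 with h0 | h0
    · rw [h0]
      exact zero_le
    refine h1.trans (liminf_le_liminf ?_)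
    -- the norms of the truncations are eventually bounded below
    obtain ⟨c, hc0, hc⟩ := exists_between (pos_iff_ne_zero.2 h0)
    have h2 : ∀ᶠ n in atTop, c < eLpNorm (truncate μ J v n t) q μ :=
      eventually_lt_of_lt_liminf (hc.trans_le h1)
    have h3 : Tendsto (fun n : ℕ => (n + 1 : ℝ≥0∞)⁻¹) atTop (𝓝 0) := by
      have := (tendsto_add_atTop_iff_nat 1).2 ENNReal.tendsto_inv_nat_nhds_zero
      simpa using this
    filter_upwards [h2, h3.eventually (ge_mem_nhds hc0)] with n hn1 hn2
    have : t ∈ D n := hn2.trans hn1.le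
    simp only [hw, Set.indicator_of_mem this]
    exact le_rfl
  have hmeas : ∀ n, Measurable fun t => eLpNorm (w n t) q μ := fun n => (hwT n).measurable_eLpNorm hq0 hq
  have hpow : ∫⁻ t in J, eLpNorm (v t) q μ ^ p.toReal ≤ B ^ p.toReal := by
    calc ∫⁻ t in J, eLpNorm (v t) q μ ^ p.toReal
        ≤ ∫⁻ t in J, liminf (fun n => eLpNorm (w n t) q μ ^ p.toReal) atTop := by
          refine setLIntegral_mono' hJ fun t ht => ?_
          refine (ENNReal.rpow_le_rpow (hlow t ht) hr.le).trans (le_of_eq ?_)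
          exact (ENNReal.orderIsoRpow p.toReal hr).liminf_apply
      _ ≤ liminf (fun n => ∫⁻ t in J, eLpNorm (w n t) q μ ^ p.toReal) atTop :=
          lintegral_liminf_le fun n => (hmeas n).pow_const _
      _ ≤ liminf (fun _ : ℕ => B ^ p.toReal) atTop := by
          refine liminf_le_liminf (Eventually.of_forall fun n => ?_)
          refine (setLIntegral_le_lintegral _ _).trans ?_
          rw [(hwT n).lintegral_rpow_eq hJ hp0 hp]
          exact ENNReal.rpow_le_rpow (hwB n) hr.le
      _ = B ^ p.toReal := by simp
  rw [mixedNorm, eLpNorm_eq_lintegral_rpow_enorm_toReal hp0 hp, one_div, ENNReal.rpow_inv_le_iff hr]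
  simpa only [enorm_eq_self] using hpow

end Duality

/-! ### The homogeneous estimate and weak integrals -/

theorem lintegral_mul_le_eLpNorm_mul_eLpNorm {α : Type*} [MeasurableSpace α] {m : Measure α} {p q : ℝ≥0∞}
    (hpq : p.HolderConjugate q) {f g : α → ℝ≥0∞} (hf : AEMeasurable f m) (hg : AEMeasurable g m) :
    ∫⁻ x, f x * g x ∂m ≤ eLpNorm f p m * eLpNorm g q m := by
  have key : ∀ {f g : α → ℝ≥0∞}, AEMeasurable f m → AEMeasurable g m →
      ∫⁻ x, f x * g x ∂m ≤ eLpNorm f 1 m * eLpNorm g ∞ m := by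
    intro f g hf hg
    rw [eLpNorm_one_eq_lintegral_enorm, eLpNorm_exponent_top, ← lintegral_mul_const'' _ hf.enorm]
    refine lintegral_mono_ae ?_
    filter_upwards [enorm_ae_le_eLpNormEssSup g m] with x hx
    exact mul_le_mul_right hx _
  rcases eq_or_ne p ∞ with rfl | hp
  · have : q = 1 := by rw [hpq.conj_eq]; simp
    subst this
    simp only [mul_comm (f _), mul_comm (eLpNorm f _ _)]
    exact key hg hf
  rcases eq_or_ne q ∞ with rfl | hq
  · have : p = 1 := by rw [hpq.symm.conj_eq]; simp
    subst this
    exact key hf hg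
  have hp0 : p ≠ 0 := hpq.ne_zero
  have hq0 : q ≠ 0 := hpq.symm.ne_zero
  rw [eLpNorm_eq_lintegral_rpow_enorm_toReal hp0 hp, eLpNorm_eq_lintegral_rpow_enorm_toReal hq0 hq]
  have hr : p.toReal.HolderConjugate q.toReal := hpq.toReal_of_ne_top hp hq
  simpa using ENNReal.lintegral_mul_le_Lp_mul_Lq m hr hf hg

section Duhamel

variable {X : Type*} [MeasurableSpace X] {μ : Measure X} [SigmaFinite μ]
  {𝓗 : Type*} [NormedAddCommGroup 𝓗] [InnerProductSpace ℂ 𝓗] [CompleteSpace 𝓗]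
  {V : ℝ → Lp ℂ 2 μ →L[ℂ] 𝓗} {J : Set ℝ} {σ : ℝ} {A : ℝ≥0∞}

theorem lintegral_lintegral_mul_le_mixedNorm {p q p' q' : ℝ≥0∞} (hpp : p.HolderConjugate p')
    (hqq : q.HolderConjugate q') (hq : q ≠ ∞) (hq' : q' ≠ ∞) {f g : ℝ → X → ℂ}
    (hf : StronglyMeasurable (Function.uncurry f)) (hg : StronglyMeasurable (Function.uncurry g))
    (E : Set ℝ) :
    ∫⁻ t in E, ∫⁻ x, ‖f t x‖ₑ * ‖g t x‖ₑ ∂μ ≤ mixedNorm μ E p q f * mixedNorm μ E p' q' g := by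
  refine le_trans (lintegral_mono fun t => ?_) (lintegral_mul_le_eLpNorm_mul_eLpNorm hpp
    (measurable_eLpNorm_apply hf hqq.ne_zero hq).aemeasurable
    (measurable_eLpNorm_apply hg hqq.symm.ne_zero hq').aemeasurable)
  have h1 := lintegral_mul_le_eLpNorm_mul_eLpNorm (m := μ) hqq
    (hf.comp_measurable (measurable_prodMk_left (x := t))).enorm.aemeasurable
    (hg.comp_measurable (measurable_prodMk_left (x := t))).enorm.aemeasurable
  rw [eLpNorm_enorm, eLpNorm_enorm] at h1
  exact h1

namespace IsDispersive

/-- The homogeneous estimate is the adjoint of the estimate for the integral over all times. -/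
theorem mixedNorm_adjoint_le (hV : IsDispersive V J σ A) (hJ : MeasurableSet J)
    (hVa : ∀ h, Continuous fun t => (V t).adjoint h) {p q p' q' : ℝ≥0∞}
    (hp2 : 2 ≤ p) (hp : p ≠ ∞) (hq2 : 2 ≤ q) (hq : q ≠ ∞) (hpp : p.HolderConjugate p')
    (hqq : q.HolderConjugate q') {C : ℝ≥0∞}
    (h : ∀ F : ℝ → X → ℂ, IsTest μ J F → ‖∫ t, push V F t‖ₑ ≤ C * mixedNorm μ J p' q' F) (f : 𝓗) :
    mixedNorm μ J p q (fun t => (V t).adjoint f) ≤ C * ‖f‖ₑ := by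
  refine mixedNorm_le_of_forall_test hJ hp2 hp hq2 hq hpp hqq (hVa f).stronglyMeasurable fun G hG => ?_
  have : ∫ t, inner ℂ ((V t).adjoint f) (slice μ G t) = inner ℂ f (∫ t, push V G t) := by
    rw [← integral_inner (hV.integrable_push hG)]
    refine integral_congr_ae (ae_of_all _ fun t => ?_)
    exact ContinuousLinearMap.adjoint_inner_left _ _ _
  rw [this]
  refine (enorm_inner_le _ _).trans ((mul_le_mul_right (h G hG) _).trans_eq ?_)
  ring

omit [SigmaFinite μ] in
theorem enorm_adjoint_le (hV : IsDispersive V J σ A) (t : ℝ) (f : 𝓗) : ‖(V t).adjoint f‖ₑ ≤ ‖f‖ₑ := by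
  have h1 : ‖V t‖ ≤ 1 := ContinuousLinearMap.opNorm_le_bound _ zero_le_one fun φ => by
    have := hV.norm_le t φ
    rw [enorm_le_iff_norm_le] at this
    simpa using this
  rw [enorm_le_iff_norm_le]
  refine ((V t).adjoint.le_opNorm f).trans ?_
  rw [LinearIsometryEquiv.norm_map]
  exact mul_le_of_le_one_left (norm_nonneg _) h1

omit [SigmaFinite μ] in
theorem mixedNorm_top_two_le {u : ℝ → Lp ℂ 2 μ} {B : ℝ≥0∞} (h : ∀ t, ‖u t‖ₑ ≤ B) :
    mixedNorm μ J ∞ 2 (fun t => u t) ≤ B := by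
  rw [mixedNorm, eLpNorm_exponent_top]
  refine eLpNormEssSup_le_of_ae_enorm_bound (ae_of_all _ fun t => ?_)
  rw [enorm_eq_self]
  exact (Lp.enorm_def _).symm.trans_le (h t)

end IsDispersive

omit [SigmaFinite μ] in
theorem inner_slice_eq_integral {u : Lp ℂ 2 μ} {F : ℝ → X → ℂ} (hF : IsTest μ J F) (t : ℝ) :
    inner ℂ u (slice μ F t) = ∫ x, conj (u x) * F t x ∂μ :=
  inner_slice_of_ae_eq (G := F t) (t := t) EventuallyEq.rfl (hF.memLp 2 t)

/-- The weak integral of `V s (F s)` over `s ∈ E`. It is provided by the Riesz representation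
theorem: by Hölder's inequality and the homogeneous estimate, it converges absolutely when tested
against a vector. -/
theorem exists_weak_integral {p q p' q' : ℝ≥0∞} (hpp : p.HolderConjugate p')
    (hqq : q.HolderConjugate q') (hq : q ≠ ∞) (hq' : q' ≠ ∞) {E : Set ℝ}
    (hVa : ∀ h, Continuous fun t => (V t).adjoint h) {C : ℝ≥0∞} (hC : C ≠ ∞)
    (hhom : ∀ h, mixedNorm μ E p q (fun t => (V t).adjoint h) ≤ C * ‖h‖ₑ) {F : ℝ → X → ℂ}
    (hF : StronglyMeasurable (Function.uncurry F)) (hfin : mixedNorm μ E p' q' F ≠ ∞) :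
    ∃ w : 𝓗, ‖w‖ₑ ≤ C * mixedNorm μ E p' q' F ∧ ∀ h : 𝓗,
      (∀ᵐ s ∂(volume.restrict E), Integrable (fun x => conj ((V s).adjoint h x) * F s x) μ) ∧
      IntegrableOn (fun s => ∫ x, conj ((V s).adjoint h x) * F s x ∂μ) E ∧
      inner ℂ h w = ∫ s in E, ∫ x, conj ((V s).adjoint h x) * F s x ∂μ := by
  set Y := mixedNorm μ E p' q' F with hY
  have hrep : ∀ h, ∃ v : ℝ → X → ℂ, StronglyMeasurable (Function.uncurry v) ∧
      ∀ t, (V t).adjoint h =ᵐ[μ] v t := fun h =>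
    exists_stronglyMeasurable_uncurry_ae_eq (hVa h).stronglyMeasurable
  choose v hv hVv using hrep
  have hmv : ∀ h, mixedNorm μ E p q (v h) ≤ C * ‖h‖ₑ := fun h => by
    refine le_trans (le_of_eq ?_) (hhom h)
    simp only [mixedNorm]
    congr 1
    ext1 t
    exact eLpNorm_congr_ae (hVv h t).symm
  have hlin : ∀ h, ∫⁻ t in E, ∫⁻ x, ‖v h t x‖ₑ * ‖F t x‖ₑ ∂μ ≤ C * ‖h‖ₑ * Y := fun h =>
    (lintegral_lintegral_mul_le_mixedNorm hpp hqq hq hq' (hv h) hF E).trans (mul_le_mul_left (hmv h) _)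
  have hlin' : ∀ h, ∫⁻ t in E, ∫⁻ x, ‖v h t x‖ₑ * ‖F t x‖ₑ ∂μ ≠ ∞ := fun h =>
    ne_top_of_le_ne_top (ENNReal.mul_ne_top (ENNReal.mul_ne_top hC enorm_ne_top) hfin) (hlin h)
  have hcongr : ∀ h t, (fun x => conj ((V t).adjoint h x) * F t x) =ᵐ[μ]
      fun x => conj (v h t x) * F t x := fun h t => by
    filter_upwards [hVv h t] with x hx
    rw [hx]
  have hmeas : ∀ h, StronglyMeasurable (Function.uncurry fun t x => conj (v h t x) * F t x) := fun h =>
    (Complex.continuous_conj.comp_stronglyMeasurable (hv h)).mul hF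
  have hmeas' : ∀ h, StronglyMeasurable fun t => ∫ x, conj (v h t x) * F t x ∂μ := fun h =>
    (hmeas h).integral_prod_right
  have hI1 : ∀ h, ∀ᵐ s ∂(volume.restrict E),
      Integrable (fun x => conj ((V s).adjoint h x) * F s x) μ := fun h => by
    have hm : Measurable fun z : ℝ × X => ‖v h z.1 z.2‖ₑ * ‖F z.1 z.2‖ₑ := (hv h).enorm.mul hF.enorm
    filter_upwards [ae_lt_top hm.lintegral_prod_right' (hlin' h)] with s hs
    refine Integrable.congr ⟨((hmeas h).comp_measurable
      (measurable_prodMk_left (x := s))).aestronglyMeasurable, ?_⟩ (hcongr h s).symm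
    rw [hasFiniteIntegral_iff_enorm]
    simpa using hs
  have hsb : ∀ h s, ‖∫ x, conj ((V s).adjoint h x) * F s x ∂μ‖ₑ ≤ ∫⁻ x, ‖v h s x‖ₑ * ‖F s x‖ₑ ∂μ :=
    fun h s => by
      rw [integral_congr_ae (hcongr h s)]
      refine (enorm_integral_le_lintegral_enorm _).trans_eq ?_
      simp
  have hI2 : ∀ h, IntegrableOn (fun s => ∫ x, conj ((V s).adjoint h x) * F s x ∂μ) E := fun h => by
    refine ⟨?_, ?_⟩
    · refine (hmeas' h).aestronglyMeasurable.congr (ae_of_all _ fun s => ?_)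
      exact (integral_congr_ae (hcongr h s)).symm
    · rw [hasFiniteIntegral_iff_enorm]
      exact (lintegral_mono fun s => hsb h s).trans_lt (hlin' h).lt_top
  have hbound : ∀ h, ‖∫ s in E, ∫ x, conj ((V s).adjoint h x) * F s x ∂μ‖ₑ ≤ C * Y * ‖h‖ₑ := fun h =>
    (enorm_integral_le_lintegral_enorm _).trans ((lintegral_mono fun s => hsb h s).trans
      ((hlin h).trans_eq (by ring)))
  have hCY : C * Y ≠ ∞ := ENNReal.mul_ne_top hC hfin
  have hbound' : ∀ h, ‖∫ s in E, ∫ x, conj ((V s).adjoint h x) * F s x ∂μ‖ ≤ (C * Y).toReal * ‖h‖ :=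
    fun h => by
      have := ENNReal.toReal_mono (ENNReal.mul_ne_top hCY enorm_ne_top) (hbound h)
      simpa [ENNReal.toReal_mul] using this
  have hadd : ∀ h h', ∫ s in E, ∫ x, conj ((V s).adjoint (h + h') x) * F s x ∂μ =
      (∫ s in E, ∫ x, conj ((V s).adjoint h x) * F s x ∂μ) +
        ∫ s in E, ∫ x, conj ((V s).adjoint h' x) * F s x ∂μ := fun h h' => by
    rw [← integral_add (hI2 h) (hI2 h')]
    refine integral_congr_ae ?_
    filter_upwards [hI1 h, hI1 h'] with s h1 h2
    rw [← integral_add h1 h2]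
    refine integral_congr_ae ?_
    rw [map_add]
    filter_upwards [Lp.coeFn_add ((V s).adjoint h) ((V s).adjoint h')] with x hx
    rw [hx, Pi.add_apply, map_add, add_mul]
  have hsmul : ∀ (c : ℂ) h, ∫ s in E, ∫ x, conj ((V s).adjoint (c • h) x) * F s x ∂μ =
      conj c * ∫ s in E, ∫ x, conj ((V s).adjoint h x) * F s x ∂μ := fun c h => by
    rw [← integral_const_mul]
    refine integral_congr_ae (ae_of_all _ fun s => ?_)
    simp only
    rw [← integral_const_mul]
    refine integral_congr_ae ?_
    rw [map_smul]
    filter_upwards [Lp.coeFn_smul c ((V s).adjoint h)] with x hx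
    rw [hx, Pi.smul_apply, smul_eq_mul, map_mul, mul_assoc]
  -- the integral is antilinear in `h`, so its conjugate is represented by a vector
  set l : StrongDual ℂ 𝓗 := LinearMap.mkContinuous
    { toFun := fun h => conj (∫ s in E, ∫ x, conj ((V s).adjoint h x) * F s x ∂μ)
      map_add' := fun h h' => by rw [hadd, map_add]
      map_smul' := fun c h => by
        rw [hsmul, map_mul, Complex.conj_conj, RingHom.id_apply, smul_eq_mul] }
    (C * Y).toReal (fun h => by
      simp only [LinearMap.coe_mk, AddHom.coe_mk, RCLike.norm_conj]
      exact hbound' h) with hl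
  refine ⟨(InnerProductSpace.toDual ℂ 𝓗).symm l, ?_, fun h => ⟨hI1 h, hI2 h, ?_⟩⟩
  · rw [← ofReal_norm, LinearIsometryEquiv.norm_map, ← ENNReal.ofReal_toReal hCY]
    exact ENNReal.ofReal_le_ofReal (LinearMap.mkContinuous_norm_le _ ENNReal.toReal_nonneg _)
  · rw [← inner_conj_symm, InnerProductSpace.toDual_symm_apply, hl]
    simp

end Duhamel

/-! ### The inhomogeneous estimate -/

section Retarded

variable {X : Type*} [MeasurableSpace X] {μ : Measure X} [SigmaFinite μ]
  {𝓗 : Type*} [NormedAddCommGroup 𝓗] [InnerProductSpace ℂ 𝓗] [CompleteSpace 𝓗]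
  {V : ℝ → Lp ℂ 2 μ →L[ℂ] 𝓗} {J : Set ℝ} {σ : ℝ} {A : ℝ≥0∞}

omit [CompleteSpace 𝓗] in
theorem stronglyMeasurable_clm_apply {E : Type*} [NormedAddCommGroup E] [NormedSpace ℂ E]
    {B : ℝ → 𝓗 →L[ℂ] E} (hB : ∀ h, Continuous fun t => B t h) {w : ℝ → 𝓗}
    (hw : StronglyMeasurable w) : StronglyMeasurable fun t => B t (w t) := by
  have h : StronglyMeasurable (Function.uncurry fun s t : ℝ => B s (w t)) :=
    stronglyMeasurable_uncurry_of_continuous_of_stronglyMeasurable (fun t => hB (w t))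
      (fun s => (B s).continuous.comp_stronglyMeasurable hw)
  exact h.comp_measurable (measurable_id.prodMk measurable_id)

omit [CompleteSpace 𝓗] in
theorem _root_.MeasureTheory.StronglyMeasurable.setIntegral_section {Φ : ℝ → 𝓗} (hΦ : StronglyMeasurable Φ)
    {R : Set (ℝ × ℝ)} (hR : MeasurableSet R) :
    StronglyMeasurable fun t => ∫ s in {s | (s, t) ∈ R}, Φ s := by
  have hsec : ∀ t : ℝ, MeasurableSet {s : ℝ | (s, t) ∈ R} := fun t => measurable_prodMk_right hR
  have h1 : StronglyMeasurable (Function.uncurry fun t s =>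
      (Prod.swap ⁻¹' R).indicator (fun z : ℝ × ℝ => Φ z.2) (t, s)) :=
    (hΦ.comp_measurable measurable_snd).indicator (measurable_swap hR)
  have h2 := h1.integral_prod_right (ν := volume)
  have h3 : (fun t => ∫ s in {s | (s, t) ∈ R}, Φ s) =
      fun t => ∫ s, (Prod.swap ⁻¹' R).indicator (fun z : ℝ × ℝ => Φ z.2) (t, s) := by
    ext1 t
    rw [← integral_indicator (hsec t)]
    rfl
  rwa [h3]

namespace IsDispersive

/-- The weak integral is additive, and it is the Bochner integral for test functions. -/
theorem sub_setIntegral_push_eq (hV : IsDispersive V J σ A) (hJ : MeasurableSet J)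
    {F G : ℝ → X → ℂ} (hG : IsTest μ J G) {S : Set ℝ} {w d : 𝓗}
    (hw : ∀ h : 𝓗, (∀ᵐ s ∂(volume.restrict (J ∩ S)),
        Integrable (fun x => conj ((V s).adjoint h x) * F s x) μ) ∧
      IntegrableOn (fun s => ∫ x, conj ((V s).adjoint h x) * F s x ∂μ) (J ∩ S) ∧
      inner ℂ h w = ∫ s in J ∩ S, ∫ x, conj ((V s).adjoint h x) * F s x ∂μ)
    (hd : ∀ h : 𝓗, (∀ᵐ s ∂(volume.restrict (J ∩ S)),
        Integrable (fun x => conj ((V s).adjoint h x) * (F s x - G s x)) μ) ∧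
      IntegrableOn (fun s => ∫ x, conj ((V s).adjoint h x) * (F s x - G s x) ∂μ) (J ∩ S) ∧
      inner ℂ h d = ∫ s in J ∩ S, ∫ x, conj ((V s).adjoint h x) * (F s x - G s x) ∂μ) :
    w - ∫ s in S, push V G s = d := by
  refine ext_inner_left ℂ fun h => ?_
  obtain ⟨a1, a2, a3⟩ := hw h
  obtain ⟨b1, b2, b3⟩ := hd h
  have c1 : inner ℂ h (∫ s in S, push V G s) =
      ∫ s in J ∩ S, ∫ x, conj ((V s).adjoint h x) * G s x ∂μ := by
    have e1 : ∫ s in S, push V G s = ∫ s in J ∩ S, push V G s := by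
      rw [Set.inter_comm, ← setIntegral_indicator hJ]
      congr 1
      ext1 s
      by_cases hs : s ∈ J
      · rw [Set.indicator_of_mem hs]
      · rw [Set.indicator_of_notMem hs, push_of_notMem hG hs]
    rw [e1, ← integral_inner (hV.integrable_push hG).restrict]
    refine integral_congr_ae (ae_of_all _ fun s => ?_)
    simp only
    rw [← inner_slice_eq_integral hG, ContinuousLinearMap.adjoint_inner_left, push]
  have hsub : ∀ᵐ s ∂(volume.restrict (J ∩ S)),
      ∫ x, conj ((V s).adjoint h x) * (F s x - G s x) ∂μ =
      (∫ x, conj ((V s).adjoint h x) * F s x ∂μ) - ∫ x, conj ((V s).adjoint h x) * G s x ∂μ := by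
    filter_upwards [a1, b1] with s hs1 hs2
    have hs3 : Integrable (fun x => conj ((V s).adjoint h x) * G s x) μ := by
      refine (hs1.sub hs2).congr (ae_of_all _ fun x => ?_)
      simp only [Pi.sub_apply]
      ring
    rw [← integral_sub hs1 hs3]
    simp only [mul_sub]
  have hI : IntegrableOn (fun s => ∫ x, conj ((V s).adjoint h x) * G s x ∂μ) (J ∩ S) := by
    refine (a2.sub b2).congr ?_
    filter_upwards [hsub] with s hs
    rw [Pi.sub_apply, hs]
    ring
  rw [inner_sub_right, a3, b3, c1, ← integral_sub a2 hI]
  exact (integral_congr_ae hsub).symm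

/-- The inhomogeneous estimate, from the estimate of the bilinear form over the pairs of times in
`R`. With `V s = U (-s)`, the function `t ↦ (V t)† (w t)` is the integral of `U (t - s) F(s)` over the
times `s` with `(s, t) ∈ R`. -/
theorem exists_inhomogeneous (hV : IsDispersive V J σ A) (hJ : MeasurableSet J)
    (hVa : ∀ h, Continuous fun t => (V t).adjoint h) {p q p' q' p₁ q₁ p₁' q₁' : ℝ≥0∞}
    (hp2 : 2 ≤ p) (hq2 : 2 ≤ q) (hq : q ≠ ∞) (hpq : p = ∞ → q = 2) (hpp : p.HolderConjugate p')
    (hqq : q.HolderConjugate q') (hpp₁ : p₁.HolderConjugate p₁') (hqq₁ : q₁.HolderConjugate q₁')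
    (hq₁ : q₁ ≠ ∞) (hp₁' : p₁' ≠ ∞) (hq₁' : q₁' ≠ ∞) {R : Set (ℝ × ℝ)} (hR : MeasurableSet R)
    {C₁ C₂ : ℝ≥0∞} (hC₁ : C₁ ≠ ∞)
    (hhom : ∀ h, mixedNorm μ J p₁ q₁ (fun t => (V t).adjoint h) ≤ C₁ * ‖h‖ₑ)
    (hpair : ∀ F G : ℝ → X → ℂ, IsTest μ J F → IsTest μ J G →
      ‖pairing (push V F) (push V G) R‖ₑ ≤ C₂ * (mixedNorm μ J p₁' q₁' F * mixedNorm μ J p' q' G))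
    {F : ℝ → X → ℂ} (hF : StronglyMeasurable (Function.uncurry F))
    (hfin : mixedNorm μ J p₁' q₁' F ≠ ∞) :
    ∃ w : ℝ → 𝓗, (∀ t h, (∀ᵐ s ∂(volume.restrict (J ∩ {s | (s, t) ∈ R})),
        Integrable (fun x => conj ((V s).adjoint h x) * F s x) μ) ∧
      IntegrableOn (fun s => ∫ x, conj ((V s).adjoint h x) * F s x ∂μ) (J ∩ {s | (s, t) ∈ R}) ∧
      inner ℂ h (w t) = ∫ s in J ∩ {s | (s, t) ∈ R}, ∫ x, conj ((V s).adjoint h x) * F s x ∂μ) ∧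
      mixedNorm μ J p q (fun t => (V t).adjoint (w t)) ≤ (C₁ + C₂) * mixedNorm μ J p₁' q₁' F := by
  set E : ℝ → Set ℝ := fun t => J ∩ {s | (s, t) ∈ R} with hE
  have hsec : ∀ t : ℝ, MeasurableSet {s : ℝ | (s, t) ∈ R} := fun t => measurable_prodMk_right hR
  have hmono : ∀ (p q : ℝ≥0∞) (f : ℝ → X → ℂ) t, mixedNorm μ (E t) p q f ≤ mixedNorm μ J p q f :=
    fun p q f t => eLpNorm_mono_measure _ (Measure.restrict_mono Set.inter_subset_left le_rfl)
  have hweak : ∀ {F : ℝ → X → ℂ}, StronglyMeasurable (Function.uncurry F) →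
      mixedNorm μ J p₁' q₁' F ≠ ∞ → ∀ t, ∃ w : 𝓗, ‖w‖ₑ ≤ C₁ * mixedNorm μ J p₁' q₁' F ∧ ∀ h : 𝓗,
      (∀ᵐ s ∂(volume.restrict (E t)), Integrable (fun x => conj ((V s).adjoint h x) * F s x) μ) ∧
      IntegrableOn (fun s => ∫ x, conj ((V s).adjoint h x) * F s x ∂μ) (E t) ∧
      inner ℂ h w = ∫ s in E t, ∫ x, conj ((V s).adjoint h x) * F s x ∂μ := fun hF hfin t => by
    obtain ⟨w, h1, h2⟩ := exists_weak_integral hpp₁ hqq₁ hq₁ hq₁' (E := E t) hVa hC₁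
      (fun h => (hmono _ _ _ t).trans (hhom h)) hF (ne_top_of_le_ne_top hfin (hmono _ _ _ t))
    exact ⟨w, h1.trans (mul_le_mul_right (hmono _ _ _ t) _), h2⟩
  choose w hw1 hw2 using hweak hF hfin
  refine ⟨w, hw2, ?_⟩
  set Fn : ℕ → ℝ → X → ℂ := truncate μ J F with hFn
  have hT : ∀ n, IsTest μ J (Fn n) := fun n => isTest_truncate hJ hF n
  set D : ℕ → ℝ → X → ℂ := fun n t x => F t x - Fn n t x with hD
  have hDm : ∀ n, StronglyMeasurable (Function.uncurry (D n)) := fun n => hF.sub (hT n).meas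
  have hlim : Tendsto (fun n => mixedNorm μ J p₁' q₁' (D n)) atTop (𝓝 0) :=
    tendsto_mixedNorm_sub_truncate hJ hF hpp₁.symm.ne_zero hp₁' hqq₁.symm.ne_zero hq₁' hfin
  have hFnle : ∀ n, mixedNorm μ J p₁' q₁' (Fn n) ≤ mixedNorm μ J p₁' q₁' F := fun n =>
    eLpNorm_mono_enorm fun t => by
      simpa using eLpNorm_mono_enorm fun x => enorm_truncate_le (μ := μ) (J := J) (v := F) n t x
  set wn : ℕ → ℝ → 𝓗 := fun n t => ∫ s in {s | (s, t) ∈ R}, push V (Fn n) s with hwn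
  have hwnm : ∀ n, StronglyMeasurable (wn n) := fun n =>
    (hV.stronglyMeasurable_push (hT n)).setIntegral_section hR
  -- `w` is the uniform limit of the integrals of the truncations
  have hwapp : ∀ n t, mixedNorm μ J p₁' q₁' (D n) ≠ ∞ →
      ‖w t - wn n t‖ₑ ≤ C₁ * mixedNorm μ J p₁' q₁' (D n) := fun n t hn => by
    obtain ⟨d, hd1, hd2⟩ := hweak (hDm n) hn t
    rwa [hV.sub_setIntegral_push_eq hJ (hT n) (hw2 t) hd2]
  have hev : ∀ᶠ n in atTop, mixedNorm μ J p₁' q₁' (D n) ≠ ∞ :=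
    (hlim.eventually (gt_mem_nhds ENNReal.zero_lt_top)).mono fun n hn => hn.ne
  have hlimC : Tendsto (fun n => C₁ * mixedNorm μ J p₁' q₁' (D n)) atTop (𝓝 0) := by
    have := ENNReal.Tendsto.const_mul hlim (Or.inr hC₁)
    rwa [mul_zero] at this
  have hwm : StronglyMeasurable w := by
    refine stronglyMeasurable_of_tendsto atTop hwnm (tendsto_pi_nhds.2 fun t => ?_)
    rw [tendsto_iff_edist_tendsto_0]
    refine tendsto_of_tendsto_of_tendsto_of_le_of_le' tendsto_const_nhds hlimC
      (Eventually.of_forall fun n => zero_le) (hev.mono fun n hn => ?_)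
    rw [edist_comm, edist_eq_enorm_sub]
    exact hwapp n t hn
  have hum : StronglyMeasurable fun t => (V t).adjoint (w t) := stronglyMeasurable_clm_apply hVa hwm
  -- for `p = ∞` the bound of the weak integral is enough
  by_cases hp : p = ∞
  · rw [hp, hpq hp]
    refine mixedNorm_top_two_le fun t => (hV.enorm_adjoint_le t _).trans ((hw1 t).trans ?_)
    exact mul_le_mul_left le_self_add _
  refine (mixedNorm_le_of_forall_test hJ hp2 hp hq2 hq hpp hqq hum (B := C₂ * mixedNorm μ J p₁' q₁' F)
    fun G hG => ?_).trans (mul_le_mul_left le_add_self _)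
  have hPI := hV.integrable_push hG
  set P := ∫⁻ t, ‖push V G t‖ₑ with hP
  have hPt : P ≠ ∞ := hV.lintegral_enorm_push_ne_top hG
  -- the pairing estimate for the truncations, up to an error which tends to `0`
  have hbd : ∀ᶠ n in atTop, ‖∫ t, inner ℂ ((V t).adjoint (w t)) (slice μ G t)‖ₑ ≤
      C₂ * mixedNorm μ J p₁' q₁' F * mixedNorm μ J p' q' G + C₁ * mixedNorm μ J p₁' q₁' (D n) * P := by
    filter_upwards [hev] with n hn
    have hi : ∀ {f : ℝ → 𝓗}, StronglyMeasurable f → (∃ M : ℝ≥0∞, M ≠ ∞ ∧ ∀ t, ‖f t‖ₑ ≤ M) →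
        Integrable fun t => inner ℂ (f t) (push V G t) := by
      rintro f hf ⟨M, hM, hfM⟩
      refine ⟨hf.aestronglyMeasurable.inner hPI.1, ?_⟩
      rw [hasFiniteIntegral_iff_enorm]
      refine (lintegral_mono fun t => (enorm_inner_le _ _).trans (mul_le_mul_left (hfM t) _)).trans_lt ?_
      rw [lintegral_const_mul _ (hV.stronglyMeasurable_push hG).enorm]
      exact ENNReal.mul_lt_top hM.lt_top hPt.lt_top
    have i1 : Integrable fun t => inner ℂ (w t) (push V G t) :=
      hi hwm ⟨_, ENNReal.mul_ne_top hC₁ hfin, hw1⟩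
    have i2 : Integrable fun t => inner ℂ (w t - wn n t) (push V G t) :=
      hi (hwm.sub (hwnm n)) ⟨_, ENNReal.mul_ne_top hC₁ hn, fun t => hwapp n t hn⟩
    have i3 : Integrable fun t => inner ℂ (wn n t) (push V G t) := by
      refine (i1.sub i2).congr (ae_of_all _ fun t => ?_)
      simp only [Pi.sub_apply, ← inner_sub_left, sub_sub_cancel]
    have e1 : ∫ t, inner ℂ ((V t).adjoint (w t)) (slice μ G t) =
        pairing (push V (Fn n)) (push V G) R + ∫ t, inner ℂ (w t - wn n t) (push V G t) := by
      rw [pairing_eq_integral_inner (hV.integrable_push (hT n)) hPI hR, ← integral_add i3 i2]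
      refine integral_congr_ae (ae_of_all _ fun t => ?_)
      simp only
      rw [ContinuousLinearMap.adjoint_inner_left, ← inner_add_left]
      simp only [hwn, add_sub_cancel]
      rfl
    rw [e1]
    refine (enorm_add_le _ _).trans (add_le_add ?_ ?_)
    · refine (hpair _ _ (hT n) hG).trans ?_
      rw [← mul_assoc]
      exact mul_le_mul_left (mul_le_mul_right (hFnle n) _) _
    · refine (enorm_integral_le_lintegral_enorm _).trans ?_
      rw [hP, ← lintegral_const_mul _ (hV.stronglyMeasurable_push hG).enorm]
      exact lintegral_mono fun t => (enorm_inner_le _ _).trans (mul_le_mul_left (hwapp n t hn) _)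
  have hlimP : Tendsto (fun n => C₂ * mixedNorm μ J p₁' q₁' F * mixedNorm μ J p' q' G +
      C₁ * mixedNorm μ J p₁' q₁' (D n) * P) atTop
      (𝓝 (C₂ * mixedNorm μ J p₁' q₁' F * mixedNorm μ J p' q' G + 0)) := by
    refine Tendsto.const_add _ ?_
    have := ENNReal.Tendsto.mul_const hlimC (Or.inr hPt)
    rwa [zero_mul] at this
  rw [add_zero] at hlimP
  exact ge_of_tendsto hlimP hbd

end IsDispersive

end Retarded

/-! ### Bounds from integrals over rectangles -/

section Rectangles

variable {M N : Type*} [MeasurableSpace M] [MeasurableSpace N]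

theorem isSetSemiring_prod : IsSetSemiring
    (Set.image2 (fun (s : Set M) (t : Set N) => s ×ˢ t) {s | MeasurableSet s} {t | MeasurableSet t}) where
  empty_mem := ⟨∅, MeasurableSet.empty, ∅, MeasurableSet.empty, by simp⟩
  inter_mem := by
    rintro _ ⟨A, hA, B, hB, rfl⟩ _ ⟨A', hA', B', hB', rfl⟩
    exact ⟨A ∩ A', hA.inter hA', B ∩ B', hB.inter hB', Set.prod_inter_prod.symm⟩
  sdiff_eq_sUnion' := by
    classical
    rintro _ ⟨A, hA, B, hB, rfl⟩ _ ⟨A', hA', B', hB', rfl⟩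
    refine ⟨{(A \ A') ×ˢ B, (A ∩ A') ×ˢ (B \ B')}, ?_, ?_, ?_⟩
    · intro s hs
      rw [Finset.coe_insert, Finset.coe_singleton, Set.mem_insert_iff, Set.mem_singleton_iff] at hs
      rcases hs with rfl | rfl
      · exact ⟨_, hA.diff hA', _, hB, rfl⟩
      · exact ⟨_, hA.inter hA', _, hB.diff hB', rfl⟩
    · rw [Finset.coe_insert, Finset.coe_singleton]
      refine Set.PairwiseDisjoint.insert (Set.pairwiseDisjoint_singleton _ _) ?_
      rintro _ rfl -
      exact Set.disjoint_left.2 fun z h h' => h.1.2 h'.1.2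
    · ext z
      simp only [Finset.coe_insert, Finset.coe_singleton, Set.sUnion_insert, Set.sUnion_singleton,
        Set.mem_union, Set.mem_prod, Set.mem_sdiff, Set.mem_inter_iff]
      tauto

/-- A function whose integrals over rectangles are at most `m` times their measures is bounded by
`m` almost everywhere. -/
theorem ae_norm_le_of_forall_rectangle {ρ : Measure (M × N)} [IsFiniteMeasure ρ] {k : M × N → ℂ}
    (hk : Integrable k ρ) {m : ℝ} (hm : 0 ≤ m) (h : ∀ A B, MeasurableSet A → MeasurableSet B →
      ‖∫ z in A ×ˢ B, k z ∂ρ‖ ≤ m * ρ.real (A ×ˢ B)) :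
    ∀ᵐ z ∂ρ, ‖k z‖ ≤ m := by
  set C : Set (Set (M × N)) := Set.image2 (fun (s : Set M) (t : Set N) => s ×ˢ t)
    {s | MeasurableSet s} {t | MeasurableSet t} with hC
  have hCm : ∀ s ∈ C, MeasurableSet s := by
    rintro _ ⟨A, hA, B, hB, rfl⟩
    exact hA.prod hB
  -- finite unions of rectangles
  have hunion : ∀ P ∈ supClosure C, MeasurableSet P ∧ ‖∫ z in P, k z ∂ρ‖ ≤ m * ρ.real P := by
    intro P hP
    obtain ⟨Q, hQ⟩ := isSetSemiring_prod.mem_supClosure_iff.1 hP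
    have hPQ : P = ⋃ s ∈ Q.parts, s := by
      conv_lhs => rw [← Q.sup_parts]
      rw [Finset.sup_set_eq_biUnion]
      rfl
    have hd : (Q.parts : Set (Set (M × N))).Pairwise (Function.onFun Disjoint fun s => s) := Q.disjoint
    have hm' : ∀ s ∈ Q.parts, MeasurableSet s := fun s hs => hCm s (hQ hs)
    refine ⟨hPQ ▸ Q.parts.measurableSet_biUnion hm', ?_⟩
    rw [hPQ, integral_biUnion_finset _ hm' hd fun s _ => hk.integrableOn,
      measureReal_biUnion_finset hd hm', Finset.mul_sum]
    refine (norm_sum_le _ _).trans (Finset.sum_le_sum fun s hs => ?_)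
    obtain ⟨A, hA, B, hB, rfl⟩ := hQ hs
    exact h A B hA hB
  -- all measurable sets
  have hall : ∀ S, MeasurableSet S → ‖∫ z in S, k z ∂ρ‖ ≤ m * ρ.real S := by
    intro S hS
    set ν := ρ + ρ.withDensity fun z => ‖k z‖ₑ with hν
    have hfin : IsFiniteMeasure (ρ.withDensity fun z => ‖k z‖ₑ) :=
      isFiniteMeasure_withDensity hk.2.ne
    refine le_of_forall_pos_le_add fun ε hε => ?_
    have hε' : 0 < ε / (m + 1) := by positivity
    obtain ⟨P, hP, hPS⟩ := exists_measure_symmDiff_lt_of_generateFrom_isSetSemiring (μ := ν)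
      isSetSemiring_prod ⟨{Set.univ}, Set.countable_singleton _, by
        rw [Set.singleton_subset_iff]
        exact ⟨Set.univ, MeasurableSet.univ, Set.univ, MeasurableSet.univ, Set.univ_prod_univ⟩, by simp⟩
      generateFrom_prod.symm hS (ENNReal.ofReal_pos.2 hε')
    obtain ⟨hPm, hPb⟩ := hunion P hP
    have hsd : MeasurableSet (symmDiff P S) := hPm.symmDiff hS
    rw [hν, Measure.add_apply] at hPS
    -- the measure and the integral of `|k|` over the symmetric difference are both small
    have h1 : ρ.real (symmDiff P S) + ∫ z in symmDiff P S, ‖k z‖ ∂ρ ≤ ε / (m + 1) := by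
      have e1 : ∫ z in symmDiff P S, ‖k z‖ ∂ρ = (∫⁻ z in symmDiff P S, ‖k z‖ₑ ∂ρ).toReal :=
        integral_norm_eq_lintegral_enorm hk.1.restrict
      rw [withDensity_apply _ hsd] at hPS
      rw [e1, measureReal_def, ← ENNReal.toReal_add (measure_ne_top _ _)
        (ne_top_of_le_ne_top hk.2.ne (setLIntegral_le_lintegral _ _))]
      exact ENNReal.toReal_le_of_le_ofReal hε'.le hPS.le
    have h2 : ρ.real P ≤ ρ.real S + ρ.real (symmDiff P S) := by
      refine (measureReal_mono ?_).trans (measureReal_union_le _ _)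
      intro z hz
      by_cases hzS : z ∈ S
      · exact Or.inl hzS
      · exact Or.inr (Or.inl ⟨hz, hzS⟩)
    have h3 : ‖∫ z in S, k z ∂ρ‖ ≤ ‖∫ z in P, k z ∂ρ‖ + ∫ z in symmDiff P S, ‖k z‖ ∂ρ := by
      have e1 : ∫ z in S, k z ∂ρ = (∫ z in P, k z ∂ρ) - ∫ z, (P.indicator k z - S.indicator k z) ∂ρ := by
        rw [integral_sub (hk.indicator hPm) (hk.indicator hS), integral_indicator hPm,
          integral_indicator hS]
        ring
      rw [e1]
      refine (norm_sub_le _ _).trans (add_le_add le_rfl ?_)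
      rw [← integral_indicator hsd]
      refine (norm_integral_le_integral_norm _).trans (integral_mono_of_nonneg
        (ae_of_all _ fun z => norm_nonneg _) (hk.norm.indicator hsd) (ae_of_all _ fun z => ?_))
      by_cases hzP : z ∈ P <;> by_cases hzS : z ∈ S <;>
        simp [hzP, hzS, Set.indicator, Set.mem_symmDiff]
    have h4 : 0 ≤ ∫ z in symmDiff P S, ‖k z‖ ∂ρ := integral_nonneg fun z => norm_nonneg _
    have h5 : 0 ≤ ρ.real (symmDiff P S) := measureReal_nonneg
    calc ‖∫ z in S, k z ∂ρ‖ ≤ m * (ρ.real S + ρ.real (symmDiff P S)) +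
          ∫ z in symmDiff P S, ‖k z‖ ∂ρ :=
          h3.trans (add_le_add (hPb.trans (mul_le_mul_of_nonneg_left h2 hm)) le_rfl)
      _ ≤ m * ρ.real S + (m + 1) * (ρ.real (symmDiff P S) + ∫ z in symmDiff P S, ‖k z‖ ∂ρ) := by
          nlinarith [mul_nonneg hm h4]
      _ ≤ m * ρ.real S + (m + 1) * (ε / (m + 1)) := by gcongr
      _ = m * ρ.real S + ε := by field_simp
  -- bound the real parts of all multiples of `k`; a countable dense set of factors suffices
  have hre : ∀ c : ℂ, ∀ᵐ z ∂ρ, (c * k z).re ≤ m * ‖c‖ := fun c => by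
    refine ae_le_of_forall_setIntegral_le (hk.const_mul c).re (integrable_const _) fun S hS _ => ?_
    rw [setIntegral_const, smul_eq_mul]
    have e1 : ∫ z in S, (c * k z).re ∂ρ = (c * ∫ z in S, k z ∂ρ).re := by
      rw [← integral_const_mul]
      exact integral_re (hk.const_mul c).restrict
    rw [e1]
    refine (Complex.re_le_norm _).trans ?_
    rw [norm_mul]
    nlinarith [mul_le_mul_of_nonneg_left (hall S hS) (norm_nonneg c)]
  have hseq : ∀ᵐ z ∂ρ, ∀ n, (TopologicalSpace.denseSeq ℂ n * k z).re ≤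
      m * ‖TopologicalSpace.denseSeq ℂ n‖ := ae_all_iff.2 fun n => hre _
  filter_upwards [hseq] with z hz
  have hcl : ∀ c : ℂ, (c * k z).re ≤ m * ‖c‖ := by
    have hclosed : IsClosed {c : ℂ | (c * k z).re ≤ m * ‖c‖} :=
      isClosed_le (Complex.continuous_re.comp (continuous_id.mul continuous_const))
        (continuous_const.mul continuous_norm)
    intro c
    have := hclosed.closure_subset_iff.2 (Set.range_subset_iff.2 hz)
      (TopologicalSpace.denseRange_denseSeq ℂ c)
    exact this
  have h1 := hcl (conj (k z))
  rw [Complex.conj_mul', RCLike.norm_conj] at h1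
  have h2 : ‖k z‖ * ‖k z‖ ≤ m * ‖k z‖ := by
    rw [← sq]
    exact_mod_cast h1
  rcases (norm_nonneg (k z)).eq_or_lt with h0 | h0
  · rw [← h0]
    exact hm
  · exact le_of_mul_le_mul_right h2 h0

end Rectangles

/-! ### Tensor products -/

section Tensor

variable {M N : Type*} [MeasurableSpace M] [MeasurableSpace N] {μ : Measure M} {ν : Measure N}
  [SigmaFinite μ] [SigmaFinite ν]

omit [SigmaFinite μ] in
theorem eLpNorm_two_mul_prod {f : M → ℂ} {g : N → ℂ} (hf : AEStronglyMeasurable f μ)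
    (hg : AEStronglyMeasurable g ν) :
    eLpNorm (fun z : M × N => f z.1 * g z.2) 2 (μ.prod ν) = eLpNorm f 2 μ * eLpNorm g 2 ν := by
  simp only [eLpNorm_eq_lintegral_rpow_enorm_toReal (p := 2) (by norm_num) (by norm_num), enorm_mul,
    ENNReal.toReal_ofNat, ENNReal.mul_rpow_of_nonneg _ _ (zero_le_two : (0 : ℝ) ≤ 2)]
  rw [lintegral_prod_mul (hf.enorm.pow_const _) (hg.enorm.pow_const _),
    ENNReal.mul_rpow_of_nonneg _ _ (by norm_num)]

omit [SigmaFinite μ] in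
theorem memLp_two_mul_prod {f : M → ℂ} {g : N → ℂ} (hf : MemLp f 2 μ) (hg : MemLp g 2 ν) :
    MemLp (fun z : M × N => f z.1 * g z.2) 2 (μ.prod ν) :=
  ⟨hf.1.comp_fst.mul hg.1.comp_snd, by
    rw [eLpNorm_two_mul_prod hf.1 hg.1]
    exact ENNReal.mul_lt_top hf.2 hg.2⟩

/-- The tensor product `f(x) g(y)` of square integrable functions, as a bounded bilinear map. -/
noncomputable def tensor (μ : Measure M) (ν : Measure N) [SigmaFinite μ] [SigmaFinite ν] :
    Lp ℂ 2 μ →L[ℂ] Lp ℂ 2 ν →L[ℂ] Lp ℂ 2 (μ.prod ν) :=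
  LinearMap.mkContinuous₂
    (LinearMap.mk₂ ℂ (fun f g => (memLp_two_mul_prod (Lp.memLp f) (Lp.memLp g)).toLp)
      (fun f f' g => by
        refine Lp.ext ((MemLp.coeFn_toLp _).trans ?_)
        filter_upwards [Lp.coeFn_add (memLp_two_mul_prod (Lp.memLp f) (Lp.memLp g)).toLp
          (memLp_two_mul_prod (Lp.memLp f') (Lp.memLp g)).toLp,
          (memLp_two_mul_prod (Lp.memLp f) (Lp.memLp g)).coeFn_toLp,
          (memLp_two_mul_prod (Lp.memLp f') (Lp.memLp g)).coeFn_toLp,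
          Measure.quasiMeasurePreserving_fst.ae_eq_comp (Lp.coeFn_add f f')] with z h1 h2 h3 h4
        simp only [Function.comp_apply] at h4
        rw [h1, Pi.add_apply, h2, h3, h4, Pi.add_apply, add_mul])
      (fun c f g => by
        refine Lp.ext ((MemLp.coeFn_toLp _).trans ?_)
        filter_upwards [Lp.coeFn_smul c (memLp_two_mul_prod (Lp.memLp f) (Lp.memLp g)).toLp,
          (memLp_two_mul_prod (Lp.memLp f) (Lp.memLp g)).coeFn_toLp,
          Measure.quasiMeasurePreserving_fst.ae_eq_comp (Lp.coeFn_smul c f)] with z h1 h2 h4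
        simp only [Function.comp_apply] at h4
        rw [h1, Pi.smul_apply, h2, h4, Pi.smul_apply, smul_mul_assoc])
      (fun f g g' => by
        refine Lp.ext ((MemLp.coeFn_toLp _).trans ?_)
        filter_upwards [Lp.coeFn_add (memLp_two_mul_prod (Lp.memLp f) (Lp.memLp g)).toLp
          (memLp_two_mul_prod (Lp.memLp f) (Lp.memLp g')).toLp,
          (memLp_two_mul_prod (Lp.memLp f) (Lp.memLp g)).coeFn_toLp,
          (memLp_two_mul_prod (Lp.memLp f) (Lp.memLp g')).coeFn_toLp,
          Measure.quasiMeasurePreserving_snd.ae_eq_comp (Lp.coeFn_add g g')] with z h1 h2 h3 h4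
        simp only [Function.comp_apply] at h4
        rw [h1, Pi.add_apply, h2, h3, h4, Pi.add_apply, mul_add])
      (fun c f g => by
        refine Lp.ext ((MemLp.coeFn_toLp _).trans ?_)
        filter_upwards [Lp.coeFn_smul c (memLp_two_mul_prod (Lp.memLp f) (Lp.memLp g)).toLp,
          (memLp_two_mul_prod (Lp.memLp f) (Lp.memLp g)).coeFn_toLp,
          Measure.quasiMeasurePreserving_snd.ae_eq_comp (Lp.coeFn_smul c g)] with z h1 h2 h4
        simp only [Function.comp_apply] at h4
        rw [h1, Pi.smul_apply, h2, h4, Pi.smul_apply, mul_smul_comm]))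
    1 (fun f g => by
      rw [LinearMap.mk₂_apply, one_mul, Lp.norm_toLp, eLpNorm_two_mul_prod (Lp.memLp f).1 (Lp.memLp g).1,
        ENNReal.toReal_mul, ← Lp.norm_def, ← Lp.norm_def])

theorem coeFn_tensor (f : Lp ℂ 2 μ) (g : Lp ℂ 2 ν) :
    tensor μ ν f g =ᵐ[μ.prod ν] fun z => f z.1 * g z.2 :=
  (memLp_two_mul_prod (Lp.memLp f) (Lp.memLp g)).coeFn_toLp

end Tensor

/-! ### Schrödinger flows -/

namespace IsSchrodingerFlow

variable {E : Type*} [NormedAddCommGroup E] [InnerProductSpace ℂ E] [CompleteSpace E]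
  {A : E →ₗ.[ℂ] E} {U : ℝ → E →L[ℂ] E}

theorem norm_apply (h : IsSchrodingerFlow A U) (t : ℝ) (f : E) : ‖U t f‖ = ‖f‖ :=
  ContinuousLinearMap.norm_map_of_mem_unitary (h.unitary t) f

theorem enorm_apply (h : IsSchrodingerFlow A U) (t : ℝ) (f : E) : ‖U t f‖ₑ = ‖f‖ₑ := by
  rw [enorm_eq_iff_norm_eq, h.norm_apply]

theorem zero_apply (h : IsSchrodingerFlow A U) (f : E) : U 0 f = f := by
  rw [h.zero]; rfl

theorem add_apply (h : IsSchrodingerFlow A U) (s t : ℝ) (f : E) : U (s + t) f = U s (U t f) := by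
  rw [h.add]; rfl

theorem adjoint_eq (h : IsSchrodingerFlow A U) (t : ℝ) : (U t).adjoint = U (-t) :=
  left_inv_eq_right_inv (Unitary.star_mul_self_of_mem (h.unitary t))
    (by rw [← h.add, add_neg_cancel, h.zero])

theorem inner_apply_left (h : IsSchrodingerFlow A U) (t : ℝ) (f g : E) :
    inner ℂ (U t f) g = inner ℂ f (U (-t) g) := by
  rw [← h.adjoint_eq, ContinuousLinearMap.adjoint_inner_right]

/-- The flow preserves the domain of its generator and commutes with it. -/
theorem apply_mem_graph (h : IsSchrodingerFlow A U) {f g : E} (hfg : (f, g) ∈ A.graph) (t : ℝ) :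
    (U t f, U t g) ∈ A.graph := by
  rw [h.generator] at hfg ⊢
  have := (U t).restrictScalars ℝ |>.hasFDerivAt.comp_hasDerivAt (0 : ℝ) hfg
  convert this using 1
  · ext τ
    simp [← h.add_apply, add_comm]
  · simp

theorem hasDerivAt (h : IsSchrodingerFlow A U) {f g : E} (hfg : (f, g) ∈ A.graph) (t : ℝ) :
    HasDerivAt (fun t => U t f) (Complex.I • U t g) t := by
  have h0 := (h.generator _ _).1 (h.apply_mem_graph hfg t)
  rw [← sub_self t] at h0
  have := h0.comp_sub_const t t
  simpa [← h.add_apply] using this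

/-- The orbits of the flow are the only solutions of `y' = i A y`: the norm of the difference of
two solutions is conserved. -/
theorem eq_apply_of_hasDerivAt (h : IsSchrodingerFlow A U) {y z : ℝ → E}
    (hyz : ∀ t, (y t, z t) ∈ A.graph) (hy : ∀ t, HasDerivAt y (Complex.I • z t) t) (t : ℝ) :
    y t = U t (y 0) := by
  -- conservation of the norm makes the generator antisymmetric
  have hsymm : ∀ f g : E, (f, g) ∈ A.graph →
      inner ℂ f (Complex.I • g) + inner ℂ (Complex.I • g) f = 0 := by
    intro f g hfg
    have h1 := ((h.generator _ _).1 hfg).inner ℂ ((h.generator _ _).1 hfg)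
    have h2 : (fun t => inner ℂ (U t f) (U t f)) = fun _ => inner ℂ f f := by
      ext t
      rw [inner_self_eq_norm_sq_to_K, inner_self_eq_norm_sq_to_K, h.norm_apply]
    rw [h2, h.zero_apply] at h1
    exact h1.unique (hasDerivAt_const _ _)
  have hd : ∀ t, HasDerivAt (fun t => inner ℂ (y t - U t (y 0)) (y t - U t (y 0))) 0 t := by
    intro t
    have h1 := (hy t).sub (h.hasDerivAt (hyz 0) t)
    have h2 := h1.inner ℂ h1
    rw [← smul_sub] at h2
    rwa [Pi.sub_apply, hsymm _ _ (A.graph.sub_mem (hyz t) (h.apply_mem_graph (hyz 0) t))] at h2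
  have := is_const_of_deriv_eq_zero (fun t => (hd t).differentiableAt) (fun t => (hd t).deriv) t 0
  rw [h.zero_apply, sub_self, inner_zero_left, inner_self_eq_zero, sub_eq_zero] at this
  exact this

end IsSchrodingerFlow

section SumOperator

variable {M N : Type*} [MeasurableSpace M] [MeasurableSpace N] {μ : Measure M} {ν : Measure N}
  [SigmaFinite μ] [SigmaFinite ν]
  {H : Lp ℂ 2 μ →ₗ.[ℂ] Lp ℂ 2 μ} {K : Lp ℂ 2 ν →ₗ.[ℂ] Lp ℂ 2 ν}
  {L : Lp ℂ 2 (μ.prod ν) →ₗ.[ℂ] Lp ℂ 2 (μ.prod ν)}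
  {UH : ℝ → Lp ℂ 2 μ →L[ℂ] Lp ℂ 2 μ} {UK : ℝ → Lp ℂ 2 ν →L[ℂ] Lp ℂ 2 ν}
  {UL : ℝ → Lp ℂ 2 (μ.prod ν) →L[ℂ] Lp ℂ 2 (μ.prod ν)}

/-- Since `L` is closed, the identity `L (f ⊗ g) = H f ⊗ g + f ⊗ K g` extends to the whole
domains of `H` and `K`. -/
theorem IsSumOperator.tensor_mem_graph (hsum : IsSumOperator H K L) (hL : L.IsClosed)
    {f f' : Lp ℂ 2 μ} {g g' : Lp ℂ 2 ν} (hf : (f, f') ∈ H.graph) (hg : (g, g') ∈ K.graph) :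
    (tensor μ ν f g, tensor μ ν f' g + tensor μ ν f g') ∈ L.graph := by
  obtain ⟨DH, DK, hDH, hDK, hD⟩ := hsum
  have hLc : _root_.IsClosed
      (L.graph : Set (Lp ℂ 2 (μ.prod ν) × Lp ℂ 2 (μ.prod ν))) := hL
  -- extend the identity from the dense subsets to the domains, one variable at a time
  have hcore : ∀ u ∈ DH, ∀ v ∈ DK,
      (tensor μ ν u v, tensor μ ν (H u) v + tensor μ ν u (K v)) ∈ L.graph := by
    intro u hu v hv
    obtain ⟨w, hw, hLw⟩ := hD u hu v hv
    rw [LinearPMap.mem_graph_iff]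
    refine ⟨w, Lp.ext (hw.trans (coeFn_tensor _ _).symm), Lp.ext ?_⟩
    filter_upwards [hLw, Lp.coeFn_add (tensor μ ν (H u) v) (tensor μ ν u (K v)),
      coeFn_tensor (H u) (v : Lp ℂ 2 ν), coeFn_tensor (u : Lp ℂ 2 μ) (K v)] with z h1 h2 h3 h4
    rw [h1, h2, Pi.add_apply, h3, h4]
  have h1 : ∀ u ∈ DH, (tensor μ ν u g, tensor μ ν (H u) g + tensor μ ν u g') ∈ L.graph := by
    intro u hu
    rw [LinearPMap.mem_graph_iff] at hg
    obtain ⟨v, rfl, rfl⟩ := hg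
    have hk : Continuous fun z : Lp ℂ 2 ν × Lp ℂ 2 ν =>
      (tensor μ ν u z.1, tensor μ ν (H u) z.1 + tensor μ ν u z.2) := by fun_prop
    have h := map_mem_closure (t := (L.graph : Set _)) hk (hDK v) (by
      rintro _ ⟨v', hv', rfl⟩
      exact hcore u hu v' hv')
    rwa [hLc.closure_eq] at h
  rw [LinearPMap.mem_graph_iff] at hf
  obtain ⟨u, rfl, rfl⟩ := hf
  have hk : Continuous fun z : Lp ℂ 2 μ × Lp ℂ 2 μ =>
    (tensor μ ν z.1 g, tensor μ ν z.2 g + tensor μ ν z.1 g') := by fun_prop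
  have h := map_mem_closure (t := (L.graph : Set _)) hk (hDH u) (by
    rintro _ ⟨u', hu', rfl⟩
    exact h1 u' hu')
  rwa [hLc.closure_eq] at h

/-- The flow of the sum operator is the tensor product of the flows. -/
theorem IsSchrodingerFlow.apply_tensor (hUH : IsSchrodingerFlow H UH)
    (hUK : IsSchrodingerFlow K UK) (hUL : IsSchrodingerFlow L UL) (hH : IsSelfAdjoint H)
    (hK : IsSelfAdjoint K) (hL : IsSelfAdjoint L) (hsum : IsSumOperator H K L) (t : ℝ)
    (f : Lp ℂ 2 μ) (g : Lp ℂ 2 ν) :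
    UL t (tensor μ ν f g) = tensor μ ν (UH t f) (UK t g) := by
  have hdom : ∀ f ∈ H.domain, ∀ g ∈ K.domain,
      UL t (tensor μ ν f g) = tensor μ ν (UH t f) (UK t g) := by
    intro f hf g hg
    have hf' := H.mem_graph ⟨f, hf⟩
    have hg' := K.mem_graph ⟨g, hg⟩
    have hd : ∀ s, HasDerivAt (fun s => tensor μ ν (UH s f) (UK s g))
        (Complex.I • (tensor μ ν (UH s (H ⟨f, hf⟩)) (UK s g) +
          tensor μ ν (UH s f) (UK s (K ⟨g, hg⟩)))) s := by
      intro s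
      have h1 : HasDerivAt (fun s => tensor μ ν (UH s f) (UK s g))
          (tensor μ ν (UH s f) (Complex.I • UK s (K ⟨g, hg⟩)) +
            tensor μ ν (Complex.I • UH s (H ⟨f, hf⟩)) (UK s g)) s :=
        ((tensor μ ν).bilinearRestrictScalars ℝ).hasDerivAt_of_bilinear
          (fun _ => hUH.hasDerivAt hf' s) (fun _ => hUK.hasDerivAt hg' s)
      rwa [map_smul, map_smul, smul_apply, ← smul_add, add_comm] at h1
    have := hUL.eq_apply_of_hasDerivAt
      (fun s => hsum.tensor_mem_graph hL.isClosed (hUH.apply_mem_graph hf' s)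
        (hUK.apply_mem_graph hg' s)) hd t
    rw [hUH.zero_apply, hUK.zero_apply] at this
    exact this.symm
  -- the domains of self-adjoint operators are dense
  have h1 : ∀ f ∈ H.domain, ∀ g, UL t (tensor μ ν f g) = tensor μ ν (UH t f) (UK t g) :=
    fun f hf => congrFun (Continuous.ext_on hK.dense_domain (by fun_prop) (by fun_prop)
      fun g hg => hdom f hf g hg)
  exact congrFun (Continuous.ext_on hH.dense_domain
    (f := fun f => UL t (tensor μ ν f g)) (g := fun f => tensor μ ν (UH t f) (UK t g))
    (by fun_prop) (by fun_prop) fun f hf => h1 f hf g) f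

/-- Dispersive estimates multiply under tensor products. The adjoint of `T` maps `G ∈ L¹` to a
function whose averages over rectangles are bounded, and rectangles suffice to control its
essential supremum. -/
theorem enorm_inner_le_of_apply_tensor
    {T : Lp ℂ 2 (μ.prod ν) →L[ℂ] Lp ℂ 2 (μ.prod ν)} {P : Lp ℂ 2 μ →L[ℂ] Lp ℂ 2 μ}
    {Q : Lp ℂ 2 ν →L[ℂ] Lp ℂ 2 ν} (hT : ∀ f g, T (tensor μ ν f g) = tensor μ ν (P f) (Q g))
    {c d : ℝ≥0∞} (hc : c ≠ ∞) (hd : d ≠ ∞)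
    (hP : ∀ φ : Lp ℂ 2 μ, MemLp φ 1 μ → eLpNorm (P φ) ∞ μ ≤ c * eLpNorm φ 1 μ)
    (hQ : ∀ ψ : Lp ℂ 2 ν, MemLp ψ 1 ν → eLpNorm (Q ψ) ∞ ν ≤ d * eLpNorm ψ 1 ν)
    {F G : Lp ℂ 2 (μ.prod ν)} (hG : MemLp G 1 (μ.prod ν)) :
    ‖inner ℂ (T F) G‖ₑ ≤ c * d * (eLpNorm F 1 (μ.prod ν) * eLpNorm G 1 (μ.prod ν)) := by
  set k := T.adjoint G with hk
  set m : ℝ≥0∞ := c * d * eLpNorm G 1 (μ.prod ν) with hm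
  have hmt : m ≠ ∞ := ENNReal.mul_ne_top (ENNReal.mul_ne_top hc hd) hG.2.ne
  -- the bound for the integral of `k` over a rectangle
  have hrect : ∀ (A : Set M) (B : Set N), MeasurableSet A → MeasurableSet B → μ A ≠ ∞ → ν B ≠ ∞ →
      ‖∫ z in A ×ˢ B, k z ∂(μ.prod ν)‖ₑ ≤ m * (μ A * ν B) := by
    intro A B hA hB hμA hνB
    have hAB : (μ.prod ν) (A ×ˢ B) ≠ ∞ := by
      rw [Measure.prod_prod]; exact ENNReal.mul_ne_top hμA hνB
    set f := indicatorConstLp 2 hA hμA (1 : ℂ) with hf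
    set g := indicatorConstLp 2 hB hνB (1 : ℂ) with hg
    have hfg : indicatorConstLp 2 (hA.prod hB) hAB (1 : ℂ) = tensor μ ν f g := by
      refine Lp.ext (indicatorConstLp_coeFn.trans (EventuallyEq.trans ?_ (coeFn_tensor f g).symm))
      filter_upwards [Measure.quasiMeasurePreserving_fst.ae_eq_comp
        (indicatorConstLp_coeFn (p := 2) (hs := hA) (hμs := hμA) (c := (1 : ℂ))),
        Measure.quasiMeasurePreserving_snd.ae_eq_comp
        (indicatorConstLp_coeFn (p := 2) (hs := hB) (hμs := hνB) (c := (1 : ℂ)))] with z h1 h2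
      simp only [Function.comp_apply] at h1 h2
      rw [h1, h2]
      by_cases hz1 : z.1 ∈ A <;> by_cases hz2 : z.2 ∈ B <;> simp [hz1, hz2]
    have hf1 : eLpNorm f 1 μ = μ A := by
      rw [eLpNorm_congr_ae indicatorConstLp_coeFn,
        eLpNorm_indicator_const hA one_ne_zero ENNReal.one_ne_top]
      simp
    have hg1 : eLpNorm g 1 ν = ν B := by
      rw [eLpNorm_congr_ae indicatorConstLp_coeFn,
        eLpNorm_indicator_const hB one_ne_zero ENNReal.one_ne_top]
      simp
    have hPf : ∀ᵐ z ∂(μ.prod ν), ‖P f z.1‖ₑ ≤ c * μ A := by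
      have h1 := hP f ⟨Lp.aestronglyMeasurable f, hf1.trans_lt hμA.lt_top⟩
      rw [hf1, eLpNorm_exponent_top] at h1
      exact Measure.quasiMeasurePreserving_fst.ae ((ae_le_eLpNormEssSup (f := P f)).mono
        fun x hx => hx.trans h1)
    have hQg : ∀ᵐ z ∂(μ.prod ν), ‖Q g z.2‖ₑ ≤ d * ν B := by
      have h1 := hQ g ⟨Lp.aestronglyMeasurable g, hg1.trans_lt hνB.lt_top⟩
      rw [hg1, eLpNorm_exponent_top] at h1
      exact Measure.quasiMeasurePreserving_snd.ae ((ae_le_eLpNormEssSup (f := Q g)).mono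
        fun x hx => hx.trans h1)
    rw [← L2.inner_indicatorConstLp_one (𝕜 := ℂ) (hA.prod hB) hAB, hfg, hk,
      ContinuousLinearMap.adjoint_inner_right, hT, L2.inner_def]
    refine (enorm_integral_le_lintegral_enorm _).trans ?_
    calc ∫⁻ z, ‖inner ℂ (tensor μ ν (P f) (Q g) z) (G z)‖ₑ ∂(μ.prod ν)
        ≤ ∫⁻ z, (c * μ A) * (d * ν B) * ‖G z‖ₑ ∂(μ.prod ν) := by
          refine lintegral_mono_ae ?_
          filter_upwards [hPf, hQg, coeFn_tensor (P f) (Q g)] with z h1 h2 h3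
          refine (enorm_inner_le _ _).trans ?_
          rw [h3, enorm_mul]
          gcongr
      _ = m * (μ A * ν B) := by
          rw [lintegral_const_mul'' _ (Lp.aestronglyMeasurable G).enorm, hm,
            eLpNorm_one_eq_lintegral_enorm]
          ring
  -- exhaust the product by rectangles of finite measure
  have hbound : ∀ᵐ z ∂(μ.prod ν), ‖k z‖ ≤ m.toReal := by
    have hcover : ⋃ n, (spanningSets μ n ×ˢ spanningSets ν n) = Set.univ := by
      rw [Set.iUnion_prod_of_monotone (monotone_spanningSets μ) (monotone_spanningSets ν),
        iUnion_spanningSets, iUnion_spanningSets, Set.univ_prod_univ]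
    have hall := (ae_restrict_iUnion_iff (μ := μ.prod ν)
      (fun n => spanningSets μ n ×ˢ spanningSets ν n) (fun z => ‖k z‖ ≤ m.toReal)).2
    rw [hcover, Measure.restrict_univ] at hall
    refine hall fun n => ?_
    have hfin : (μ.prod ν) (spanningSets μ n ×ˢ spanningSets ν n) < ∞ := by
      rw [Measure.prod_prod]
      exact ENNReal.mul_lt_top (measure_spanningSets_lt_top μ n) (measure_spanningSets_lt_top ν n)
    have : IsFiniteMeasure ((μ.prod ν).restrict (spanningSets μ n ×ˢ spanningSets ν n)) :=
      ⟨by rwa [Measure.restrict_apply_univ]⟩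
    refine ae_norm_le_of_forall_rectangle
      ((Lp.memLp k).restrict _ |>.integrable (by norm_num)) ENNReal.toReal_nonneg ?_
    intro A B hA hB
    have hS := measurableSet_spanningSets μ n
    have hS' := measurableSet_spanningSets ν n
    have h1 := hrect (A ∩ spanningSets μ n) (B ∩ spanningSets ν n) (hA.inter hS) (hB.inter hS')
      (measure_inter_lt_top_of_right_ne_top (measure_spanningSets_lt_top μ n).ne).ne
      (measure_inter_lt_top_of_right_ne_top (measure_spanningSets_lt_top ν n).ne).ne
    rw [Measure.restrict_restrict (hA.prod hB), Set.prod_inter_prod, measureReal_def,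
      Measure.restrict_apply (hA.prod hB), Set.prod_inter_prod, Measure.prod_prod,
      ← ENNReal.toReal_mul, ← toReal_enorm]
    exact ENNReal.toReal_mono (ENNReal.mul_ne_top hmt (ENNReal.mul_ne_top
      (measure_inter_lt_top_of_right_ne_top (measure_spanningSets_lt_top μ n).ne).ne
      (measure_inter_lt_top_of_right_ne_top (measure_spanningSets_lt_top ν n).ne).ne)) h1
  rw [← ContinuousLinearMap.adjoint_inner_right, L2.inner_def]
  refine (enorm_integral_le_lintegral_enorm _).trans ?_
  calc ∫⁻ z, ‖inner ℂ (F z) (k z)‖ₑ ∂(μ.prod ν)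
      ≤ ∫⁻ z, m * ‖F z‖ₑ ∂(μ.prod ν) := by
        refine lintegral_mono_ae ?_
        filter_upwards [hbound] with z hz
        refine (enorm_inner_le _ _).trans ?_
        rw [mul_comm]
        gcongr
        rw [← ENNReal.ofReal_toReal hmt, ← ofReal_norm]
        exact ENNReal.ofReal_le_ofReal hz
    _ = c * d * (eLpNorm F 1 (μ.prod ν) * eLpNorm G 1 (μ.prod ν)) := by
        rw [lintegral_const_mul'' _ (Lp.aestronglyMeasurable F).enorm, hm,
          eLpNorm_one_eq_lintegral_enorm, eLpNorm_one_eq_lintegral_enorm]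
        ring

end SumOperator

/-! ### Strichartz estimates for admissible couples -/

theorem ENNReal.HolderConjugate.inv_toReal_add {p p' : ℝ≥0∞} (h : p.HolderConjugate p') :
    p⁻¹.toReal + p'⁻¹.toReal = 1 := by
  have h1 := h.inv_add_inv_eq_inv
  have h2 : p⁻¹ ≠ ∞ := ENNReal.inv_ne_top.2 h.ne_zero
  have h3 : p'⁻¹ ≠ ∞ := ENNReal.inv_ne_top.2 h.symm.ne_zero
  rw [← ENNReal.toReal_add h2 h3, h1, inv_one, ENNReal.toReal_one]

theorem ENNReal.HolderConjugate.eq_two {p : ℝ≥0∞} (h : HolderConjugate 2 p) : p = 2 := by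
  rw [h.conj_eq, ← one_add_one_eq_two, ENNReal.add_sub_cancel_right ENNReal.one_ne_top, inv_one]

namespace IsAdmissible

variable {σ : ℝ} {p q p' q' : ℝ≥0∞}

theorem pos (h : IsAdmissible σ p q) : 0 < σ := by
  rcases h.2 with h | h
  · linarith [h.1]
  · exact h.1

theorem two_le_left (h : IsAdmissible σ p q) : 2 ≤ p := by
  rcases h.2 with h | h
  · exact h.2.1
  · refine le_trans ?_ h.2.2.1.le
    rw [← ENNReal.ofReal_ofNat]
    refine ENNReal.ofReal_le_ofReal ?_
    rw [le_div_iff₀ h.1]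
    linarith [h.2.1]

theorem two_le_right (h : IsAdmissible σ p q) : 2 ≤ q := by
  rcases h.2 with h | h
  · exact h.2.2.1
  · exact h.2.2.2.1

theorem ne_top_right (h : IsAdmissible σ p q) : q ≠ ∞ := by
  rcases h.2 with h | h
  · exact ne_top_of_le_ne_top ENNReal.ofReal_ne_top h.2.2.2
  · exact h.2.2.2.2.ne

theorem eq_two_of_eq_top (h : IsAdmissible σ p q) (hp : p = ∞) : q = 2 := by
  have h1 := h.1
  rw [hp, ENNReal.inv_top, ENNReal.toReal_zero, zero_add, ENNReal.toReal_inv] at h1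
  have h2 : q.toReal = 2 := by
    have h3 : q.toReal⁻¹ = 2⁻¹ := mul_left_cancel₀ h.pos.ne' (h1.trans (div_eq_mul_inv _ _))
    exact inv_injective h3
  rw [← ENNReal.ofReal_toReal h.ne_top_right, h2, ENNReal.ofReal_ofNat]

theorem one_lt_of_eq_two (h : IsAdmissible σ p q) (hp : p = 2) : 1 < σ := by
  rcases h.2 with h1 | h1
  · exact h1.1
  · have h2 := h1.2.2.1
    rw [hp, ← ENNReal.ofReal_ofNat, ENNReal.ofReal_lt_ofReal_iff (by norm_num),
      div_lt_iff₀ h1.1] at h2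
    linarith

/-- The relation between the exponents, in terms of the dual exponent `q'` of `q`. -/
theorem mul_eq (h : IsAdmissible σ p q) (hqq : q.HolderConjugate q') :
    σ * (2 / q'.toReal - 1) = 2 * p⁻¹.toReal := by
  have h1 := h.1
  have h2 := hqq.inv_toReal_add
  rw [ENNReal.toReal_inv q'] at h2
  have : q⁻¹.toReal = 1 - q'.toReal⁻¹ := by linarith
  rw [this] at h1
  rw [div_eq_mul_inv]
  linarith

theorem one_div_eq_of_eq_two (h : IsAdmissible σ p q) (hp : p = 2) (hqq : q.HolderConjugate q') :
    1 / q'.toReal = (σ + 1) / (2 * σ) := by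
  have h1 := h.mul_eq hqq
  have hσ := h.pos
  rw [hp, ENNReal.toReal_inv, ENNReal.toReal_ofNat] at h1
  rw [eq_div_iff (by positivity)]
  linear_combination h1

theorem left_conj_ne_top (h : IsAdmissible σ p q) (hpp : p.HolderConjugate p') : p' ≠ ∞ := by
  rintro rfl
  have h1 := hpp.inv_toReal_add
  rw [ENNReal.inv_top, ENNReal.toReal_zero, add_zero] at h1
  have h2 := ENNReal.toReal_mono (by simp) (ENNReal.inv_le_inv.2 h.two_le_left)
  rw [h1, ENNReal.toReal_inv, ENNReal.toReal_ofNat] at h2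
  norm_num at h2

theorem right_conj_ne_top (h : IsAdmissible σ p q) (hqq : q.HolderConjugate q') : q' ≠ ∞ := by
  rintro rfl
  have h1 := hqq.inv_toReal_add
  rw [ENNReal.inv_top, ENNReal.toReal_zero, add_zero] at h1
  have h2 := ENNReal.toReal_mono (by simp) (ENNReal.inv_le_inv.2 h.two_le_right)
  rw [h1, ENNReal.toReal_inv, ENNReal.toReal_ofNat] at h2
  norm_num at h2

end IsAdmissible

namespace IsDispersive

variable {X : Type*} [MeasurableSpace X] {μ : Measure X} [SigmaFinite μ]
  {𝓗 : Type*} [NormedAddCommGroup 𝓗] [InnerProductSpace ℂ 𝓗] [CompleteSpace 𝓗]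
  {V : ℝ → Lp ℂ 2 μ →L[ℂ] 𝓗} {J : Set ℝ} {σ : ℝ} {A : ℝ≥0∞} {p q p' q' p₁ q₁ p₁' q₁' : ℝ≥0∞}

/-- The dual Strichartz estimate for every admissible couple: `p = ∞` is the energy bound, `p = 2` the
endpoint, and all other couples are covered by the `TT*` argument. -/
theorem exists_enorm_integral_push_le (hV : IsDispersive V J σ A) (hJ : MeasurableSet J)
    (h : IsAdmissible σ p q) (hpp : p.HolderConjugate p') (hqq : q.HolderConjugate q') :
    ∃ C : ℝ≥0∞, C ≠ ∞ ∧ ∀ F : ℝ → X → ℂ, IsTest μ J F →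
      ‖∫ t, push V F t‖ₑ ≤ C * mixedNorm μ J p' q' F := by
  rcases eq_or_ne p ∞ with hp | hp
  · have hq := h.eq_two_of_eq_top hp
    obtain rfl : p' = 1 := by rw [hpp.conj_eq, hp]; simp
    obtain rfl : q' = 2 := (hq ▸ hqq).eq_two
    exact ⟨1, ENNReal.one_ne_top, fun F hF => by
      rw [one_mul]; exact hV.enorm_integral_push_le_one_two hJ hF⟩
  rcases eq_or_ne p 2 with hp2 | hp2
  · obtain rfl : p' = 2 := (hp2 ▸ hpp).eq_two
    exact hV.exists_enorm_integral_push_le_two hJ (h.one_lt_of_eq_two hp2)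
      (h.one_div_eq_of_eq_two hp2 hqq)
  have hp2' : 2 < p := lt_of_le_of_ne h.two_le_left hp2.symm
  have hpr : 2 < p.toReal := by
    rwa [← ENNReal.toReal_ofNat 2, ENNReal.toReal_lt_toReal (by simp) hp]
  have hmul := h.mul_eq hqq
  have hpinv : p⁻¹.toReal < 1 / 2 := by
    rw [ENNReal.toReal_inv, one_div]
    exact inv_strictAnti₀ two_pos hpr
  have hpinv0 : 0 < p⁻¹.toReal := by rw [ENNReal.toReal_inv]; positivity
  have hp' := hpp.inv_toReal_add
  rw [ENNReal.toReal_inv p'] at hp'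
  have hq2 : q' < 2 := by
    have h1 : 0 < 2 / q'.toReal - 1 := by
      have : 0 < σ * (2 / q'.toReal - 1) := by rw [hmul]; positivity
      exact (pos_iff_pos_of_mul_pos this).1 h.pos
    have h2 : 0 < q'.toReal := ENNReal.toReal_pos hqq.symm.ne_zero (h.right_conj_ne_top hqq)
    rw [sub_pos, lt_div_iff₀ h2, one_mul] at h1
    rwa [← ENNReal.toReal_lt_toReal (h.right_conj_ne_top hqq) (by simp)]
  have hq1 : 1 < q' := by
    rw [hqq.conj_eq]
    refine ENNReal.lt_add_right ENNReal.one_ne_top (ENNReal.inv_ne_zero.2 ?_)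
    exact ENNReal.sub_ne_top h.ne_top_right
  exact hV.exists_enorm_integral_push_le_of_lt hJ hq1 hq2 (by rw [hmul]; positivity)
    (by rw [hmul]; linarith) (h.left_conj_ne_top hpp) (by rw [hmul, one_div]; linarith)

/-- The homogeneous Strichartz estimate for dispersive families. -/
theorem exists_mixedNorm_adjoint_le (hV : IsDispersive V J σ A) (hJ : MeasurableSet J)
    (hVa : ∀ h, Continuous fun t => (V t).adjoint h) (h : IsAdmissible σ p q) :
    ∃ C : ℝ≥0∞, C ≠ ∞ ∧ ∀ f, mixedNorm μ J p q (fun t => (V t).adjoint f) ≤ C * ‖f‖ₑ := by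
  rcases eq_or_ne p ∞ with hp | hp
  · rw [h.eq_two_of_eq_top hp, hp]
    exact ⟨1, ENNReal.one_ne_top, fun f => by
      rw [one_mul]; exact mixedNorm_top_two_le fun t => hV.enorm_adjoint_le t f⟩
  have hpp := ENNReal.HolderConjugate.conjExponent (one_le_two.trans h.two_le_left)
  have hqq := ENNReal.HolderConjugate.conjExponent (one_le_two.trans h.two_le_right)
  obtain ⟨C, hC, hF⟩ := hV.exists_enorm_integral_push_le hJ h hpp hqq
  exact ⟨C, hC, hV.mixedNorm_adjoint_le hJ hVa h.two_le_left hp h.two_le_right h.ne_top_right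
    hpp hqq hF⟩

/-- The bilinear form of the retarded operator: away from the double endpoint it is dominated by
the bilinear form without the restriction `s < t`. -/
theorem exists_enorm_pairing_lt_le_of_isAdmissible (hV : IsDispersive V J σ A)
    (hJ : MeasurableSet J) (h : IsAdmissible σ p q) (hpp : p.HolderConjugate p')
    (hqq : q.HolderConjugate q') (h₁ : IsAdmissible σ p₁ q₁) (hpp₁ : p₁.HolderConjugate p₁')
    (hqq₁ : q₁.HolderConjugate q₁') :
    ∃ C : ℝ≥0∞, C ≠ ∞ ∧ ∀ F G : ℝ → X → ℂ, IsTest μ J F → IsTest μ J G →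
      ‖pairing (push V F) (push V G) {z | z.1 < z.2}‖ₑ ≤
        C * (mixedNorm μ J p₁' q₁' F * mixedNorm μ J p' q' G) := by
  by_cases h2 : p = 2 ∧ p₁ = 2
  · obtain ⟨hp, hp₁⟩ := h2
    have hq := h.one_div_eq_of_eq_two hp hqq
    obtain rfl : q' = q₁' := by
      rw [← ENNReal.toReal_eq_toReal_iff' (h.right_conj_ne_top hqq) (h₁.right_conj_ne_top hqq₁)]
      have := hq.trans (h₁.one_div_eq_of_eq_two hp₁ hqq₁).symm
      rw [one_div, one_div] at this
      exact inv_injective this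
    obtain rfl : p' = 2 := (hp ▸ hpp).eq_two
    obtain rfl : p₁' = 2 := (hp₁ ▸ hpp₁).eq_two
    exact hV.exists_enorm_pairing_lt_le_two hJ (h.one_lt_of_eq_two hp) hq
  · obtain ⟨C, hC, hF⟩ := hV.exists_enorm_integral_push_le hJ h hpp hqq
    obtain ⟨C₁, hC₁, hF₁⟩ := hV.exists_enorm_integral_push_le hJ h₁ hpp₁ hqq₁
    refine hV.exists_enorm_pairing_lt_le hJ hpp₁.symm.ne_zero (h₁.left_conj_ne_top hpp₁)
      hqq₁.symm.ne_zero (h₁.right_conj_ne_top hqq₁) ?_ (h.left_conj_ne_top hpp) ?_ hC₁ hC hF₁ hF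
    · rw [hpp.conj_eq]
      exact le_self_add
    have hle : ∀ {r s : ℝ≥0∞}, IsAdmissible σ r s → r⁻¹.toReal ≤ 1 / 2 ∧
        (r ≠ 2 → r⁻¹.toReal < 1 / 2) := by
      intro r s hr
      have h3 : (2 : ℝ≥0∞)⁻¹.toReal = 1 / 2 := by simp
      rw [← h3]
      refine ⟨ENNReal.toReal_mono (by simp) (ENNReal.inv_le_inv.2 hr.two_le_left), fun hr2 =>
        ENNReal.toReal_strict_mono (by simp) (ENNReal.inv_lt_inv.2
          (lt_of_le_of_ne hr.two_le_left hr2.symm))⟩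
    have e := hpp.inv_toReal_add
    have e₁ := hpp₁.inv_toReal_add
    rw [ENNReal.toReal_inv p'] at e
    rw [ENNReal.toReal_inv p₁'] at e₁
    -- the sum of the inverse dual exponents exceeds `1` unless both `p` and `p₁` are `2`
    rw [one_div, one_div]
    rcases not_and_or.1 h2 with h2 | h2
    · linarith [(hle h).2 h2, (hle h₁).1]
    · linarith [(hle h).1, (hle h₁).2 h2]

/-- The advanced bilinear form is the retarded one with the functions exchanged. -/
theorem exists_enorm_pairing_gt_le_of_isAdmissible (hV : IsDispersive V J σ A)
    (hJ : MeasurableSet J) (h : IsAdmissible σ p q) (hpp : p.HolderConjugate p')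
    (hqq : q.HolderConjugate q') (h₁ : IsAdmissible σ p₁ q₁) (hpp₁ : p₁.HolderConjugate p₁')
    (hqq₁ : q₁.HolderConjugate q₁') :
    ∃ C : ℝ≥0∞, C ≠ ∞ ∧ ∀ F G : ℝ → X → ℂ, IsTest μ J F → IsTest μ J G →
      ‖pairing (push V F) (push V G) {z | z.2 < z.1}‖ₑ ≤
        C * (mixedNorm μ J p₁' q₁' F * mixedNorm μ J p' q' G) := by
  obtain ⟨C, hC, hFG⟩ := hV.exists_enorm_pairing_lt_le_of_isAdmissible hJ h₁ hpp₁ hqq₁ h hpp hqq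
  refine ⟨C, hC, fun F G hF hG => ?_⟩
  have := hFG G F hG hF
  rwa [← enorm_pairing_swap, mul_comm (mixedNorm μ J p' q' G)] at this

/-- The inhomogeneous estimate for the part of the time line where `R` holds: `w t` is the weak
integral of `V s (F s)` over those `s ∈ J` with `(s, t) ∈ R`. -/
theorem exists_inhomogeneous_of_isAdmissible (hV : IsDispersive V J σ A) (hJ : MeasurableSet J)
    (hVa : ∀ h, Continuous fun t => (V t).adjoint h) (h : IsAdmissible σ p q)
    (h₁ : IsAdmissible σ p₁ q₁) {R : Set (ℝ × ℝ)}
    (hR : R = {z | z.1 < z.2} ∨ R = {z | z.2 < z.1}) :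
    ∃ C : ℝ≥0∞, C ≠ ∞ ∧ ∀ F : ℝ → X → ℂ, StronglyMeasurable (Function.uncurry F) →
      mixedNorm μ J p₁.conjExponent q₁.conjExponent F ≠ ∞ →
      ∃ w : ℝ → 𝓗, (∀ t h, (∀ᵐ s ∂(volume.restrict (J ∩ {s | (s, t) ∈ R})),
        Integrable (fun x => conj ((V s).adjoint h x) * F s x) μ) ∧
      IntegrableOn (fun s => ∫ x, conj ((V s).adjoint h x) * F s x ∂μ) (J ∩ {s | (s, t) ∈ R}) ∧
      inner ℂ h (w t) = ∫ s in J ∩ {s | (s, t) ∈ R}, ∫ x, conj ((V s).adjoint h x) * F s x ∂μ) ∧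
      mixedNorm μ J p q (fun t => (V t).adjoint (w t)) ≤
        C * mixedNorm μ J p₁.conjExponent q₁.conjExponent F := by
  have hpp := ENNReal.HolderConjugate.conjExponent (one_le_two.trans h.two_le_left)
  have hqq := ENNReal.HolderConjugate.conjExponent (one_le_two.trans h.two_le_right)
  have hpp₁ := ENNReal.HolderConjugate.conjExponent (one_le_two.trans h₁.two_le_left)
  have hqq₁ := ENNReal.HolderConjugate.conjExponent (one_le_two.trans h₁.two_le_right)
  obtain ⟨C₁, hC₁, hhom⟩ := hV.exists_mixedNorm_adjoint_le hJ hVa h₁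
  have hpair : ∃ C : ℝ≥0∞, C ≠ ∞ ∧ ∀ F G : ℝ → X → ℂ, IsTest μ J F → IsTest μ J G →
      ‖pairing (push V F) (push V G) R‖ₑ ≤ C * (mixedNorm μ J p₁.conjExponent q₁.conjExponent F *
        mixedNorm μ J p.conjExponent q.conjExponent G) := by
    rcases hR with rfl | rfl
    · exact hV.exists_enorm_pairing_lt_le_of_isAdmissible hJ h hpp hqq h₁ hpp₁ hqq₁
    · exact hV.exists_enorm_pairing_gt_le_of_isAdmissible hJ h hpp hqq h₁ hpp₁ hqq₁
  obtain ⟨C₂, hC₂, hpair⟩ := hpair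
  have hRm : MeasurableSet R := by
    rcases hR with rfl | rfl
    · exact measurableSet_lt measurable_fst measurable_snd
    · exact measurableSet_lt measurable_snd measurable_fst
  exact ⟨C₁ + C₂, ENNReal.add_ne_top.2 ⟨hC₁, hC₂⟩, fun F hF hfin =>
    hV.exists_inhomogeneous hJ hVa h.two_le_left h.two_le_right h.ne_top_right
      h.eq_two_of_eq_top hpp hqq hpp₁ hqq₁ h₁.ne_top_right (h₁.left_conj_ne_top hpp₁)
      (h₁.right_conj_ne_top hqq₁) hRm hC₁ hhom hpair hF hfin⟩

end IsDispersive

/-! ### From dispersive flows to the Duhamel integral -/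

theorem eLpNorm_restrict_union_le {α : Type*} [MeasurableSpace α] {m : Measure α}
    {f : α → ℝ≥0∞} {p : ℝ≥0∞} (hp : 1 ≤ p) (s t : Set α) :
    eLpNorm f p (m.restrict (s ∪ t)) ≤ eLpNorm f p (m.restrict s) + eLpNorm f p (m.restrict t) := by
  rcases eq_or_ne p ∞ with rfl | hp'
  · simp only [eLpNorm_exponent_top]
    refine eLpNormEssSup_le_of_ae_enorm_bound ?_
    rw [ae_restrict_union_eq, eventually_sup]
    exact ⟨ae_le_eLpNormEssSup.mono fun x hx => hx.trans le_self_add,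
      ae_le_eLpNormEssSup.mono fun x hx => hx.trans le_add_self⟩
  · have hp0 : p ≠ 0 := (zero_lt_one.trans_le hp).ne'
    have hpr : 1 ≤ p.toReal := by
      rw [← ENNReal.toReal_one]; exact ENNReal.toReal_mono hp' hp
    simp only [eLpNorm_eq_lintegral_rpow_enorm_toReal hp0 hp']
    exact (ENNReal.rpow_le_rpow (lintegral_union_le _ _ _) (by positivity)).trans
      (ENNReal.rpow_add_le_add_rpow _ _ (by positivity) ((div_le_one (by positivity)).2 hpr))

section

variable {X : Type*} [MeasurableSpace X] {μ : Measure X}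

/-- The instant `t = 0` is negligible, so that the norm over `I` is controlled by the norms over
positive and over negative times. -/
theorem mixedNorm_le_add {I : Set ℝ} {p q : ℝ≥0∞} (hp : 1 ≤ p) (F : ℝ → X → ℂ) :
    mixedNorm μ I p q F ≤
      mixedNorm μ (I ∩ Set.Ioi 0) p q F + mixedNorm μ (I ∩ Set.Iio 0) p q F := by
  have : (I : Set ℝ) =ᵐ[volume] (I ∩ Set.Ioi 0 ∪ I ∩ Set.Iio 0 : Set ℝ) := by
    rw [← Set.inter_union_distrib_left, Set.union_comm, Set.Iio_union_Ioi, ← Set.sdiff_eq]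
    exact (sdiff_null_ae_eq_self (by simp)).symm
  rw [mixedNorm, Measure.restrict_congr_set this]
  exact eLpNorm_restrict_union_le hp _ _

theorem mixedNorm_mono_set {J I : Set ℝ} (h : J ⊆ I) (p q : ℝ≥0∞) (F : ℝ → X → ℂ) :
    mixedNorm μ J p q F ≤ mixedNorm μ I p q F :=
  eLpNorm_mono_measure _ (Measure.restrict_mono h le_rfl)

theorem mixedNorm_congr {J : Set ℝ} {p q : ℝ≥0∞} {F G : ℝ → X → ℂ}
    (h : ∀ᵐ t ∂(volume.restrict J), F t =ᵐ[μ] G t) : mixedNorm μ J p q F = mixedNorm μ J p q G :=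
  eLpNorm_congr_ae (h.mono fun _ ht => eLpNorm_congr_ae ht)

namespace IsSchrodingerFlow

variable {L : Lp ℂ 2 μ →ₗ.[ℂ] Lp ℂ 2 μ} {U : ℝ → Lp ℂ 2 μ →L[ℂ] Lp ℂ 2 μ}

theorem adjoint_neg (hU : IsSchrodingerFlow L U) (t : ℝ) : (U (-t)).adjoint = U t := by
  rw [hU.adjoint_eq, neg_neg]

/-- A dispersive estimate for `U` at the times in `I` is one for the family `t ↦ U (-t)` on every
set `J` whose differences belong to `I` up to sign. -/
theorem isDispersive (hU : IsSchrodingerFlow L U) {I J : Set ℝ} {σ : ℝ} (hσ : 0 < σ) {A : ℝ≥0∞}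
    (hA : A ≠ ∞) (hA0 : A ≠ 0)
    (hdisp : ∀ t ∈ I, t ≠ 0 → ∀ φ ψ : Lp ℂ 2 μ, MemLp φ 1 μ → MemLp ψ 1 μ →
      ‖inner ℂ (U t φ) ψ‖ₑ ≤
        A * ENNReal.ofReal |t| ^ (-σ) * (eLpNorm φ 1 μ * eLpNorm ψ 1 μ))
    (hJ : ∀ s ∈ J, ∀ t ∈ J, s ≠ t → s - t ∈ I ∨ t - s ∈ I) : IsDispersive (fun t => U (-t)) J σ A where
  norm_le t φ := (hU.enorm_apply _ _).le
  cont φ := (hU.continuous φ).comp continuous_neg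
  ne_top := hA
  disp s hs t ht φ ψ hφ hψ := by
    -- move `U (-s)` to the other side as `U s`
    have key : ∀ s t : ℝ, s ≠ t → t - s ∈ I → ∀ φ ψ : Lp ℂ 2 μ, MemLp φ 1 μ → MemLp ψ 1 μ →
        ‖inner ℂ (U (-s) φ) (U (-t) ψ)‖ₑ ≤
          A * ENNReal.ofReal |s - t| ^ (-σ) * (eLpNorm φ 1 μ * eLpNorm ψ 1 μ) := by
      intro s t hne hst φ ψ hφ hψ
      have h := hdisp _ hst (sub_ne_zero.2 hne.symm) φ ψ hφ hψ
      rw [sub_eq_add_neg, hU.add_apply, hU.inner_apply_left] at h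
      rw [abs_sub_comm]
      exact h
    rcases eq_or_ne s t with rfl | hne
    · -- for `s = t` the right hand side is infinite, unless a factor vanishes
      rw [sub_self, abs_zero, ENNReal.ofReal_zero, ENNReal.zero_rpow_of_neg (neg_neg_of_pos hσ),
        ENNReal.mul_top hA0]
      rcases eq_or_ne (eLpNorm φ 1 μ * eLpNorm ψ 1 μ) 0 with h0 | h0
      · have hzero : ∀ f : Lp ℂ 2 μ, eLpNorm f 1 μ = 0 → f = 0 := fun f hf =>
          (Lp.eq_zero_iff_ae_eq_zero).2
            ((eLpNorm_eq_zero_iff (Lp.aestronglyMeasurable f) one_ne_zero).1 hf)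
        rcases mul_eq_zero.1 h0 with h | h
        · simp [hzero φ h]
        · simp [hzero ψ h]
      · rw [ENNReal.top_mul h0]
        exact le_top
    rcases hJ s hs t ht hne with h | h
    · rw [← inner_conj_symm, RCLike.enorm_conj, abs_sub_comm, mul_comm (eLpNorm φ 1 μ)]
      exact key t s hne.symm h ψ φ hψ hφ
    · exact key s t hne h φ ψ hφ hψ

variable [SigmaFinite μ]

/-- The homogeneous estimate for a flow, from the dispersive families of positive and of negative times. -/
theorem exists_mixedNorm_le (hU : IsSchrodingerFlow L U) {I : Set ℝ} (hI : MeasurableSet I)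
    {σ : ℝ} {A : ℝ≥0∞} (hpos : IsDispersive (fun t => U (-t)) (I ∩ Set.Ioi 0) σ A)
    (hneg : IsDispersive (fun t => U (-t)) (I ∩ Set.Iio 0) σ A) {p q : ℝ≥0∞}
    (h : IsAdmissible σ p q) :
    ∃ C : ℝ≥0, ∀ f : Lp ℂ 2 μ, mixedNorm μ I p q (fun t => U t f) ≤ C * eLpNorm f 2 μ := by
  have hVa : ∀ f, Continuous fun t => (U (-t)).adjoint f := fun f => by
    simpa only [hU.adjoint_neg] using hU.continuous f
  obtain ⟨C, hC, hCf⟩ :=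
    hpos.exists_mixedNorm_adjoint_le (hI.inter measurableSet_Ioi) hVa h
  obtain ⟨C', hC', hCf'⟩ :=
    hneg.exists_mixedNorm_adjoint_le (hI.inter measurableSet_Iio) hVa h
  simp only [hU.adjoint_neg] at hCf hCf'
  refine ⟨(C + C').toNNReal, fun f => ?_⟩
  rw [ENNReal.coe_toNNReal (ENNReal.add_ne_top.2 ⟨hC, hC'⟩), add_mul, ← Lp.enorm_def]
  exact (mixedNorm_le_add (one_le_two.trans h.two_le_left) _).trans (add_le_add (hCf f) (hCf' f))

omit [SigmaFinite μ] in
/-- Only the values of `F` up to null sets matter for the Duhamel integral. -/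
theorem _root_.IsDuhamelIntegral.congr {F G : ℝ → X → ℂ} {t : ℝ} {v : Lp ℂ 2 μ}
    (h : IsDuhamelIntegral U F t v)
    (hFG : ∀ᵐ s ∂(volume.restrict (Set.uIoc 0 t)), F s =ᵐ[μ] G s) : IsDuhamelIntegral U G t v := by
  intro g
  obtain ⟨h1, h2, h3⟩ := h g
  have hint : ∀ᵐ s ∂(volume.restrict (Set.uIoc 0 t)), ∫ z, conj (U (s - t) g z) * F s z ∂μ =
      ∫ z, conj (U (s - t) g z) * G s z ∂μ := by
    filter_upwards [hFG] with s hs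
    exact integral_congr_ae (hs.mono fun z hz => by simp only [hz])
  refine ⟨?_, h2.congr_ae hint, h3.trans (intervalIntegral.integral_congr_ae_restrict hint)⟩
  filter_upwards [h1, hFG] with s hs hs'
  exact hs.congr (hs'.mono fun z hz => by simp only [hz])

omit [SigmaFinite μ] in
/-- Weak integrals of `U (-s) (F s)` over the interval between `0` and `t` are transported to the
Duhamel integral by `U t`; the sign is that of the oriented interval. -/
theorem isDuhamelIntegral_of_ae_eq (hU : IsSchrodingerFlow L U) {F : ℝ → X → ℂ} {t : ℝ}
    {E : Set ℝ} (hE : E =ᵐ[volume] Set.uIoc 0 t) {w : Lp ℂ 2 μ}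
    (hw : ∀ h : Lp ℂ 2 μ, (∀ᵐ s ∂(volume.restrict E), Integrable (fun x => conj (U s h x) * F s x) μ) ∧
      IntegrableOn (fun s => ∫ x, conj (U s h x) * F s x ∂μ) E ∧
      inner ℂ h w = ∫ s in E, ∫ x, conj (U s h x) * F s x ∂μ) :
    IsDuhamelIntegral U F t (if 0 ≤ t then U t w else -U t w) := by
  intro g
  obtain ⟨h1, h2, h3⟩ := hw (U (-t) g)
  rw [IntegrableOn, Measure.restrict_congr_set hE] at h2
  rw [Measure.restrict_congr_set hE] at h1 h3
  simp only [← hU.add_apply, ← sub_eq_add_neg] at h1 h2 h3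
  rw [hU.inner_apply_left, neg_neg] at h3
  refine ⟨h1, intervalIntegrable_iff.2 h2, ?_⟩
  rw [intervalIntegral.intervalIntegral_eq_integral_uIoc, ← h3]
  split_ifs
  · rw [one_smul]
  · rw [inner_neg_right, neg_one_smul]

/-- The inhomogeneous estimate for a flow. For `t > 0` the Duhamel integral is `U t` applied to the
weak integral of `U (-s) (F s)` over `0 < s < t`, a retarded integral; for `t < 0` it is minus an
advanced one. -/
theorem exists_isDuhamelIntegral (hU : IsSchrodingerFlow L U) {I : Set ℝ} (hI : I.OrdConnected)
    (hI0 : ∀ t ∈ I, Set.uIoc 0 t ∩ {0}ᶜ ⊆ I) {σ : ℝ} {A : ℝ≥0∞}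
    (hpos : IsDispersive (fun t => U (-t)) (I ∩ Set.Ioi 0) σ A)
    (hneg : IsDispersive (fun t => U (-t)) (I ∩ Set.Iio 0) σ A) {p q p₁ q₁ : ℝ≥0∞}
    (h : IsAdmissible σ p q) (h₁ : IsAdmissible σ p₁ q₁) :
    ∃ C : ℝ≥0, ∀ F : ℝ → X → ℂ,
      AEStronglyMeasurable (Function.uncurry F) ((volume.restrict I).prod μ) →
      mixedNorm μ I p₁.conjExponent q₁.conjExponent F < ∞ →
      ∃ u : ℝ → Lp ℂ 2 μ, (∀ t ∈ I, IsDuhamelIntegral U F t (u t)) ∧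
        mixedNorm μ I p q (fun t => u t) ≤ C * mixedNorm μ I p₁.conjExponent q₁.conjExponent F := by
  have hVa : ∀ f, Continuous fun t => (U (-t)).adjoint f := fun f => by
    simpa only [hU.adjoint_neg] using hU.continuous f
  obtain ⟨C, hC, hCF⟩ := hpos.exists_inhomogeneous_of_isAdmissible
    (hI.measurableSet.inter measurableSet_Ioi) hVa h h₁ (Or.inl rfl)
  obtain ⟨C', hC', hCF'⟩ := hneg.exists_inhomogeneous_of_isAdmissible
    (hI.measurableSet.inter measurableSet_Iio) hVa h h₁ (Or.inr rfl)
  simp only [hU.adjoint_neg, Set.mem_ofPred_eq] at hCF hCF'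
  refine ⟨(C + C').toNNReal, fun F hF hfin => ?_⟩
  -- a jointly measurable representative
  set G : ℝ → X → ℂ := Function.curry (hF.mk _) with hG
  have hGm : StronglyMeasurable (Function.uncurry G) := by
    rw [hG, Function.uncurry_curry]
    exact hF.stronglyMeasurable_mk
  have hFG : ∀ᵐ t ∂(volume.restrict I), F t =ᵐ[μ] G t := Measure.ae_ae_of_ae_prod hF.ae_eq_mk
  have hnorm := mixedNorm_congr (p := p₁.conjExponent) (q := q₁.conjExponent) hFG
  rw [hnorm] at hfin ⊢
  have hle : ∀ S : Set ℝ, mixedNorm μ (I ∩ S) p₁.conjExponent q₁.conjExponent G ≤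
      mixedNorm μ I p₁.conjExponent q₁.conjExponent G :=
    fun S => mixedNorm_mono_set Set.inter_subset_left _ _ _
  obtain ⟨w, hw, hwn⟩ := hCF G hGm ((hle _).trans_lt hfin).ne
  obtain ⟨w', hw', hwn'⟩ := hCF' G hGm ((hle _).trans_lt hfin).ne
  refine ⟨fun t => if 0 ≤ t then U t (w t) else -U t (w' t), fun t ht => ?_, ?_⟩
  · have hsub : ∀ᵐ s ∂(volume.restrict (Set.uIoc 0 t)), G s =ᵐ[μ] F s := by
      have h0 : (Set.uIoc 0 t ∩ {0}ᶜ : Set ℝ) =ᵐ[volume] Set.uIoc 0 t := by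
        rw [← Set.sdiff_eq]
        exact sdiff_null_ae_eq_self (by simp)
      rw [← Measure.restrict_congr_set h0]
      exact (ae_restrict_of_ae_restrict_of_subset (hI0 t ht) hFG).mono fun s hs => hs.symm
    refine IsDuhamelIntegral.congr ?_ hsub
    rcases le_or_gt 0 t with h0 | h0
    · have hE : (I ∩ Set.Ioi 0 ∩ {s | s < t} : Set ℝ) = Set.Ioo 0 t := by
        ext s
        refine ⟨fun hs => ⟨hs.1.2, hs.2⟩, fun hs => ⟨⟨hI0 t ht ⟨?_, hs.1.ne'⟩, hs.1⟩, hs.2⟩⟩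
        rw [Set.uIoc_of_le h0]
        exact ⟨hs.1, hs.2.le⟩
      have := hU.isDuhamelIntegral_of_ae_eq (E := I ∩ Set.Ioi 0 ∩ {s | s < t}) (t := t)
        (by rw [hE, Set.uIoc_of_le h0]; exact Ioo_ae_eq_Ioc) (hw t)
      simpa only [if_pos h0] using this
    · have hE : (I ∩ Set.Iio 0 ∩ {s | t < s} : Set ℝ) = Set.Ioo t 0 := by
        ext s
        refine ⟨fun hs => ⟨hs.2, hs.1.2⟩, fun hs => ⟨⟨hI0 t ht ⟨?_, hs.2.ne⟩, hs.2⟩, hs.1⟩⟩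
        rw [Set.uIoc_of_ge h0.le]
        exact ⟨hs.1, hs.2.le⟩
      have := hU.isDuhamelIntegral_of_ae_eq (E := I ∩ Set.Iio 0 ∩ {s | t < s}) (t := t)
        (by rw [hE, Set.uIoc_of_ge h0.le]; exact Ioo_ae_eq_Ioc) (hw' t)
      simpa only [if_neg h0.not_ge] using this
  · rw [ENNReal.coe_toNNReal (ENNReal.add_ne_top.2 ⟨hC, hC'⟩), add_mul]
    refine (mixedNorm_le_add (one_le_two.trans h.two_le_left) _).trans (add_le_add ?_ ?_)
    · refine (mixedNorm_congr ?_).trans_le (hwn.trans (mul_le_mul_right (hle _) C))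
      filter_upwards [ae_restrict_mem (hI.measurableSet.inter measurableSet_Ioi)] with t ht
      rw [if_pos (le_of_lt ht.2)]
    · refine Eq.trans_le ?_ (hwn'.trans (mul_le_mul_right (hle _) C'))
      refine eLpNorm_congr_ae ?_
      filter_upwards [ae_restrict_mem (hI.measurableSet.inter measurableSet_Iio)] with t ht
      rw [if_neg (not_le.2 ht.2), eLpNorm_congr_ae (Lp.coeFn_neg _), eLpNorm_neg]

end IsSchrodingerFlow

end

theorem proposition2 {M N : Type*} [MeasurableSpace M] [MeasurableSpace N]
    (μ : Measure M) (ν : Measure N) [SigmaFinite μ] [SigmaFinite ν]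
    (H : Lp ℂ 2 μ →ₗ.[ℂ] Lp ℂ 2 μ) (K : Lp ℂ 2 ν →ₗ.[ℂ] Lp ℂ 2 ν)
    (L : Lp ℂ 2 (μ.prod ν) →ₗ.[ℂ] Lp ℂ 2 (μ.prod ν))
    (hH : IsSelfAdjoint H) (hK : IsSelfAdjoint K) (hL : IsSelfAdjoint L)
    (hsum : IsSumOperator H K L)
    (UH : ℝ → Lp ℂ 2 μ →L[ℂ] Lp ℂ 2 μ) (UK : ℝ → Lp ℂ 2 ν →L[ℂ] Lp ℂ 2 ν)
    (UL : ℝ → Lp ℂ 2 (μ.prod ν) →L[ℂ] Lp ℂ 2 (μ.prod ν))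
    (hUH : IsSchrodingerFlow H UH) (hUK : IsSchrodingerFlow K UK)
    (hUL : IsSchrodingerFlow L UL)
    (I : Set ℝ) (hI : I.OrdConnected) (hI0 : (0 : ℝ) ∈ closure I)
    (a b : ℝ) (ha : 0 ≤ a) (hb : 0 ≤ b)
    (hdispH : DispersiveEstimate UH I a ∞ 1) (hdispK : DispersiveEstimate UK I b ∞ 1) :
    (∀ p q : ℝ≥0∞, IsAdmissible (a + b) p q →
      ∃ C : ℝ≥0, ∀ f : Lp ℂ 2 (μ.prod ν),
        mixedNorm (μ.prod ν) I p q (fun t => UL t f) ≤ C * eLpNorm f 2 (μ.prod ν)) ∧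
    (∀ p q p₁ q₁ : ℝ≥0∞, IsAdmissible (a + b) p q → IsAdmissible (a + b) p₁ q₁ →
      ∃ C : ℝ≥0, ∀ F : ℝ → M × N → ℂ,
        AEStronglyMeasurable (Function.uncurry F) ((volume.restrict I).prod (μ.prod ν)) →
        mixedNorm (μ.prod ν) I p₁.conjExponent q₁.conjExponent F < ∞ →
        ∃ u : ℝ → Lp ℂ 2 (μ.prod ν),
          (∀ t ∈ I, IsDuhamelIntegral UL F t (u t)) ∧
          mixedNorm (μ.prod ν) I p q (fun t => u t) ≤
            C * mixedNorm (μ.prod ν) I p₁.conjExponent q₁.conjExponent F) := by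
  by_cases hσ : 0 < a + b
  swap
  · exact ⟨fun p q h => absurd h.pos hσ, fun p q p₁ q₁ h => absurd h.pos hσ⟩
  -- the half open intervals between the times of `I` and `0`
  have hIpos : ∀ t ∈ I, 0 < t → Set.Ioc 0 t ⊆ I := by
    intro t ht ht0 s hs
    obtain ⟨r, hr, hrs⟩ := mem_closure_iff.1 hI0 (Set.Iio s) isOpen_Iio hs.1
    exact hI.out hrs ht ⟨(Set.mem_Iio.1 hr).le, hs.2⟩
  have hIneg : ∀ t ∈ I, t < 0 → Set.Ico t 0 ⊆ I := by
    intro t ht ht0 s hs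
    obtain ⟨r, hr, hrs⟩ := mem_closure_iff.1 hI0 (Set.Ioi s) isOpen_Ioi hs.2
    exact hI.out ht hrs ⟨hs.1, (Set.mem_Ioi.1 hr).le⟩
  obtain ⟨c, hc⟩ := hdispH
  obtain ⟨d, hd⟩ := hdispK
  -- the constant must not vanish: for equal times the right hand side of the dispersive estimate is to
  -- be infinite
  set A : ℝ≥0∞ := max 1 (c * d) with hA
  have hAt : A ≠ ∞ := max_ne_top ENNReal.one_ne_top (ENNReal.mul_ne_top (by simp) (by simp))
  have hA0 : A ≠ 0 := (zero_lt_one.trans_le (le_max_left _ _)).ne'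
  have hdisp : ∀ t ∈ I, t ≠ 0 → ∀ φ ψ : Lp ℂ 2 (μ.prod ν), MemLp φ 1 (μ.prod ν) →
      MemLp ψ 1 (μ.prod ν) → ‖inner ℂ (UL t φ) ψ‖ₑ ≤ A * ENNReal.ofReal |t| ^ (-(a + b)) *
        (eLpNorm φ 1 (μ.prod ν) * eLpNorm ψ 1 (μ.prod ν)) := by
    intro t ht ht0 φ ψ _ hψ
    refine (enorm_inner_le_of_apply_tensor
      (hUH.apply_tensor hUK hUL hH hK hL hsum t) (ENNReal.mul_ne_top (by simp) (by simp))
      (ENNReal.mul_ne_top (by simp) (by simp)) (hc t ht ht0) (hd t ht ht0) hψ).trans ?_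
    have h0 : 0 < |t| := abs_pos.2 ht0
    have e : ENNReal.ofReal |t| ^ (-(a + b)) =
        ENNReal.ofReal (|t| ^ (-a)) * ENNReal.ofReal (|t| ^ (-b)) := by
      rw [ENNReal.ofReal_rpow_of_pos h0, ← ENNReal.ofReal_mul (by positivity),
        ← Real.rpow_add h0, neg_add]
    rw [e, mul_mul_mul_comm (c : ℝ≥0∞)]
    gcongr
    exact le_max_right _ _
  have hpos : IsDispersive (fun t => UL (-t)) (I ∩ Set.Ioi 0) (a + b) A := by
    refine hUL.isDispersive hσ hAt hA0 hdisp fun s hs t ht hst => ?_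
    have hs0 : 0 < s := hs.2
    have ht0 : 0 < t := ht.2
    rcases lt_or_gt_of_ne hst with h | h
    · exact Or.inr (hIpos t ht.1 ht0 ⟨sub_pos.2 h, by linarith⟩)
    · exact Or.inl (hIpos s hs.1 hs0 ⟨sub_pos.2 h, by linarith⟩)
  have hneg : IsDispersive (fun t => UL (-t)) (I ∩ Set.Iio 0) (a + b) A := by
    refine hUL.isDispersive hσ hAt hA0 hdisp fun s hs t ht hst => ?_
    have hs0 : s < 0 := hs.2
    have ht0 : t < 0 := ht.2
    rcases lt_or_gt_of_ne hst with h | h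
    · exact Or.inl (hIneg s hs.1 hs0 ⟨by linarith, sub_neg.2 h⟩)
    · exact Or.inr (hIneg t ht.1 ht0 ⟨by linarith, sub_neg.2 h⟩)
  have hI1 : ∀ t ∈ I, Set.uIoc 0 t ∩ {0}ᶜ ⊆ I := by
    intro t ht s hs
    rcases lt_trichotomy 0 t with h0 | rfl | h0
    · rw [Set.uIoc_of_le h0.le] at hs
      exact hIpos t ht h0 hs.1
    · simp at hs
    · rw [Set.uIoc_of_ge h0.le] at hs
      exact hIneg t ht h0 ⟨hs.1.1.le, lt_of_le_of_ne hs.1.2 hs.2⟩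
  exact ⟨fun p q h => hUL.exists_mixedNorm_le hI.measurableSet hpos hneg h,
    fun p q p₁ q₁ h h₁ => hUL.exists_isDuhamelIntegral hI hI1 hpos hneg h h₁⟩
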